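/- **Setting.** For $n\le 1$ let $V_n=\mathbb{R}^d$ (Euclidean norm). For $n\le 0$ let $\Omega_n\subset V_n$ be an open neighbourhood of $0$ and let $f_n\colon\Omega_n\to V_{n+1}$ be a $C^{1}$ diffeomorphism onto its image with $f_n(0)=0$ and $Df_n$ $\alpha$-Hölder, $\alpha\in(0,1]$; $|Dg|_\alpha$ denotes the $\alpha$-Hölder seminorm of $Dg$ on the domain of $g$. Let $V_n=E_n^u\oplus E_n^s$ be a splitting with $Df_n(0)E_n^{\sigma}=E_{n+1}^{\sigma}$ ($\sigma=u,s$), and let $\lambda_n^u,\lambda_n^s\in\mathbb{R}$, $\theta_n,\beta_n>0$ satisfy, for all $v_u\in E^u_n$, $v_s\in E^s_n$: $\|Df_n(0)v_u\|\ge e^{\lambda_n^u}\|v_u\|$, $\|Df_n(0)v_s\|\le e^{\lambda_n^s}\|v_s\|$, $\measuredangle(v_u,v_s)\ge\theta_n$ (if $v_u,v_s\ne0$), $\max(1,|Df_n|_\alpha)\le\beta_n\sin\theta_{n+1}$, and $|\lambda_n^u|,|\lambda_n^s|\le L$, $\beta_{n+1}\le e^L\beta_n$. Let $\Delta_n=\max(0,(\lambda_n^s-\lambda_n^u)/\alpha)$.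 Given a threshold $\bar\beta$, let $\lambda_n^e=\lambda_n^u-\Delta_n$ if $\beta_n\le\bar\beta$ and $\lambda_n^e=\min(\lambda_n^u-\Delta_n,\frac1\alpha\log\frac{\beta_{n-1}}{\beta_n})$ if $\beta_n>\bar\beta$. Put $$\chi^e=\varliminf_{n\to-\infty}\tfrac1{|n|}\sum_{k=n}^{-1}\lambda_k^e,\quad \chi^g=\varliminf_{n\to-\infty}\tfrac1{|n|}\sum_{k=n}^{-1}(\lambda_k^u-\lambda_k^s),\quad \chi^s=\varlimsup_{n\to-\infty}\tfrac1{|n|}\sum_{k=n}^{-1}\lambda_k^s,\quad M_n=\sup_{m\le n}\sum_{k=m}^{n-1}(\hat\chi^u-\lambda_k^e).$$ The splitting is asymptotically dominated if $\chi^g>0$. Let $B_n^{\sigma}(r)$ be the open ball of radius $r$ about $0$ in $E_n^{\sigma}$, and let $\hat{\mathcal C}_n(r,\kappa)$ be the set of $C^{1+\alpha}$ functions $\psi\colon B_n^u(r)\to E_n^s$ with $\psi(0)=0$, $D\psi(0)=0$, $|D\psi|_\alpha\le\kappa$; $\operatorname{graph}\psi=\{v+\psi(v): v\in B_n^u(r)\}$.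 Given $\bar r,\bar\gamma>0$ let $r_n=\bar re^{-M_n}$ and $D_n=B_n^u(r_n)\times B_n^s(\bar\gamma r_n)$. Let $F_{m,n}=f_{n-1}\circ\cdots\circ f_m$, and let $D_m^n$ be the connected component containing $0$ of $\bigcap_{k=m}^{n-1}F_{m,k}^{-1}(D_k)$. **Theorem.** Given $\bar\beta,L>0$, $\alpha\in(0,1]$, $\hat\chi^u>\bar\chi^u>0$ and $\hat\chi^g>0$, there are $\tilde\gamma,\tilde r,\tilde\theta,\tilde\kappa>0$ such that for all $\bar\gamma\in(0,\tilde\gamma]$, $\bar r\in(0,\tilde r]$, $\bar\theta\in(0,\tilde\theta]$, $\bar\kappa\ge\tilde\kappa$ with $\bar\kappa\bar r^\alpha\le\bar\gamma$ the following holds. Let $\{f_n\mid n\le0\}$ be as above, with $\Omega_n\supset D_n$ for all $n\le 0$, $\chi^e>\hat\chi^u$ (with threshold $\bar\beta$), and $\beta_m\le\bar\beta$ for infinitely many $m\le 0$. Then: 1. The lower asymptotic density $\varliminf_{N\to\infty}\frac1N\#\{n\in(-N,0]: M_n=0\}$ is at least $\big(\frac{\chi^e-\hat\chi^u}{L-\hat\chi^u}\big)^2>0$.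 2. $\theta_n\ge\bar\theta e^{-\alpha M_n}$ for all $n\le0$. 3. There exist $\psi_n\in\hat{\mathcal C}_n(\bar re^{-M_n},\bar\kappa e^{\alpha M_n})$, $n\le0$, with $f_n(\operatorname{graph}\psi_n)\supset\operatorname{graph}\psi_{n+1}$ for all $n<0$; moreover $\|D\psi_n\|\le\bar\gamma$ on $B_n^u(r_n)$. This family also has the following properties. 4. If $m<n\le0$ and $x,y\in(\operatorname{graph}\psi_m)\cap D_m^n$, then $\|F_{m,n}(x)-F_{m,n}(y)\|\ge e^{-M_n}e^{(n-m)\bar\chi^u}\|x-y\|$. 5. If $\chi^g>\hat\chi^g$, then $(\psi_n)_{n\le 0}$ is the unique family with $\psi_n\in\hat{\mathcal C}_n(\bar re^{-M_n},\bar\kappa e^{\alpha M_n})$ for all $n\le 0$ and $f_n(\operatorname{graph}\psi_n)\supset\operatorname{graph}\psi_{n+1}$ for all $n<0$. 6. If $\chi^g>0$ and $\chi^s<\bar\chi^u$, then: whenever $n\le0$, $x\in D_n$ and $C\in\mathbb{R}$ are such that for every $m\le n$ the preimage $F_{m,n}^{-1}(x)\in D_m^n$ exists and $\|F_{m,n}^{-1}(x)\|\le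 Ce^{-(n-m)\bar\chi^u}$, then $x\in\operatorname{graph}\psi_n$. -/

import Mathlib

/-- Euclidean `ℝ^d`; every space `V_n` is a copy of it. -/
abbrev Euc (d : ℕ) : Type := EuclideanSpace ℝ (Fin d)

/-- The data of a sequence of maps `f_n : Ω_n → V_{n+1}`, `n ≤ 0`, together with splittings
`V_n = E_n^u ⊕ E_n^s` and the numbers `λ_n^u, λ_n^s, θ_n, β_n`.  Only the indices `n ≤ 0`
(and `n = 1` for the target of `f_0`) matter; values of `f n` outside `Ω n` are never used. -/
structure MapSeq (d : ℕ) where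
  /-- the domains `Ω_n` -/
  Om : ℤ → Set (Euc d)
  /-- the maps `f_n` -/
  f : ℤ → Euc d → Euc d
  /-- the subspaces `E_n^u` -/
  Eu : ℤ → Submodule ℝ (Euc d)
  /-- the subspaces `E_n^s` -/
  Es : ℤ → Submodule ℝ (Euc d)
  /-- `λ_n^u` -/
  lu : ℤ → ℝ
  /-- `λ_n^s` -/
  ls : ℤ → ℝ
  /-- `θ_n` -/
  th : ℤ → ℝ
  /-- `β_n` -/
  be : ℤ → ℝ

/-- `|Dg|_α ≤ K` on the (open) set `s`, where `|Dg|_α` is the Hölder seminorm of the derivative. -/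
def DerivHolderLE {E F : Type*} [NormedAddCommGroup E] [NormedSpace ℝ E]
    [NormedAddCommGroup F] [NormedSpace ℝ F] (α K : ℝ) (g : E → F) (s : Set E) : Prop :=
  ∀ x ∈ s, ∀ y ∈ s, ‖fderiv ℝ g x - fderiv ℝ g y‖ ≤ K * ‖x - y‖ ^ α

/-- The lower asymptotic density of a set of non-positive integers,
`liminf_{N → ∞} #(Γ ∩ (-N, 0]) / N`. -/
noncomputable def lowerDensity (Γ : Set ℤ) : ℝ :=
  Filter.liminf (fun N : ℕ => ((Γ ∩ Set.Ioc (-(N : ℤ)) 0).ncard : ℝ) / (N : ℝ)) Filter.atTop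

/-- The average `(1/|n|) ∑_{k=n}^{-1} a_k`. -/
noncomputable def backAvg (a : ℤ → ℝ) (n : ℤ) : ℝ :=
  (1 / |(n : ℝ)|) * ∑ k ∈ Finset.Ico n 0, a k

namespace MapSeq

variable {d : ℕ}

/-- The composition `f_{m+k-1} ∘ ⋯ ∘ f_m`. -/
def iter (S : MapSeq d) (m : ℤ) : ℕ → Euc d → Euc d
  | 0 => id
  | k + 1 => S.f (m + k) ∘ S.iter m k

/-- `F_{m,n} = f_{n-1} ∘ ⋯ ∘ f_m` for `m ≤ n` (with `F_{m,m} = id`). -/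
def F (S : MapSeq d) (m n : ℤ) : Euc d → Euc d := S.iter m (n - m).toNat

/-- The connected component containing `0` of `⋂_{m ≤ k < n} F_{m,k}⁻¹(D_k)`, for a sequence
`D` of neighbourhoods of `0`. -/
def orbitDomain (S : MapSeq d) (D : ℤ → Set (Euc d)) (m n : ℤ) : Set (Euc d) :=
  connectedComponentIn {x | ∀ k : ℤ, m ≤ k → k < n → S.F m k x ∈ D k} 0

/-- The product `B_n^u(r) × B_n^s(s)` in the coordinates `V_n = E_n^u ⊕ E_n^s`. -/
def box (S : MapSeq d) (n : ℤ) (r s : ℝ) : Set (Euc d) :=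
  {x | ∃ v : S.Eu n, ∃ w : S.Es n, ‖v‖ < r ∧ ‖w‖ < s ∧ x = (v : Euc d) + (w : Euc d)}

/-- The graph `{v + ψ(v) : v ∈ B_n^u(r)}` of a function on `B_n^u(r)`. -/
def graph (S : MapSeq d) (n : ℤ) (r : ℝ) (ψ : S.Eu n → S.Es n) : Set (Euc d) :=
  {x | ∃ v : S.Eu n, ‖v‖ < r ∧ x = (v : Euc d) + (ψ v : Euc d)}

/-- Membership in `Ĉ_n(r, κ)`: `ψ : B_n^u(r) → E_n^s` is of class `C^{1+α}`, `ψ(0) = 0`,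
`Dψ(0) = 0` and `|Dψ|_α ≤ κ`.  (Values of `ψ` outside the ball are irrelevant.) -/
def Admissible (S : MapSeq d) (α : ℝ) (n : ℤ) (r κ : ℝ) (ψ : S.Eu n → S.Es n) : Prop :=
  ContDiffOn ℝ 1 ψ (Metric.ball 0 r) ∧ ψ 0 = 0 ∧ fderiv ℝ ψ 0 = 0 ∧
    DerivHolderLE α κ ψ (Metric.ball 0 r)

/-- The defect from domination `Δ_n = max(0, (λ_n^s - λ_n^u)/α)`. -/
noncomputable def defect (S : MapSeq d) (α : ℝ) (n : ℤ) : ℝ := max 0 ((S.ls n - S.lu n) / α)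

open Classical in
/-- The effective exponent `λ_n^e`, for the threshold `βbar`. -/
noncomputable def lamE (S : MapSeq d) (α βbar : ℝ) (n : ℤ) : ℝ :=
  if S.be n ≤ βbar then S.lu n - S.defect α n
  else min (S.lu n - S.defect α n) ((1 / α) * Real.log (S.be (n - 1) / S.be n))

/-- `χ^e = liminf_{n → -∞} (1/|n|) ∑_{k=n}^{-1} λ_k^e`. -/
noncomputable def chiE (S : MapSeq d) (α βbar : ℝ) : ℝ :=
  Filter.liminf (backAvg (S.lamE α βbar)) Filter.atBot

/-- `χ^g = liminf_{n → -∞} (1/|n|) ∑_{k=n}^{-1} (λ_k^u - λ_k^s)`; the splitting is asymptotically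
dominated when `χ^g > 0`. -/
noncomputable def chiG (S : MapSeq d) : ℝ :=
  Filter.liminf (backAvg (fun k => S.lu k - S.ls k)) Filter.atBot

/-- `χ^s = limsup_{n → -∞} (1/|n|) ∑_{k=n}^{-1} λ_k^s`. -/
noncomputable def chiS (S : MapSeq d) : ℝ := Filter.limsup (backAvg S.ls) Filter.atBot

/-- `M_n(χhat) = sup_{m ≤ n} ∑_{k=m}^{n-1} (χhat - λ_k^e)`; the set is bounded above for every
`n ≤ 0` as soon as `χhat < χ^e`, and it contains the empty sum `0`. -/
noncomputable def M (S : MapSeq d) (α βbar χhat : ℝ) (n : ℤ) : ℝ :=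
  sSup {s : ℝ | ∃ m : ℤ, m ≤ n ∧ s = ∑ k ∈ Finset.Ico m n, (χhat - S.lamE α βbar k)}

/-- The radius `r_n = rbar · e^{-M_n}`. -/
noncomputable def radius (S : MapSeq d) (α βbar χhat rbar : ℝ) (n : ℤ) : ℝ :=
  rbar * Real.exp (-S.M α βbar χhat n)

/-- The Hölder bound `κ_n = κbar · e^{α M_n}`. -/
noncomputable def holderBound (S : MapSeq d) (α βbar χhat κbar : ℝ) (n : ℤ) : ℝ :=
  κbar * Real.exp (α * S.M α βbar χhat n)

/-- The local product neighbourhood `B_n^u(r_n) × B_n^s(γbar r_n)` of `0` in `V_n`. -/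
noncomputable def localBox (S : MapSeq d) (α βbar χhat rbar γbar : ℝ) (n : ℤ) : Set (Euc d) :=
  S.box n (S.radius α βbar χhat rbar n) (γbar * S.radius α βbar χhat rbar n)

/-- The standing assumptions on `{f_n | n ≤ 0}`, apart from the size of the domains. -/
structure Standing (S : MapSeq d) (α L : ℝ) : Prop where
  /-- `Ω_n` is an open neighbourhood of the origin -/
  isOpen_dom : ∀ n ≤ 0, IsOpen (S.Om n)
  zero_mem : ∀ n ≤ 0, (0 : Euc d) ∈ S.Om n
  /-- `f_n` is a `C^1` diffeomorphism of `Ω_n` onto its image, fixing `0`; Hölder continuity of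
  `Df_n` with exponent `α` is part of `holder` below -/
  contDiffOn : ∀ n ≤ 0, ContDiffOn ℝ 1 (S.f n) (S.Om n)
  injOn : ∀ n ≤ 0, Set.InjOn (S.f n) (S.Om n)
  invertible : ∀ n ≤ 0, ∀ x ∈ S.Om n, (fderiv ℝ (S.f n) x).IsInvertible
  map_zero : ∀ n ≤ 0, S.f n 0 = 0
  /-- invariant splitting -/
  isCompl : ∀ n ≤ 0, IsCompl (S.Eu n) (S.Es n)
  map_Eu : ∀ n ≤ 0, (S.Eu n).map (fderiv ℝ (S.f n) 0).toLinearMap = S.Eu (n + 1)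
  map_Es : ∀ n ≤ 0, (S.Es n).map (fderiv ℝ (S.f n) 0).toLinearMap = S.Es (n + 1)
  /-- rates, angles and nonlinearity -/
  th_pos : ∀ n ≤ 0, 0 < S.th n
  be_pos : ∀ n ≤ 0, 0 < S.be n
  expand : ∀ n ≤ 0, ∀ v ∈ S.Eu n, Real.exp (S.lu n) * ‖v‖ ≤ ‖fderiv ℝ (S.f n) 0 v‖
  contract : ∀ n ≤ 0, ∀ w ∈ S.Es n, ‖fderiv ℝ (S.f n) 0 w‖ ≤ Real.exp (S.ls n) * ‖w‖
  angle : ∀ n ≤ 0, ∀ v ∈ S.Eu n, ∀ w ∈ S.Es n, v ≠ 0 → w ≠ 0 →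
    S.th n ≤ InnerProductGeometry.angle v w
  one_le : ∀ n ≤ 0, 1 ≤ S.be n * Real.sin (S.th (n + 1))
  holder : ∀ n ≤ 0, DerivHolderLE α (S.be n * Real.sin (S.th (n + 1))) (S.f n) (S.Om n)
  /-- uniform bounds -/
  abs_lu : ∀ n ≤ 0, |S.lu n| ≤ L
  abs_ls : ∀ n ≤ 0, |S.ls n| ≤ L
  be_succ : ∀ n < 0, S.be (n + 1) ≤ Real.exp L * S.be n

/-- `ψ = (ψ_n)_{n ≤ 0}` is an invariant family of local unstable graphs:
`ψ_n ∈ Ĉ_n(rbar e^{-M_n}, κbar e^{α M_n})` and `f_n(graph ψ_n) ⊇ graph ψ_{n+1}`. -/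
def InvariantFamily (S : MapSeq d) (α βbar χhat rbar κbar : ℝ)
    (ψ : ∀ n : ℤ, S.Eu n → S.Es n) : Prop :=
  (∀ n ≤ 0, S.Admissible α n (S.radius α βbar χhat rbar n) (S.holderBound α βbar χhat κbar n)
      (ψ n)) ∧
    ∀ n < 0, S.graph (n + 1) (S.radius α βbar χhat rbar (n + 1)) (ψ (n + 1)) ⊆
      S.f n '' S.graph n (S.radius α βbar χhat rbar n) (ψ n)

end MapSeq

/-! Write `f_n` in the coordinates of the splittings, with the maximum norm on `E_n^u × E_n^s`. The
coordinates at time `n + 1` cost a factor `1 / sin θ_{n+1}`, which the hypothesis on `|Df_n|_α`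
cancels. What remains is a hyperbolic linear map with rates `e^{λ^u}`, `e^{λ^s}` plus a nonlinearity
of Hölder constant `4 β_n` (`exists_splitStep`).

The effective exponent is tailored to three needs. Since `M_{n+1} ≥ M_n + χ - λ_n^e` (`M_succ`), the
inequality `λ^e ≤ λ^u` makes the image of a graph over radius `r_n` cover radius `r_{n+1}`
(`radius_succ_le`), and the defect makes the Hölder constant `κ_n` turn into at most `κ_{n+1}`
(`transform_bound`). The logarithmic clause telescopes to `β_{n-1} ≤ βbar e^{α M_n}`
(`be_le_exp_M`). This bounds the angles, and it keeps `4 β_n r_n^α` below a small multiple `s` of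
both rates at all times.

Graph transforms therefore preserve the admissible classes. Invariant graphs are ultrafilter limits
of zero sections pushed forward from times `-k` (`exists_invariant_family`); compactness replaces
contraction, so existence needs no domination. Along a graph the horizontal distance expands at
every step by almost `e^{λ^u}`, and the accumulated deficit is at most `M_n` (`expansion`).

The last two properties rest on `compare`: a map multiplies the vertical distance to an invariant
graph by at most `e^{λ^s}` plus a nonlinear error. Relative to the horizontal norm the rate is
nearly `e^{λ^s - λ^u}`, and domination forces two families to agree. For a backward orbit decaying
at rate `χ'` the error tends to zero, so the vertical distance grows more slowly than `χ'` allows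
and must vanish.

The density bound is a counting argument on partial sums (`exists_sum_le_card`). It gives the first
power of the ratio, which lies in `(0, 1]` and so dominates its square. -/

section LocalUnstableGraphs

open Metric Set Filter Topology

/-! ### Lipschitz graphs -/

/-- `ψ` is `γ`-Lipschitz on the ball of radius `r` and vanishes at the origin. -/
def LipGraph {U W : Type*} [NormedAddCommGroup U] [NormedAddCommGroup W] (r γ : ℝ) (ψ : U → W) : Prop :=
  ψ 0 = 0 ∧ ∀ v ∈ ball (0 : U) r, ∀ w ∈ ball (0 : U) r, ‖ψ v - ψ w‖ ≤ γ * ‖v - w‖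

theorem LipGraph.norm_le {U W : Type*} [NormedAddCommGroup U] [NormedAddCommGroup W] {r γ : ℝ} {ψ : U → W} (h : LipGraph r γ ψ) {v : U}
    (hv : v ∈ ball (0 : U) r) : ‖ψ v‖ ≤ γ * ‖v‖ := by
  have h0 : (0 : U) ∈ ball (0 : U) r := by
    simp only [mem_ball, dist_self, dist_zero_right] at hv ⊢
    exact (norm_nonneg v).trans_lt hv
  have := h.2 v hv 0 h0
  simpa [h.1] using this

theorem LipGraph.mem {U W : Type*} [NormedAddCommGroup U] [NormedAddCommGroup W] {r γ : ℝ} (hγ : 0 < γ) {ψ : U → W} (h : LipGraph r γ ψ) {v : U}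
    (hv : v ∈ ball (0 : U) r) : (v, ψ v) ∈ ball (0 : U) r ×ˢ ball (0 : W) (γ * r) := by
  refine ⟨hv, ?_⟩
  have hv' : ‖v‖ < r := by simpa using hv
  simpa using (h.norm_le hv).trans_lt (mul_lt_mul_of_pos_left hv' hγ)

/-! ### One hyperbolic step and its graph transform -/

section SplitStep

variable {U W U' W' : Type*}
  [NormedAddCommGroup U] [NormedSpace ℝ U] [NormedAddCommGroup W] [NormedSpace ℝ W]
  [NormedAddCommGroup U'] [NormedSpace ℝ U'] [NormedAddCommGroup W'] [NormedSpace ℝ W']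

/-- Quantitative hyperbolicity of a map `F : U × W → U' × W'` fixing the origin, on the product of
the balls of radii `r` and `γ r`. -/
structure SplitStep (α r γ a c b : ℝ) (F : U × W → U' × W') (A : U ≃L[ℝ] U')
    (B : W →L[ℝ] W') : Prop where
  alpha_pos : 0 < α
  r_pos : 0 < r
  gamma_pos : 0 < γ
  gamma_le : γ ≤ 1
  b_nonneg : 0 ≤ b
  c_nonneg : 0 ≤ c
  small : b * r ^ α < a
  diff : ∀ x ∈ ball (0 : U) r ×ˢ ball (0 : W) (γ * r), DifferentiableAt ℝ F x
  map_zero : F 0 = 0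
  deriv_zero : fderiv ℝ F 0 = (A : U →L[ℝ] U').prodMap B
  holder : DerivHolderLE α b F (ball (0 : U) r ×ˢ ball (0 : W) (γ * r))
  expand : ∀ v, a * ‖v‖ ≤ ‖A v‖
  contract : ∀ w, ‖B w‖ ≤ c * ‖w‖

/-- The functions of class `C^{1+α}` on the ball of radius `r`, tangent to zero at the origin and
with `α`-Hölder constant `κ` of the derivative. -/
structure TangentGraph (α r κ : ℝ) (ψ : U → W) : Prop where
  diff : ∀ v ∈ ball (0 : U) r, DifferentiableAt ℝ ψ v
  map_zero : ψ 0 = 0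
  deriv_zero : fderiv ℝ ψ 0 = 0
  holder : DerivHolderLE α κ ψ (ball (0 : U) r)

theorem TangentGraph.norm_fderiv_le {α r κ γ : ℝ} (hα : 0 < α) (hκ : 0 ≤ κ) (hr : κ * r ^ α ≤ γ)
    {ψ : U → W} (h : TangentGraph α r κ ψ) {v : U} (hv : v ∈ ball (0 : U) r) :
    ‖fderiv ℝ ψ v‖ ≤ γ := by
  have hv' : ‖v‖ < r := by simpa using hv
  have h0 : (0 : U) ∈ ball (0 : U) r := by
    simpa using (norm_nonneg v).trans_lt hv'
  have := h.holder v hv 0 h0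
  rw [h.deriv_zero, sub_zero, sub_zero] at this
  refine this.trans (le_trans ?_ hr)
  gcongr

theorem TangentGraph.lipGraph {α r κ γ : ℝ} (hα : 0 < α) (hκ : 0 ≤ κ) (hr : κ * r ^ α ≤ γ)
    {ψ : U → W} (h : TangentGraph α r κ ψ) : LipGraph r γ ψ := by
  refine ⟨h.map_zero, fun v hv w hw => ?_⟩
  exact (convex_ball (0 : U) r).norm_image_sub_le_of_norm_fderiv_le (𝕜 := ℝ) h.diff
    (fun x hx => h.norm_fderiv_le hα hκ hr hx) hw hv

namespace SplitStep

variable {α r γ a c b : ℝ} {F : U × W → U' × W'} {A : U ≃L[ℝ] U'} {B : W →L[ℝ] W'}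

theorem zero_mem (h : SplitStep α r γ a c b F A B) :
    (0 : U × W) ∈ ball (0 : U) r ×ˢ ball (0 : W) (γ * r) :=
  ⟨by simpa using h.r_pos, by simpa using mul_pos h.gamma_pos h.r_pos⟩

theorem norm_lt_of_mem (h : SplitStep α r γ a c b F A B) {x : U × W}
    (hx : x ∈ ball (0 : U) r ×ˢ ball (0 : W) (γ * r)) : ‖x‖ < r := by
  have h1 : ‖x.1‖ < r := by simpa using hx.1
  have h2 : ‖x.2‖ < γ * r := by simpa using hx.2
  exact max_lt h1 (h2.trans_le (by nlinarith [h.gamma_le, h.r_pos]))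

/-- Mean value inequality for `F` minus its derivative at the origin. Keeping `ρ` apart from `r`
matters: near the origin the error is smaller than the uniform `b * r ^ α`, which the backward
characterisation exploits. -/
theorem approx (h : SplitStep α r γ a c b F A B) {ρ : ℝ} {x y : U × W}
    (hx : x ∈ ball (0 : U) r ×ˢ ball (0 : W) (γ * r))
    (hy : y ∈ ball (0 : U) r ×ˢ ball (0 : W) (γ * r)) (hxρ : ‖x‖ ≤ ρ) (hyρ : ‖y‖ ≤ ρ) :
    ‖F x - F y - (A (x.1 - y.1), B (x.2 - y.2))‖ ≤ b * ρ ^ α * ‖x - y‖ := by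
  have hconv : Convex ℝ ((ball (0 : U) r ×ˢ ball (0 : W) (γ * r)) ∩ closedBall 0 ρ) :=
    ((convex_ball _ _).prod (convex_ball _ _)).inter (convex_closedBall _ _)
  have := hconv.norm_image_sub_le_of_norm_fderiv_le' (𝕜 := ℝ) (f := F)
    (φ := (A : U →L[ℝ] U').prodMap B) (C := b * ρ ^ α) (x := y) (y := x)
    (fun z hz => h.diff z hz.1) (fun z hz => ?_) ⟨hy, by simpa using hyρ⟩ ⟨hx, by simpa using hxρ⟩
  · exact this
  · rw [← h.deriv_zero]
    refine (h.holder z hz.1 0 h.zero_mem).trans ?_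
    have hzρ : ‖z‖ ≤ ρ := by simpa using hz.2
    have := h.b_nonneg
    have := h.alpha_pos
    rw [sub_zero]
    gcongr

theorem approx_of_mem (h : SplitStep α r γ a c b F A B) {x y : U × W}
    (hx : x ∈ ball (0 : U) r ×ˢ ball (0 : W) (γ * r))
    (hy : y ∈ ball (0 : U) r ×ˢ ball (0 : W) (γ * r)) :
    ‖F x - F y - (A (x.1 - y.1), B (x.2 - y.2))‖ ≤ b * r ^ α * ‖x - y‖ :=
  h.approx hx hy (h.norm_lt_of_mem hx).le (h.norm_lt_of_mem hy).le

theorem eps_nonneg (h : SplitStep α r γ a c b F A B) : 0 ≤ b * r ^ α :=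
  mul_nonneg h.b_nonneg (Real.rpow_nonneg h.r_pos.le _)

/-- In the maximum norm a graph of slope at most one is isometric to its base, so passing between
graph and base costs no constant. -/
theorem graph_norm_sub (h : SplitStep α r γ a c b F A B) {ψ : U → W} (hψ : LipGraph r γ ψ)
    {v w : U} (hv : v ∈ ball (0 : U) r) (hw : w ∈ ball (0 : U) r) :
    ‖((v, ψ v) : U × W) - (w, ψ w)‖ = ‖v - w‖ := by
  have := hψ.2 v hv w hw
  refine max_eq_left (this.trans ?_)
  have := h.gamma_le
  show γ * ‖v - w‖ ≤ ‖v - w‖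
  nlinarith [norm_nonneg (v - w)]

theorem graph_fst_approx (h : SplitStep α r γ a c b F A B) {ψ : U → W} (hψ : LipGraph r γ ψ)
    {v w : U} (hv : v ∈ ball (0 : U) r) (hw : w ∈ ball (0 : U) r) :
    ‖(F (v, ψ v)).1 - (F (w, ψ w)).1 - A (v - w)‖ ≤ b * r ^ α * ‖v - w‖ := by
  have := h.approx_of_mem (hψ.mem h.gamma_pos hv) (hψ.mem h.gamma_pos hw)
  rw [h.graph_norm_sub hψ hv hw] at this
  exact (le_max_left _ _).trans this

theorem graph_expand (h : SplitStep α r γ a c b F A B) {ψ : U → W} (hψ : LipGraph r γ ψ)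
    {v w : U} (hv : v ∈ ball (0 : U) r) (hw : w ∈ ball (0 : U) r) :
    (a - b * r ^ α) * ‖v - w‖ ≤ ‖(F (v, ψ v)).1 - (F (w, ψ w)).1‖ := by
  have h1 := h.graph_fst_approx hψ hv hw
  have h2 := h.expand (v - w)
  have h3 := norm_sub_norm_le (A (v - w)) (A (v - w) - ((F (v, ψ v)).1 - (F (w, ψ w)).1))
  rw [sub_sub_cancel, norm_sub_rev] at h3
  linarith

theorem graph_snd (h : SplitStep α r γ a c b F A B) {ψ : U → W} (hψ : LipGraph r γ ψ)
    {v w : U} (hv : v ∈ ball (0 : U) r) (hw : w ∈ ball (0 : U) r) :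
    ‖(F (v, ψ v)).2 - (F (w, ψ w)).2‖ ≤ (c * γ + b * r ^ α) * ‖v - w‖ := by
  have h1 := h.approx_of_mem (hψ.mem h.gamma_pos hv) (hψ.mem h.gamma_pos hw)
  rw [h.graph_norm_sub hψ hv hw] at h1
  have h1' : ‖(F (v, ψ v)).2 - (F (w, ψ w)).2 - B (ψ v - ψ w)‖ ≤ b * r ^ α * ‖v - w‖ :=
    (le_max_right _ _).trans h1
  have h2 := h.contract (ψ v - ψ w)
  have h3 := norm_le_insert' ((F (v, ψ v)).2 - (F (w, ψ w)).2) (B (ψ v - ψ w))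
  have h4 := mul_le_mul_of_nonneg_left (hψ.2 v hv w hw) h.c_nonneg
  linarith

/-- The image of a Lipschitz graph attracts nearby points. -/
theorem compare (h : SplitStep α r γ a c b F A B) {φ : U → W} (hφ : LipGraph r γ φ)
    {ρ : ℝ} {x : U × W} (hx : x ∈ ball (0 : U) r ×ˢ ball (0 : W) (γ * r)) (hxρ : ‖x‖ ≤ ρ)
    {u : U} (hu : u ∈ ball (0 : U) r) (hux : (F (u, φ u)).1 = (F x).1) :
    ‖(F x).2 - (F (u, φ u)).2‖ ≤
      (c + b * ρ ^ α + (c * γ + b * r ^ α) * (b * ρ ^ α) / (a - b * r ^ α)) * ‖x.2 - φ x.1‖ := by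
  -- `x` is compared with the graph point over the same first coordinate, where the difference is
  -- purely vertical. The image graph is then followed from the image of that point to the point
  -- over `(F x).1`, a displacement controlled by the nonlinearity alone.
  have hz := hφ.mem h.gamma_pos hx.1
  have hzρ : ‖((x.1, φ x.1) : U × W)‖ ≤ ρ := by
    refine le_trans (max_le (norm_fst_le x) ?_) hxρ
    have h1 := hφ.norm_le hx.1
    have h2 := h.gamma_le
    refine h1.trans (le_trans ?_ (norm_fst_le x))
    nlinarith [norm_nonneg x.1]
  have h1 := h.approx hx hz hxρ hzρ
  have hn : ‖x - (x.1, φ x.1)‖ = ‖x.2 - φ x.1‖ := by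
    simp [Prod.norm_def]
  rw [hn] at h1
  set δ := ‖x.2 - φ x.1‖
  have h1a : ‖(F x).1 - (F (x.1, φ x.1)).1‖ ≤ b * ρ ^ α * δ := by
    have := (le_max_left _ _).trans h1
    simpa using this
  have h1b : ‖(F x).2 - (F (x.1, φ x.1)).2 - B (x.2 - φ x.1)‖ ≤ b * ρ ^ α * δ :=
    (le_max_right _ _).trans h1
  have h2 := h.contract (x.2 - φ x.1)
  have h3 := norm_le_insert' ((F x).2 - (F (x.1, φ x.1)).2) (B (x.2 - φ x.1))
  have h4 := h.graph_expand hφ hx.1 hu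
  rw [hux, norm_sub_rev] at h4
  have h5 := h.graph_snd hφ hx.1 hu
  have hμ : 0 < a - b * r ^ α := sub_pos.2 h.small
  have h6 : ‖x.1 - u‖ ≤ b * ρ ^ α * δ / (a - b * r ^ α) := by
    rw [le_div_iff₀ hμ, mul_comm, norm_sub_rev x.1 u]
    rw [norm_sub_rev] at h1a
    linarith
  have h7 : (c * γ + b * r ^ α) * ‖x.1 - u‖ ≤
      (c * γ + b * r ^ α) * (b * ρ ^ α * δ / (a - b * r ^ α)) := by
    have := h.eps_nonneg
    have := h.c_nonneg
    have := h.gamma_pos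
    gcongr
  have h8 := norm_sub_le_norm_sub_add_norm_sub (F x).2 (F (x.1, φ x.1)).2 (F (u, φ u)).2
  have h9 : (c + b * ρ ^ α + (c * γ + b * r ^ α) * (b * ρ ^ α) / (a - b * r ^ α)) * δ
      = c * δ + b * ρ ^ α * δ + (c * γ + b * r ^ α) * (b * ρ ^ α * δ / (a - b * r ^ α)) := by
    ring
  rw [h9]
  linarith

theorem a_pos (h : SplitStep α r γ a c b F A B) : 0 < a := h.eps_nonneg.trans_lt h.small

theorem fst_map_zero (h : SplitStep α r γ a c b F A B) {ψ : U → W} (hψ : ψ 0 = 0) :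
    F ((0 : U), ψ 0) = 0 := by
  rw [hψ]; exact h.map_zero

/-- The first coordinate along the graph is a perturbation of `A` of Lipschitz size `b * r ^ α`, and
the inverse of `A` has norm at most `a⁻¹`; quantitative surjectivity of approximately linear maps
applies. -/
theorem graph_surj [CompleteSpace U] (h : SplitStep α r γ a c b F A B) {ψ : U → W}
    (hψ : LipGraph r γ ψ) {v' : U'} (hv' : ‖v'‖ < (a - b * r ^ α) * r) :
    ∃ v ∈ ball (0 : U) r, (F (v, ψ v)).1 = v' := by
  have hμ : 0 < a - b * r ^ α := sub_pos.2 h.small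
  have happ : ApproximatesLinearOn (fun v => (F (v, ψ v)).1) (A : U →L[ℝ] U') (ball 0 r)
      ⟨b * r ^ α, h.eps_nonneg⟩ :=
    fun v hv w hw => h.graph_fst_approx hψ hv hw
  have ha := h.a_pos
  let R : ContinuousLinearMap.NonlinearRightInverse (A : U →L[ℝ] U') :=
    { toFun := A.symm
      nnnorm := ⟨a⁻¹, inv_nonneg.2 ha.le⟩
      bound' := fun y => by
        have := h.expand (A.symm y)
        rw [A.apply_symm_apply] at this
        show ‖A.symm y‖ ≤ a⁻¹ * ‖y‖
        rw [inv_mul_eq_div, le_div_iff₀ ha]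
        linarith
      right_inv' := fun y => A.apply_symm_apply y }
  -- This radius makes the covered ball have radius exactly `‖v'‖`, and being below `r` it gives a
  -- closed ball inside the open one.
  have hs : ‖v'‖ / (a - b * r ^ α) < r := by
    rw [div_lt_iff₀ hμ]; linarith
  have hsub : closedBall (0 : U) (‖v'‖ / (a - b * r ^ α)) ⊆ ball 0 r := closedBall_subset_ball hs
  obtain ⟨v, hv, hv2⟩ := happ.surjOn_closedBall_of_nonlinearRightInverse R (by positivity) hsub
    (show v' ∈ _ by
      rw [h.fst_map_zero hψ.1]
      show v' ∈ closedBall (0 : U') (((a⁻¹)⁻¹ - b * r ^ α) * (‖v'‖ / (a - b * r ^ α)))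
      rw [inv_inv, mul_div_cancel₀ _ hμ.ne']
      simp)
  exact ⟨v, hsub hv, hv2⟩

/-- The derivative of `v ↦ F (v, ψ v)`. -/
noncomputable def graphDeriv (F : U × W → U' × W') (ψ : U → W) (v : U) : U →L[ℝ] U' × W' :=
  (fderiv ℝ F (v, ψ v)).comp ((ContinuousLinearMap.id ℝ U).prod (fderiv ℝ ψ v))

theorem graphDeriv_apply (F : U × W → U' × W') (ψ : U → W) (v p : U) :
    graphDeriv F ψ v p = fderiv ℝ F (v, ψ v) (p, fderiv ℝ ψ v p) := rfl

section Transform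

variable {κ : ℝ} {ψ : U → W}

theorem hasFDerivAt_graph (h : SplitStep α r γ a c b F A B) (hκ : 0 ≤ κ) (hr : κ * r ^ α ≤ γ)
    (hψ : TangentGraph α r κ ψ) {v : U} (hv : v ∈ ball (0 : U) r) :
    HasFDerivAt (fun v => F (v, ψ v)) (graphDeriv F ψ v) v :=
  (h.diff _ ((hψ.lipGraph h.alpha_pos hκ hr).mem h.gamma_pos hv)).hasFDerivAt.comp v
    ((hasFDerivAt_id v).prodMk (hψ.diff v hv).hasFDerivAt)

theorem norm_prod_fderiv (h : SplitStep α r γ a c b F A B) (hκ : 0 ≤ κ) (hr : κ * r ^ α ≤ γ)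
    (hψ : TangentGraph α r κ ψ) {v : U} (hv : v ∈ ball (0 : U) r) (p : U) :
    ‖((p, fderiv ℝ ψ v p) : U × W)‖ = ‖p‖ := by
  refine max_eq_left ?_
  have h1 := (fderiv ℝ ψ v).le_of_opNorm_le (hψ.norm_fderiv_le h.alpha_pos hκ hr hv) p
  show ‖fderiv ℝ ψ v p‖ ≤ ‖p‖
  nlinarith [norm_nonneg p, h.gamma_le]

theorem norm_fderiv_sub_zero (h : SplitStep α r γ a c b F A B) {x : U × W}
    (hx : x ∈ ball (0 : U) r ×ˢ ball (0 : W) (γ * r)) :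
    ‖fderiv ℝ F x - fderiv ℝ F 0‖ ≤ b * r ^ α := by
  refine (h.holder x hx 0 h.zero_mem).trans ?_
  have h1 := h.norm_lt_of_mem hx
  have := h.b_nonneg
  have := h.alpha_pos
  rw [sub_zero]
  gcongr

theorem graphDeriv_approx (h : SplitStep α r γ a c b F A B) (hκ : 0 ≤ κ) (hr : κ * r ^ α ≤ γ)
    (hψ : TangentGraph α r κ ψ) {v : U} (hv : v ∈ ball (0 : U) r) (p : U) :
    ‖graphDeriv F ψ v p - (A p, B (fderiv ℝ ψ v p))‖ ≤ b * r ^ α * ‖p‖ := by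
  have hx := (hψ.lipGraph h.alpha_pos hκ hr).mem h.gamma_pos hv
  have h1 := (fderiv ℝ F (v, ψ v) - fderiv ℝ F 0).le_of_opNorm_le
    (h.norm_fderiv_sub_zero hx) (p, fderiv ℝ ψ v p)
  rw [h.norm_prod_fderiv hκ hr hψ hv] at h1
  rw [h.deriv_zero] at h1
  exact h1

theorem graphDeriv_expand (h : SplitStep α r γ a c b F A B) (hκ : 0 ≤ κ) (hr : κ * r ^ α ≤ γ)
    (hψ : TangentGraph α r κ ψ) {v : U} (hv : v ∈ ball (0 : U) r) (p : U) :
    (a - b * r ^ α) * ‖p‖ ≤ ‖(graphDeriv F ψ v p).1‖ := by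
  have h1 : ‖(graphDeriv F ψ v p).1 - A p‖ ≤ _ :=
    (le_max_left _ _).trans (h.graphDeriv_approx hκ hr hψ hv p)
  have h2 := h.expand p
  have h3 := norm_sub_norm_le (A p) (A p - (graphDeriv F ψ v p).1)
  rw [sub_sub_cancel, norm_sub_rev] at h3
  linarith

theorem graphDeriv_snd (h : SplitStep α r γ a c b F A B) (hκ : 0 ≤ κ) (hr : κ * r ^ α ≤ γ)
    (hψ : TangentGraph α r κ ψ) {v : U} (hv : v ∈ ball (0 : U) r) (p : U) :
    ‖(graphDeriv F ψ v p).2‖ ≤ (c * γ + b * r ^ α) * ‖p‖ := by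
  have h1 : ‖(graphDeriv F ψ v p).2 - B (fderiv ℝ ψ v p)‖ ≤ _ :=
    (le_max_right _ _).trans (h.graphDeriv_approx hκ hr hψ hv p)
  have h2 := h.contract (fderiv ℝ ψ v p)
  have h3 := norm_le_insert' (graphDeriv F ψ v p).2 (B (fderiv ℝ ψ v p))
  have h4 := mul_le_mul_of_nonneg_left ((fderiv ℝ ψ v).le_of_opNorm_le
    (hψ.norm_fderiv_le h.alpha_pos hκ hr hv) p) h.c_nonneg
  linarith

/-- Two things vary: the base point of `fderiv ℝ F` and the vector tangent to the graph. The main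
part of the second is kept exactly, as `B` applied to the change of slope, because it must be
multiplied by `c` only. -/
theorem graphDeriv_sub (h : SplitStep α r γ a c b F A B) (hκ : 0 ≤ κ) (hr : κ * r ^ α ≤ γ)
    (hψ : TangentGraph α r κ ψ) {v w : U} (hv : v ∈ ball (0 : U) r) (hw : w ∈ ball (0 : U) r)
    (p : U) :
    ‖graphDeriv F ψ v p - graphDeriv F ψ w p - (0, B ((fderiv ℝ ψ v - fderiv ℝ ψ w) p))‖ ≤
      (b + b * r ^ α * κ) * ‖v - w‖ ^ α * ‖p‖ := by
  have hlip := hψ.lipGraph h.alpha_pos hκ hr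
  have hx := hlip.mem h.gamma_pos hv
  have hy := hlip.mem h.gamma_pos hw
  have h1 := (fderiv ℝ F (v, ψ v) - fderiv ℝ F (w, ψ w)).le_of_opNorm_le
    (h.holder _ hx _ hy) (p, fderiv ℝ ψ v p)
  rw [h.norm_prod_fderiv hκ hr hψ hv, h.graph_norm_sub hlip hv hw] at h1
  set q := (fderiv ℝ ψ v - fderiv ℝ ψ w) p with hq
  have hqn : ‖q‖ ≤ κ * ‖v - w‖ ^ α * ‖p‖ :=
    (fderiv ℝ ψ v - fderiv ℝ ψ w).le_of_opNorm_le (hψ.holder v hv w hw) p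
  have h2 := (fderiv ℝ F (w, ψ w) - fderiv ℝ F 0).le_of_opNorm_le
    (h.norm_fderiv_sub_zero hy) (0, q)
  have h0q : ‖((0 : U), q)‖ = ‖q‖ := by simp
  rw [h0q] at h2
  have h3 := mul_le_mul_of_nonneg_left hqn h.eps_nonneg
  have h4 : graphDeriv F ψ v p - graphDeriv F ψ w p - (0, B q) =
      (fderiv ℝ F (v, ψ v) - fderiv ℝ F (w, ψ w)) (p, fderiv ℝ ψ v p) +
      (fderiv ℝ F (w, ψ w) - fderiv ℝ F 0) (0, q) := by
    have h5 : ((0 : U), q) = (p, fderiv ℝ ψ v p) - (p, fderiv ℝ ψ w p) := by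
      simp [hq]
    have h6 : fderiv ℝ F 0 (0, q) = (0, B q) := by
      rw [h.deriv_zero]; simp
    rw [sub_apply, sub_apply, h6, h5, map_sub,
      graphDeriv_apply, graphDeriv_apply]
    abel
  rw [h4]
  refine (norm_add_le _ _).trans ((add_le_add h1 (h2.trans h3)).trans (le_of_eq ?_))
  ring

theorem graphDeriv_fst_sub (h : SplitStep α r γ a c b F A B) (hκ : 0 ≤ κ) (hr : κ * r ^ α ≤ γ)
    (hψ : TangentGraph α r κ ψ) {v w : U} (hv : v ∈ ball (0 : U) r) (hw : w ∈ ball (0 : U) r)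
    (p : U) :
    ‖(graphDeriv F ψ v p).1 - (graphDeriv F ψ w p).1‖ ≤
      (b + b * r ^ α * κ) * ‖v - w‖ ^ α * ‖p‖ := by
  simpa using (le_max_left _ _).trans (h.graphDeriv_sub hκ hr hψ hv hw p)

theorem graphDeriv_snd_sub (h : SplitStep α r γ a c b F A B) (hκ : 0 ≤ κ) (hr : κ * r ^ α ≤ γ)
    (hψ : TangentGraph α r κ ψ) {v w : U} (hv : v ∈ ball (0 : U) r) (hw : w ∈ ball (0 : U) r)
    (p : U) :
    ‖(graphDeriv F ψ v p).2 - (graphDeriv F ψ w p).2‖ ≤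
      (c * κ + b + b * r ^ α * κ) * ‖v - w‖ ^ α * ‖p‖ := by
  have h1 : ‖(graphDeriv F ψ v p).2 - (graphDeriv F ψ w p).2 -
      B ((fderiv ℝ ψ v - fderiv ℝ ψ w) p)‖ ≤ _ :=
    (le_max_right _ _).trans (h.graphDeriv_sub hκ hr hψ hv hw p)
  have h2 := h.contract ((fderiv ℝ ψ v - fderiv ℝ ψ w) p)
  have h3 := mul_le_mul_of_nonneg_left ((fderiv ℝ ψ v - fderiv ℝ ψ w).le_of_opNorm_le
    (hψ.holder v hv w hw) p) h.c_nonneg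
  have h4 := norm_le_insert' ((graphDeriv F ψ v p).2 - (graphDeriv F ψ w p).2)
    (B ((fderiv ℝ ψ v - fderiv ℝ ψ w) p))
  have h5 : (c * κ + b + b * r ^ α * κ) * ‖v - w‖ ^ α * ‖p‖ =
    c * (κ * ‖v - w‖ ^ α * ‖p‖) + (b + b * r ^ α * κ) * ‖v - w‖ ^ α * ‖p‖ := by ring
  rw [h5]
  linarith

/-- The graph transform. -/
theorem exists_transform [FiniteDimensional ℝ U] (h : SplitStep α r γ a c b F A B) (hκ : 0 ≤ κ)
    (hr : κ * r ^ α ≤ γ) (hψ : TangentGraph α r κ ψ) {r' κ' : ℝ} (hr'0 : 0 < r')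
    (hr' : r' ≤ (a - b * r ^ α) * r)
    (hκ' : ((c * κ + b + b * r ^ α * κ) / (a - b * r ^ α) +
      (c * γ + b * r ^ α) * (b + b * r ^ α * κ) / (a - b * r ^ α) ^ 2) *
        ((a - b * r ^ α)⁻¹) ^ α ≤ κ') :
    ∃ ψ' : U' → W', TangentGraph α r' κ' ψ' ∧
      ∀ v' ∈ ball (0 : U') r', ∃ v ∈ ball (0 : U) r, F (v, ψ v) = (v', ψ' v') := by
  have hlip := hψ.lipGraph h.alpha_pos hκ hr
  have hμ : 0 < a - b * r ^ α := sub_pos.2 h.small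
  have : CompleteSpace U := FiniteDimensional.complete ℝ U
  have : FiniteDimensional ℝ U' := A.toLinearEquiv.finiteDimensional
  -- Outside the ball the preimage takes the default value `0`, so that a total function `u` can be
  -- chosen.
  have hsurj : ∀ v' : U', ∃ v, v' ∈ ball (0 : U') r' →
      v ∈ ball (0 : U) r ∧ (F (v, ψ v)).1 = v' := fun v' => by
    by_cases hv' : v' ∈ ball (0 : U') r'
    · have : ‖v'‖ < r' := by simpa using hv'
      obtain ⟨v, hv, hv2⟩ := h.graph_surj hlip (this.trans_le hr')
      exact ⟨v, fun _ => ⟨hv, hv2⟩⟩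
    · exact ⟨0, fun hh => absurd hh hv'⟩
  choose u hu using hsurj
  have hu1 : ∀ v' ∈ ball (0 : U') r', u v' ∈ ball (0 : U) r := fun v' hv' => (hu v' hv').1
  have hu2 : ∀ v' ∈ ball (0 : U') r', (F (u v', ψ (u v'))).1 = v' := fun v' hv' => (hu v' hv').2
  have hulip : ∀ v' ∈ ball (0 : U') r', ∀ w' ∈ ball (0 : U') r',
      ‖u v' - u w'‖ ≤ (a - b * r ^ α)⁻¹ * ‖v' - w'‖ := fun v' hv' w' hw' => by
    have := h.graph_expand hlip (hu1 v' hv') (hu1 w' hw')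
    rw [hu2 v' hv', hu2 w' hw'] at this
    rw [inv_mul_eq_div, le_div_iff₀ hμ]
    linarith
  have h0' : (0 : U') ∈ ball (0 : U') r' := by simpa using hr'0
  have hu0 : u 0 = 0 := by
    have h0 : (0 : U) ∈ ball (0 : U) r := by simpa using h.r_pos
    have := h.graph_expand hlip (hu1 0 h0') h0
    rw [hu2 0 h0', h.fst_map_zero hlip.1] at this
    simp only [sub_zero, Prod.fst_zero, norm_zero] at this
    have : ‖u 0‖ ≤ 0 := by
      by_contra hc
      push Not at hc
      nlinarith
    simpa using this
  have hucont : ∀ v' ∈ ball (0 : U') r', ContinuousAt u v' := fun v' hv' => by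
    have : LipschitzOnWith ⟨(a - b * r ^ α)⁻¹, inv_nonneg.2 hμ.le⟩ u (ball (0 : U') r') :=
      LipschitzOnWith.of_dist_le_mul fun x hx y hy => by
        rw [dist_eq_norm, dist_eq_norm]; exact hulip x hx y hy
    exact this.continuousOn.continuousAt (isOpen_ball.mem_nhds hv')
  have hequiv : ∀ v ∈ ball (0 : U) r, ∃ e : U ≃L[ℝ] U', ∀ p, e p = (graphDeriv F ψ v p).1 := by
    intro v hv
    let g : U →ₗ[ℝ] U' := ((ContinuousLinearMap.fst ℝ U' W').comp (graphDeriv F ψ v)).toLinearMap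
    have hinj : Function.Injective g := by
      rw [injective_iff_map_eq_zero]
      intro p hp
      have h1 := h.graphDeriv_expand hκ hr hψ hv p
      have h2 : (graphDeriv F ψ v p).1 = 0 := hp
      rw [h2, norm_zero] at h1
      have : ‖p‖ ≤ 0 := by
        by_contra hc
        push Not at hc
        nlinarith
      simpa using this
    exact ⟨(LinearEquiv.ofInjectiveOfFinrankEq g hinj
      A.toLinearEquiv.finrank_eq).toContinuousLinearEquiv, fun p => rfl⟩
  have hequiv' : ∀ v, ∃ e : U ≃L[ℝ] U', v ∈ ball (0 : U) r → ∀ p, e p = (graphDeriv F ψ v p).1 :=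
    fun v => by
      by_cases hv : v ∈ ball (0 : U) r
      · obtain ⟨e, he⟩ := hequiv v hv
        exact ⟨e, fun _ => he⟩
      · exact ⟨A, fun hh => absurd hh hv⟩
  choose e he using hequiv'
  have huderiv : ∀ v' ∈ ball (0 : U') r', HasFDerivAt u ((e (u v')).symm : U' →L[ℝ] U) v' := by
    intro v' hv'
    have h1 : HasFDerivAt (fun v => (F (v, ψ v)).1) (e (u v') : U →L[ℝ] U') (u v') := by
      have := (h.hasFDerivAt_graph hκ hr hψ (hu1 v' hv')).fst
      convert this using 1
      ext p
      exact he _ (hu1 v' hv') p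
    refine HasFDerivAt.of_local_left_inverse (hucont v' hv') h1 ?_
    filter_upwards [isOpen_ball.mem_nhds hv'] with w' hw'
    exact hu2 w' hw'
  have hsymm : ∀ v ∈ ball (0 : U) r, ∀ p', ‖(e v).symm p'‖ ≤ (a - b * r ^ α)⁻¹ * ‖p'‖ := by
    intro v hv p'
    have := h.graphDeriv_expand hκ hr hψ hv ((e v).symm p')
    rw [← he v hv, ContinuousLinearEquiv.apply_symm_apply] at this
    rw [inv_mul_eq_div, le_div_iff₀ hμ]
    linarith
  have hderiv : ∀ v' ∈ ball (0 : U') r', HasFDerivAt (fun v' => (F (u v', ψ (u v'))).2)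
      (((ContinuousLinearMap.snd ℝ U' W').comp (graphDeriv F ψ (u v'))).comp
        ((e (u v')).symm : U' →L[ℝ] U)) v' := fun v' hv' =>
    ((h.hasFDerivAt_graph hκ hr hψ (hu1 v' hv')).snd).comp v' (huderiv v' hv')
  refine ⟨fun v' => (F (u v', ψ (u v'))).2, ⟨fun v' hv' => (hderiv v' hv').differentiableAt, ?_,
    ?_, ?_⟩, fun v' hv' => ⟨u v', hu1 v' hv', Prod.ext (hu2 v' hv') rfl⟩⟩
  · show (F (u 0, ψ (u 0))).2 = 0
    rw [hu0, h.fst_map_zero hlip.1]; rfl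
  · rw [(hderiv 0 h0').fderiv]
    ext p'
    show (graphDeriv F ψ (u 0) ((e (u 0)).symm p')).2 = 0
    rw [graphDeriv_apply, hu0, hψ.map_zero, hψ.deriv_zero]
    have : fderiv ℝ F ((0 : U), (0 : W)) = (A : U →L[ℝ] U').prodMap B := h.deriv_zero
    rw [this]
    simp
  · intro v' hv' w' hw'
    rw [(hderiv v' hv').fderiv, (hderiv w' hw').fderiv]
    have hb := h.b_nonneg
    have hc := h.c_nonneg
    have hε := h.eps_nonneg
    have hγ := h.gamma_pos
    have hα := h.alpha_pos
    have hκ'0 : 0 ≤ κ' := le_trans (by positivity) hκ'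
    refine ContinuousLinearMap.opNorm_le_bound _ (by positivity) fun p' => ?_
    set v := u v'
    set w := u w'
    have hv := hu1 v' hv'
    have hw := hu1 w' hw'
    show ‖(graphDeriv F ψ v ((e v).symm p')).2 - (graphDeriv F ψ w ((e w).symm p')).2‖ ≤ _
    set p := (e v).symm p'
    set q := (e w).symm p'
    set μ := a - b * r ^ α
    set ε := b * r ^ α
    have hp : ‖p‖ ≤ μ⁻¹ * ‖p'‖ := hsymm v hv p'
    set δ := ‖v - w‖ ^ α with hδ
    have hδ0 : 0 ≤ δ := by positivity
    -- `p` and `q` are preimages of the same `p'` under the horizontal derivatives at `v` and `w`.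
    -- So the derivative at `w` sends `p - q` to the difference of the two derivatives at `p`, and
    -- its expansion bounds `p - q`.
    have hpq : ‖p - q‖ ≤ μ⁻¹ * ((b + ε * κ) * δ * (μ⁻¹ * ‖p'‖)) := by
      have h1 := h.graphDeriv_expand hκ hr hψ hw (p - q)
      have h2 : (graphDeriv F ψ w (p - q)).1 = (graphDeriv F ψ w p).1 - (graphDeriv F ψ v p).1 := by
        rw [map_sub, Prod.fst_sub, ← he w hw q, ← he v hv p, ContinuousLinearEquiv.apply_symm_apply,
          ContinuousLinearEquiv.apply_symm_apply]
      have h3 := h.graphDeriv_fst_sub hκ hr hψ hv hw p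
      rw [norm_sub_rev (graphDeriv F ψ v p).1, ← h2] at h3
      have h4 : (b + ε * κ) * δ * ‖p‖ ≤ (b + ε * κ) * δ * (μ⁻¹ * ‖p'‖) := by gcongr
      rw [inv_mul_eq_div, le_div_iff₀ hμ]
      linarith
    have h1 := h.graphDeriv_snd_sub hκ hr hψ hv hw p
    have h2 := h.graphDeriv_snd hκ hr hψ hw (p - q)
    rw [map_sub, Prod.snd_sub] at h2
    have h3 := norm_sub_le_norm_sub_add_norm_sub (graphDeriv F ψ v p).2 (graphDeriv F ψ w p).2
      (graphDeriv F ψ w q).2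
    -- The last factor of the new Hölder constant is the Lipschitz constant of `u` raised to the
    -- power `α`.
    have hδ' : δ ≤ μ⁻¹ ^ α * ‖v' - w'‖ ^ α := by
      rw [← Real.mul_rpow (by positivity) (norm_nonneg _)]
      exact Real.rpow_le_rpow (norm_nonneg _) (hulip v' hv' w' hw') hα.le
    calc _ ≤ (c * κ + b + ε * κ) * δ * ‖p‖ + (c * γ + ε) * ‖p - q‖ :=
          h3.trans (add_le_add h1 h2)
      _ ≤ (c * κ + b + ε * κ) * δ * (μ⁻¹ * ‖p'‖) +
          (c * γ + ε) * (μ⁻¹ * ((b + ε * κ) * δ * (μ⁻¹ * ‖p'‖))) := by gcongr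
      _ = ((c * κ + b + ε * κ) / μ + (c * γ + ε) * (b + ε * κ) / μ ^ 2) * δ * ‖p'‖ := by
          field_simp
      _ ≤ ((c * κ + b + ε * κ) / μ + (c * γ + ε) * (b + ε * κ) / μ ^ 2) *
          (μ⁻¹ ^ α * ‖v' - w'‖ ^ α) * ‖p'‖ := by gcongr
      _ = (((c * κ + b + ε * κ) / μ + (c * γ + ε) * (b + ε * κ) / μ ^ 2) * μ⁻¹ ^ α) *
          ‖v' - w'‖ ^ α * ‖p'‖ := by ring
      _ ≤ κ' * ‖v' - w'‖ ^ α * ‖p'‖ := by gcongr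

end Transform

end SplitStep
end SplitStep

/-! ### Pointwise limits of admissible functions -/

theorem Ultrafilter.exists_tendsto_of_norm_le {E : Type*} [NormedAddCommGroup E] [ProperSpace E]
    {ι : Type*} (𝒰 : Ultrafilter ι) {u : ι → E} {R : ℝ} (h : ∀ᶠ k in 𝒰, ‖u k‖ ≤ R) :
    ∃ l, ‖l‖ ≤ R ∧ Tendsto u 𝒰 (𝓝 l) := by
  obtain ⟨l, hl, hl2⟩ := (isCompact_closedBall (0 : E) R).ultrafilter_le_nhds (𝒰.map u)
    (by
      rw [le_principal_iff, Ultrafilter.coe_map, Filter.mem_map]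
      filter_upwards [h] with k hk
      simpa using hk)
  exact ⟨l, by simpa using hl, hl2⟩

section Limit

variable {U W : Type*} [NormedAddCommGroup U] [NormedSpace ℝ U] [NormedAddCommGroup W]
  [NormedSpace ℝ W]

theorem TangentGraph.taylor {α r κ : ℝ} (hα : 0 < α) (hκ : 0 ≤ κ) {ψ : U → W}
    (h : TangentGraph α r κ ψ) {v w : U} (hv : v ∈ ball (0 : U) r) (hw : w ∈ ball (0 : U) r) :
    ‖ψ w - ψ v - fderiv ℝ ψ v (w - v)‖ ≤ κ * ‖w - v‖ ^ α * ‖w - v‖ := by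
  have hconv : Convex ℝ (ball (0 : U) r ∩ closedBall v ‖w - v‖) :=
    (convex_ball _ _).inter (convex_closedBall _ _)
  refine hconv.norm_image_sub_le_of_norm_fderiv_le' (𝕜 := ℝ) (fun z hz => h.diff z hz.1)
    (fun z hz => ?_) ⟨hv, by simp⟩ ⟨hw, by simp [dist_eq_norm]⟩
  refine (h.holder z hz.1 v hv).trans ?_
  have : ‖z - v‖ ≤ ‖w - v‖ := by simpa [dist_eq_norm] using hz.2
  gcongr

/-- The Taylor estimate is uniform over the family, so it survives pointwise limits of values and
derivatives and identifies `A v` as the derivative of the limit. Uniform convergence is not needed.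
-/
theorem TangentGraph.of_tendsto {α r κ : ℝ} (hα : 0 < α) (hr : 0 < r) (hκ : 0 ≤ κ) {ι : Type*}
    {l : Filter ι} [l.NeBot] {Ψ : ι → U → W} (h : ∀ k, TangentGraph α r κ (Ψ k)) {ψ : U → W}
    {A : U → U →L[ℝ] W} (hψ : ∀ v ∈ ball (0 : U) r, Tendsto (fun k => Ψ k v) l (𝓝 (ψ v)))
    (hA : ∀ v ∈ ball (0 : U) r, Tendsto (fun k => fderiv ℝ (Ψ k) v) l (𝓝 (A v))) :
    TangentGraph α r κ ψ := by
  have h0 : (0 : U) ∈ ball (0 : U) r := by simpa using hr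
  have htaylor : ∀ v ∈ ball (0 : U) r, ∀ w ∈ ball (0 : U) r,
      ‖ψ w - ψ v - A v (w - v)‖ ≤ κ * ‖w - v‖ ^ α * ‖w - v‖ := fun v hv w hw => by
    have h1 : Tendsto (fun k => ‖Ψ k w - Ψ k v - fderiv ℝ (Ψ k) v (w - v)‖) l
        (𝓝 ‖ψ w - ψ v - A v (w - v)‖) :=
      (((hψ w hw).sub (hψ v hv)).sub (((ContinuousLinearMap.apply ℝ W (w - v)).continuous.tendsto _).comp (hA v hv))).norm
    exact le_of_tendsto h1 (Eventually.of_forall fun k => (h k).taylor hα hκ hv hw)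
  have hderiv : ∀ v ∈ ball (0 : U) r, HasFDerivAt ψ (A v) v := fun v hv => by
    refine HasFDerivAt.of_isLittleO ?_
    rw [Asymptotics.isLittleO_iff]
    intro ε hε
    have h1 : Tendsto (fun w => κ * ‖w - v‖ ^ α) (𝓝 v) (𝓝 (κ * ‖v - v‖ ^ α)) :=
      ((((continuous_id.sub continuous_const).norm.rpow_const
        (fun _ => Or.inr hα.le)).const_mul κ)).tendsto v
    rw [sub_self, norm_zero, Real.zero_rpow hα.ne', mul_zero] at h1
    filter_upwards [h1.eventually (gt_mem_nhds hε), isOpen_ball.mem_nhds hv] with w hw hwb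
    exact (htaylor v hv w hwb).trans (by gcongr)
  refine ⟨fun v hv => (hderiv v hv).differentiableAt, ?_, ?_, ?_⟩
  · refine tendsto_nhds_unique (hψ 0 h0) ?_
    simp only [(h _).map_zero]
    exact tendsto_const_nhds
  · rw [(hderiv 0 h0).fderiv]
    refine tendsto_nhds_unique (hA 0 h0) ?_
    simp only [(h _).deriv_zero]
    exact tendsto_const_nhds
  · intro v hv w hw
    rw [(hderiv v hv).fderiv, (hderiv w hw).fderiv]
    exact le_of_tendsto ((hA v hv).sub (hA w hw)).norm
      (Eventually.of_forall fun k => (h k).holder v hv w hw)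

theorem TangentGraph.zero {α r κ : ℝ} (hκ : 0 ≤ κ) :
    TangentGraph α r κ (fun _ : U => (0 : W)) := by
  refine ⟨fun v _ => differentiableAt_const _, rfl, by simp, fun v _ w _ => ?_⟩
  have : (0 : ℝ) ≤ κ * ‖v - w‖ ^ α := by positivity
  simpa using this

theorem TangentGraph.contDiffOn {α r κ : ℝ} {ψ : U → W} (hα : 0 < α)
    (h : TangentGraph α r κ ψ) : ContDiffOn ℝ 1 ψ (ball 0 r) := by
  rw [show (1 : WithTop ℕ∞) = 0 + 1 from (zero_add 1).symm,
    contDiffOn_succ_iff_fderiv_of_isOpen isOpen_ball]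
  refine ⟨fun v hv => (h.diff v hv).differentiableWithinAt, by simp,
    contDiffOn_zero.2 fun v hv => ?_⟩
  refine ContinuousAt.continuousWithinAt ?_
  rw [ContinuousAt, tendsto_iff_norm_sub_tendsto_zero]
  have h1 : Tendsto (fun w => κ * ‖w - v‖ ^ α) (𝓝 v) (𝓝 (κ * ‖v - v‖ ^ α)) :=
    (((continuous_id.sub continuous_const).norm.rpow_const
      (fun _ => Or.inr hα.le)).const_mul κ).tendsto v
  rw [sub_self, norm_zero, Real.zero_rpow hα.ne', mul_zero] at h1
  refine squeeze_zero' (Eventually.of_forall fun w => norm_nonneg _) ?_ h1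
  filter_upwards [isOpen_ball.mem_nhds hv] with w hw
  exact h.holder w hw v hv

end Limit

/-! ### Invariant families by compactness -/

section Family

variable {U W : ℤ → Type*} [∀ n, NormedAddCommGroup (U n)] [∀ n, NormedSpace ℝ (U n)]
  [∀ n, NormedAddCommGroup (W n)] [∀ n, NormedSpace ℝ (W n)]

/-- The zero section at time `m` is pushed forward `j` times, stopping at time `0`. The functions at
all other times stay admissible, so a limit can later be taken at every index. -/
theorem exists_partial_family {α : ℝ} {r κ : ℤ → ℝ}
    {F : ∀ n, U n × W n → U (n + 1) × W (n + 1)} (hκ : ∀ n, 0 ≤ κ n)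
    (step : ∀ n < 0, ∀ ψ : U n → W n, TangentGraph α (r n) (κ n) ψ →
      ∃ ψ' : U (n + 1) → W (n + 1), TangentGraph α (r (n + 1)) (κ (n + 1)) ψ' ∧
        ∀ v' ∈ ball (0 : U (n + 1)) (r (n + 1)), ∃ v ∈ ball (0 : U n) (r n),
          F n (v, ψ v) = (v', ψ' v')) (m : ℤ) (j : ℕ) :
    ∃ ψ : ∀ n, U n → W n, (∀ n ≤ 0, TangentGraph α (r n) (κ n) (ψ n)) ∧
      ∀ n < 0, m ≤ n → n < m + j → ∀ v' ∈ ball (0 : U (n + 1)) (r (n + 1)),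
        ∃ v ∈ ball (0 : U n) (r n), F n (v, ψ n v) = (v', ψ (n + 1) v') := by
  induction j with
  | zero =>
    refine ⟨fun n _ => 0, fun n _ => TangentGraph.zero (hκ n), fun n _ h1 h2 => ?_⟩
    exact absurd h1 (by push_cast at h2; omega)
  | succ j ih =>
    obtain ⟨ψ, h1, h2⟩ := ih
    by_cases hneg : m + j < 0
    · obtain ⟨ψ', h3, h4⟩ := step (m + j) hneg (ψ (m + j)) (h1 _ hneg.le)
      refine ⟨Function.update ψ (m + j + 1) ψ', fun n hn => ?_, fun n hn hmn hnj => ?_⟩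
      · by_cases h : n = m + j + 1
        · subst h; simpa using h3
        · rw [Function.update_of_ne h]; exact h1 n hn
      · by_cases h : n = m + j
        · subst h
          rw [Function.update_self, Function.update_of_ne (by omega)]
          exact h4
        · rw [Function.update_of_ne (by push_cast at hnj; omega),
            Function.update_of_ne (by push_cast at hnj; omega)]
          exact h2 n hn hmn (by push_cast at hnj; omega)
    · exact ⟨ψ, h1, fun n hn hmn hnj => h2 n hn hmn (by omega)⟩

/-- An ultrafilter gives convergence at all indices and base points at once. The graph transform
need not contract distances between graphs, hence compactness instead of a fixed point argument. -/
theorem exists_invariant_family [∀ n, FiniteDimensional ℝ (U n)] [∀ n, FiniteDimensional ℝ (W n)]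
    {α γ : ℝ} {r κ μ : ℤ → ℝ} {F : ∀ n, U n × W n → U (n + 1) × W (n + 1)} (hα : 0 < α)
    (hγ : 0 < γ) (hr : ∀ n, 0 < r n) (hκ : ∀ n, 0 ≤ κ n) (hκr : ∀ n, κ n * r n ^ α ≤ γ)
    (step : ∀ n < 0, ∀ ψ : U n → W n, TangentGraph α (r n) (κ n) ψ →
      ∃ ψ' : U (n + 1) → W (n + 1), TangentGraph α (r (n + 1)) (κ (n + 1)) ψ' ∧
        ∀ v' ∈ ball (0 : U (n + 1)) (r (n + 1)), ∃ v ∈ ball (0 : U n) (r n),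
          F n (v, ψ v) = (v', ψ' v'))
    (hμ : ∀ n < 0, 0 < μ n) (hμr : ∀ n < 0, r (n + 1) ≤ μ n * r n)
    (expand : ∀ n < 0, ∀ ψ : U n → W n, TangentGraph α (r n) (κ n) ψ →
      ∀ v ∈ ball (0 : U n) (r n), μ n * ‖v‖ ≤ ‖(F n (v, ψ v)).1‖)
    (cont : ∀ n < 0, ∀ x ∈ ball (0 : U n) (r n) ×ˢ ball (0 : W n) (γ * r n),
      ContinuousAt (F n) x) :
    ∃ ψ : ∀ n, U n → W n, (∀ n ≤ 0, TangentGraph α (r n) (κ n) (ψ n)) ∧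
      ∀ n < 0, ∀ v' ∈ ball (0 : U (n + 1)) (r (n + 1)),
        ∃ v ∈ ball (0 : U n) (r n), F n (v, ψ n v) = (v', ψ (n + 1) v') := by
  have : ∀ n, ProperSpace (U n) := fun n => FiniteDimensional.proper ℝ (U n)
  have : ∀ n, ProperSpace (W n) := fun n => FiniteDimensional.proper ℝ (W n)
  have : ∀ n, ProperSpace (U n →L[ℝ] W n) := fun n => FiniteDimensional.proper ℝ _
  choose Ψ hΨ1 hΨ2 using fun k : ℕ => exists_partial_family hκ step (-(k : ℤ)) k
  let 𝒰 := hyperfilter ℕ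
  have hΨlip : ∀ k, ∀ n ≤ 0, LipGraph (r n) γ (Ψ k n) := fun k n hn =>
    (hΨ1 k n hn).lipGraph hα (hκ n) (hκr n)
  have hlim : ∀ n, ∀ v : U n, ∃ l : W n, n ≤ 0 → v ∈ ball (0 : U n) (r n) →
      Tendsto (fun k => Ψ k n v) 𝒰 (𝓝 l) := fun n v => by
    by_cases h : n ≤ 0 ∧ v ∈ ball (0 : U n) (r n)
    · obtain ⟨l, -, hl⟩ := 𝒰.exists_tendsto_of_norm_le (u := fun k => Ψ k n v) (R := γ * ‖v‖)
        (Eventually.of_forall fun k => (hΨlip k n h.1).norm_le h.2)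
      exact ⟨l, fun _ _ => hl⟩
    · exact ⟨0, fun h1 h2 => absurd ⟨h1, h2⟩ h⟩
  have hlimD : ∀ n, ∀ v : U n, ∃ l : U n →L[ℝ] W n, n ≤ 0 → v ∈ ball (0 : U n) (r n) →
      Tendsto (fun k => fderiv ℝ (Ψ k n) v) 𝒰 (𝓝 l) := fun n v => by
    by_cases h : n ≤ 0 ∧ v ∈ ball (0 : U n) (r n)
    · obtain ⟨l, -, hl⟩ := 𝒰.exists_tendsto_of_norm_le (u := fun k => fderiv ℝ (Ψ k n) v) (R := γ)
        (Eventually.of_forall fun k => (hΨ1 k n h.1).norm_fderiv_le hα (hκ n) (hκr n) h.2)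
      exact ⟨l, fun _ _ => hl⟩
    · exact ⟨0, fun h1 h2 => absurd ⟨h1, h2⟩ h⟩
  choose ψ hψ using hlim
  choose A hA using hlimD
  have hT : ∀ n ≤ 0, TangentGraph α (r n) (κ n) (ψ n) := fun n hn =>
    TangentGraph.of_tendsto hα (hr n) (hκ n) (fun k => hΨ1 k n hn) (fun v hv => hψ n v hn hv)
      (fun v hv => hA n v hn hv)
  refine ⟨ψ, hT, fun n hn v' hv' => ?_⟩
  have hex : ∀ k : ℕ, ∃ v : U n, -n ≤ k → v ∈ ball (0 : U n) (r n) ∧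
      F n (v, Ψ k n v) = (v', Ψ k (n + 1) v') := fun k => by
    by_cases hk : -n ≤ k
    · obtain ⟨v, h1, h2⟩ := hΨ2 k n hn (by omega) (by omega) v' hv'
      exact ⟨v, fun _ => ⟨h1, h2⟩⟩
    · exact ⟨0, fun hh => absurd hh hk⟩
  choose u hu using hex
  have hev : ∀ᶠ k : ℕ in (𝒰 : Filter ℕ), -n ≤ (k : ℤ) := by
    have h1 : (𝒰 : Filter ℕ) ≤ atTop := by
      rw [← Nat.cofinite_eq_atTop]; exact hyperfilter_le_cofinite
    refine h1 ?_
    filter_upwards [eventually_ge_atTop (-n).toNat] with k hk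
    omega
  -- Expansion keeps the preimages of `v'` in a closed ball strictly inside the domain, so their
  -- limit remains in the open ball.
  have hs : ‖v'‖ / μ n < r n := by
    have : ‖v'‖ < r (n + 1) := by simpa using hv'
    rw [div_lt_iff₀ (hμ n hn)]
    linarith [hμr n hn]
  have hubd : ∀ᶠ k in (𝒰 : Filter ℕ), ‖u k‖ ≤ ‖v'‖ / μ n := by
    filter_upwards [hev] with k hk
    obtain ⟨h1, h2⟩ := hu k hk
    have := expand n hn _ (hΨ1 k n hn.le) _ h1
    rw [h2] at this
    rw [le_div_iff₀ (hμ n hn)]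
    linarith
  obtain ⟨v, hv, hvlim⟩ := 𝒰.exists_tendsto_of_norm_le hubd
  have hvb : v ∈ ball (0 : U n) (r n) := by simpa using hv.trans_lt hs
  refine ⟨v, hvb, ?_⟩
  have h1 : Tendsto (fun k => Ψ k n (u k)) 𝒰 (𝓝 (ψ n v)) := by
    -- The common Lipschitz constant allows the moving base points `u k` to be replaced by their
    -- limit.
    have h2 : Tendsto (fun k => Ψ k n (u k) - Ψ k n v) 𝒰 (𝓝 0) := by
      refine squeeze_zero_norm' (a := fun k => γ * ‖u k - v‖) ?_ ?_
      · filter_upwards [hev] with k hk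
        exact (hΨlip k n hn.le).2 _ (hu k hk).1 _ hvb
      · have := (hvlim.sub_const v).norm.const_mul γ
        simpa using this
    have := h2.add (hψ n v hn.le hvb)
    simpa using this
  have h3 : Tendsto (fun k => F n (u k, Ψ k n (u k))) 𝒰 (𝓝 (F n (v, ψ n v))) :=
    (cont n hn _ (((hT n hn.le).lipGraph hα (hκ n) (hκr n)).mem hγ hvb)).tendsto.comp
      (hvlim.prodMk_nhds h1)
  have h4 : Tendsto (fun k => F n (u k, Ψ k n (u k))) 𝒰 (𝓝 (v', ψ (n + 1) v')) := by
    have h5 := (tendsto_const_nhds (x := v')).prodMk_nhds (hψ (n + 1) v' (by omega) hv')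
    refine h5.congr' ?_
    filter_upwards [hev] with k hk
    exact (hu k hk).2.symm
  exact tendsto_nhds_unique h3 h4

end Family

/-! ### Backward averages and sums -/

section Averages

theorem backAvg_eq {a : ℤ → ℝ} {m : ℤ} (hm : m < 0) :
    ∑ k ∈ Finset.Ico m 0, a k = backAvg a m * (-(m : ℝ)) := by
  have h : (m : ℝ) < 0 := by exact_mod_cast hm
  rw [backAvg, abs_of_neg h, mul_comm, ← mul_assoc, mul_one_div_cancel (by linarith), one_mul]

theorem sum_Ico_le_of_le {a : ℤ → ℝ} {C : ℝ} (h : ∀ k < 0, a k ≤ C) {m : ℤ} (hm : m ≤ 0) :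
    ∑ k ∈ Finset.Ico m 0, a k ≤ C * (-(m : ℝ)) := by
  have h1 : ∑ k ∈ Finset.Ico m 0, a k ≤ ∑ _k ∈ Finset.Ico m 0, C :=
    Finset.sum_le_sum fun k hk => h k (Finset.mem_Ico.1 hk).2
  rw [Finset.sum_const, Int.card_Ico, nsmul_eq_mul, mul_comm] at h1
  have h2 : (((0 - m).toNat : ℕ) : ℝ) = -(m : ℝ) := by
    have : (((0 - m).toNat : ℕ) : ℤ) = -m := by omega
    exact_mod_cast this
  rwa [h2] at h1

theorem backAvg_le {a : ℤ → ℝ} {C : ℝ} (h : ∀ k < 0, a k ≤ C) {m : ℤ} (hm : m < 0) :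
    backAvg a m ≤ C := by
  have h1 := sum_Ico_le_of_le h hm.le
  rw [backAvg_eq hm] at h1
  have h2 : (m : ℝ) < 0 := by exact_mod_cast hm
  exact le_of_mul_le_mul_right h1 (by linarith)

theorem le_backAvg {a : ℤ → ℝ} {C : ℝ} (h : ∀ k < 0, C ≤ a k) {m : ℤ} (hm : m < 0) :
    C ≤ backAvg a m := by
  have h1 := backAvg_le (a := fun k => -a k) (C := -C) (fun k hk => neg_le_neg (h k hk)) hm
  have h2 : backAvg (fun k => -a k) m = -backAvg a m := by
    simp [backAvg]
  linarith

/-- The crude bound `C` serves to make the averages bounded below, without which a real `liminf`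
carries no information. -/
theorem eventually_sum_ge {a : ℤ → ℝ} {C χ : ℝ} (h : ∀ k < 0, C ≤ a k)
    (hχ : χ < liminf (backAvg a) atBot) :
    ∃ m₀ : ℤ, m₀ < 0 ∧ ∀ m ≤ m₀, χ * (-(m : ℝ)) ≤ ∑ k ∈ Finset.Ico m 0, a k := by
  have hb : IsBoundedUnder (· ≥ ·) atBot (backAvg a) :=
    ⟨C, eventually_map.2 ((eventually_lt_atBot 0).mono fun m hm => le_backAvg h hm)⟩
  obtain ⟨m₀, hm₀⟩ := eventually_atBot.1 (eventually_lt_of_lt_liminf hχ hb)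
  refine ⟨min m₀ (-1), by omega, fun m hm => ?_⟩
  have hm0 : m < 0 := by omega
  have h2 : (m : ℝ) < 0 := by exact_mod_cast hm0
  rw [backAvg_eq hm0]
  exact mul_le_mul_of_nonneg_right (hm₀ m (by omega)).le (by linarith)

theorem eventually_sum_le {a : ℤ → ℝ} {C χ : ℝ} (h : ∀ k < 0, a k ≤ C)
    (hχ : limsup (backAvg a) atBot < χ) :
    ∃ m₀ : ℤ, m₀ < 0 ∧ ∀ m ≤ m₀, ∑ k ∈ Finset.Ico m 0, a k ≤ χ * (-(m : ℝ)) := by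
  have hb : IsBoundedUnder (· ≤ ·) atBot (backAvg a) :=
    ⟨C, eventually_map.2 ((eventually_lt_atBot 0).mono fun m hm => backAvg_le h hm)⟩
  obtain ⟨m₀, hm₀⟩ := eventually_atBot.1 (eventually_lt_of_limsup_lt hχ hb)
  refine ⟨min m₀ (-1), by omega, fun m hm => ?_⟩
  have hm0 : m < 0 := by omega
  have h2 : (m : ℝ) < 0 := by exact_mod_cast hm0
  rw [backAvg_eq hm0]
  exact mul_le_mul_of_nonneg_right (hm₀ m (by omega)).le (by linarith)

theorem liminf_backAvg_le {a : ℤ → ℝ} {c C : ℝ} (hc : ∀ k < 0, c ≤ a k) (h : ∀ k < 0, a k ≤ C) :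
    liminf (backAvg a) atBot ≤ C := by
  by_contra hlt
  push Not at hlt
  have hb : IsBoundedUnder (· ≥ ·) atBot (backAvg a) :=
    ⟨c, eventually_map.2 ((eventually_lt_atBot 0).mono fun m hm => le_backAvg hc hm)⟩
  obtain ⟨m, h1, h2⟩ :=
    ((eventually_lt_of_lt_liminf hlt hb).and (eventually_lt_atBot (0 : ℤ))).exists
  exact absurd (backAvg_le h h2) (not_le.2 h1)

theorem sum_Ico_split {a : ℤ → ℝ} {m n : ℤ} (hmn : m ≤ n) (hn : n ≤ 0) :
    ∑ k ∈ Finset.Ico m n, a k = ∑ k ∈ Finset.Ico m 0, a k - ∑ k ∈ Finset.Ico n 0, a k := by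
  rw [← Finset.Ico_union_Ico_eq_Ico hmn hn,
    Finset.sum_union (Finset.Ico_disjoint_Ico_consecutive _ _ _)]
  ring

theorem sum_Ico_top {a : ℤ → ℝ} {m n : ℤ} (hmn : m ≤ n) :
    ∑ k ∈ Finset.Ico m (n + 1), a k = ∑ k ∈ Finset.Ico m n, a k + a n := by
  rw [← Finset.insert_Ico_right_eq_Ico_add_one hmn, Finset.sum_insert (by simp)]
  ring

theorem sum_Ico_bot {a : ℤ → ℝ} {m n : ℤ} (hmn : m < n) :
    ∑ k ∈ Finset.Ico m n, a k = a m + ∑ k ∈ Finset.Ico (m + 1) n, a k := by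
  rw [← Finset.insert_Ico_add_one_left_eq_Ico hmn, Finset.sum_insert (by simp)]

end Averages

/-! ### The effective exponent: bounds on `β`, angles and density -/

namespace MapSeq

variable {d : ℕ} {S : MapSeq d} {α L βbar χ : ℝ}

theorem defect_nonneg (S : MapSeq d) (α : ℝ) (n : ℤ) : 0 ≤ S.defect α n := le_max_left _ _

theorem lamE_le_sub (S : MapSeq d) (α βbar : ℝ) (n : ℤ) :
    S.lamE α βbar n ≤ S.lu n - S.defect α n := by
  unfold lamE
  split_ifs
  · exact le_rfl
  · exact min_le_left _ _

theorem lamE_le_lu (S : MapSeq d) (α βbar : ℝ) (n : ℤ) : S.lamE α βbar n ≤ S.lu n := by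
  linarith [S.lamE_le_sub α βbar n, S.defect_nonneg α n]

theorem lamE_le_log (S : MapSeq d) {α βbar : ℝ} {n : ℤ} (h : βbar < S.be n) :
    S.lamE α βbar n ≤ (1 / α) * Real.log (S.be (n - 1) / S.be n) := by
  unfold lamE
  rw [if_neg (not_le.2 h)]
  exact min_le_right _ _

theorem alpha_mul_lamE_le (S : MapSeq d) {α : ℝ} (hα : 0 < α) (βbar : ℝ) (n : ℤ) :
    α * S.lamE α βbar n ≤ α * S.lu n - (S.ls n - S.lu n) := by
  have h1 : (S.ls n - S.lu n) / α ≤ S.defect α n := le_max_right _ _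
  rw [div_le_iff₀ hα] at h1
  nlinarith [S.lamE_le_sub α βbar n]

namespace Standing

theorem lamE_le (h : S.Standing α L) (βbar : ℝ) {n : ℤ} (hn : n ≤ 0) : S.lamE α βbar n ≤ L :=
  (S.lamE_le_lu α βbar n).trans ((le_abs_self _).trans (h.abs_lu n hn))

/-- The defect is at most `2 * L / α`, and the growth bound on `β` keeps the logarithm above `-L`.
Only the existence of a uniform lower bound matters. -/
theorem le_lamE (h : S.Standing α L) (hα : 0 < α) (hL : 0 < L) (βbar : ℝ) {n : ℤ} (hn : n ≤ 0) :
    -(L + 2 * L / α) ≤ S.lamE α βbar n := by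
  have h1 := abs_le.1 (h.abs_lu n hn)
  have h2 := abs_le.1 (h.abs_ls n hn)
  have h3 : -(L + 2 * L / α) ≤ S.lu n - S.defect α n := by
    have : S.defect α n ≤ 2 * L / α := by
      refine max_le (by positivity) ?_
      gcongr
      linarith
    linarith
  unfold lamE
  split_ifs with hb
  · exact h3
  · refine le_min h3 ?_
    have hp := h.be_pos n hn
    have hp' := h.be_pos (n - 1) (by omega)
    have h4 := h.be_succ (n - 1) (by omega)
    rw [sub_add_cancel] at h4
    have h5 : -L ≤ Real.log (S.be (n - 1) / S.be n) := by
      rw [Real.le_log_iff_exp_le (by positivity), le_div_iff₀ hp, Real.exp_neg,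
        inv_mul_le_iff₀ (Real.exp_pos L)]
      exact h4
    have h6 : (1 / α) * (-L) ≤ (1 / α) * Real.log (S.be (n - 1) / S.be n) := by gcongr
    have h7 : (1 / α) * (-L) = -(L / α) := by ring
    have h8 : 2 * L / α = L / α + L / α := by ring
    have h9 : 0 < L / α := by positivity
    linarith

theorem exists_forall_sum_ge (h : S.Standing α L) (hα : 0 < α) (hL : 0 < L) {c : ℝ}
    (hc : c < S.chiE α βbar - χ) :
    ∃ m₀ : ℤ, m₀ < 0 ∧ ∀ m ≤ m₀, c * (-(m : ℝ)) ≤ ∑ k ∈ Finset.Ico m 0, (S.lamE α βbar k - χ) := by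
  obtain ⟨m₀, h0, h1⟩ := eventually_sum_ge (a := S.lamE α βbar) (χ := c + χ)
    (fun k hk => h.le_lamE hα hL βbar hk.le) (show _ < S.chiE α βbar by linarith)
  refine ⟨m₀, h0, fun m hm => ?_⟩
  have h2 := h1 m hm
  rw [Finset.sum_sub_distrib, Finset.sum_const, Int.card_Ico, nsmul_eq_mul]
  have h3 : (((0 - m).toNat : ℕ) : ℝ) = -(m : ℝ) := by
    have : (((0 - m).toNat : ℕ) : ℤ) = -m := by omega
    exact_mod_cast this
  rw [h3]
  linarith

theorem chiE_le (h : S.Standing α L) (hα : 0 < α) (hL : 0 < L) : S.chiE α βbar ≤ L :=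
  liminf_backAvg_le (fun _ hk => h.le_lamE hα hL βbar hk.le) (fun _ hk => h.lamE_le βbar hk.le)

/-- As `χ` is below the lower average `χ^e`, the sums of `λ^e - χ` over `[m, 0)` are nonnegative for
very negative `m`, and finitely many `m` remain. Hence `M` is a true supremum, not the default value
of `sSup`. -/
theorem bddAbove_M (h : S.Standing α L) (hα : 0 < α) (hL : 0 < L) (hχ : χ < S.chiE α βbar)
    {n : ℤ} (hn : n ≤ 0) :
    BddAbove {s : ℝ | ∃ m : ℤ, m ≤ n ∧ s = ∑ k ∈ Finset.Ico m n, (χ - S.lamE α βbar k)} := by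
  obtain ⟨m₀, h0, h1⟩ := h.exists_forall_sum_ge hα hL (βbar := βbar) (χ := χ) (c := 0)
    (by linarith)
  have h2 : {s : ℝ | ∃ m : ℤ, m ≤ n ∧ s = ∑ k ∈ Finset.Ico m n, (χ - S.lamE α βbar k)} ⊆
      Iic (-∑ k ∈ Finset.Ico n 0, (χ - S.lamE α βbar k)) ∪
      (fun m => ∑ k ∈ Finset.Ico m n, (χ - S.lamE α βbar k)) '' Icc m₀ n := by
    rintro s ⟨m, hm, rfl⟩
    by_cases hmm : m ≤ m₀
    · left
      have h3 := h1 m hmm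
      rw [zero_mul] at h3
      have h4 : ∑ k ∈ Finset.Ico m 0, (χ - S.lamE α βbar k) =
          -∑ k ∈ Finset.Ico m 0, (S.lamE α βbar k - χ) := by
        rw [← Finset.sum_neg_distrib]; simp
      rw [mem_Iic, sum_Ico_split hm hn, h4]
      linarith
    · right
      exact ⟨m, ⟨by omega, hm⟩, rfl⟩
  exact (bddAbove_Iic.union ((finite_Icc m₀ n).image _).bddAbove).mono h2

theorem sum_le_M (h : S.Standing α L) (hα : 0 < α) (hL : 0 < L) (hχ : χ < S.chiE α βbar)
    {m n : ℤ} (hmn : m ≤ n) (hn : n ≤ 0) :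
    ∑ k ∈ Finset.Ico m n, (χ - S.lamE α βbar k) ≤ S.M α βbar χ n :=
  le_csSup (h.bddAbove_M hα hL hχ hn) ⟨m, hmn, rfl⟩

theorem M_nonneg (h : S.Standing α L) (hα : 0 < α) (hL : 0 < L) (hχ : χ < S.chiE α βbar)
    {n : ℤ} (hn : n ≤ 0) : 0 ≤ S.M α βbar χ n := by
  simpa using h.sum_le_M hα hL hχ le_rfl hn

/-- Appending the index `n` to a sum competing for `M_n` gives one competing for `M_{n+1}`. -/
theorem M_succ (h : S.Standing α L) (hα : 0 < α) (hL : 0 < L) (hχ : χ < S.chiE α βbar)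
    {n : ℤ} (hn : n < 0) :
    S.M α βbar χ n + (χ - S.lamE α βbar n) ≤ S.M α βbar χ (n + 1) := by
  rw [← le_sub_iff_add_le]
  refine csSup_le ⟨_, n, le_rfl, rfl⟩ ?_
  rintro s ⟨m, hm, rfl⟩
  have := h.sum_le_M hα hL hχ (show m ≤ n + 1 by omega) (by omega)
  rw [sum_Ico_top hm] at this
  linarith

/-- Control of `β_{n-1}` in terms of the time `j` elapsed since `β` was last below the threshold. -/
theorem exists_be_le (h : S.Standing α L) (hα : 0 < α) (hL : 0 < L) (hχ : χ < S.chiE α βbar)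
    (hinf : {m : ℤ | m ≤ 0 ∧ S.be m ≤ βbar}.Infinite) {n : ℤ} (hn : n ≤ 0) :
    ∃ j : ℕ, S.be (n - 1) ≤ βbar * Real.exp (L * j) ∧
      S.be (n - 1) ≤ βbar * Real.exp (α * S.M α βbar χ n - α * χ * j) := by
  have hex : ∃ j : ℕ, S.be (n - 1 - j) ≤ βbar := by
    by_contra hcon
    push Not at hcon
    refine hinf ((finite_Icc n 0).subset fun m hm => ⟨?_, hm.1⟩)
    by_contra hlt
    push Not at hlt
    have h1 := hcon (n - 1 - m).toNat
    have h2 : n - 1 - ((n - 1 - m).toNat : ℤ) = m := by omega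
    rw [h2] at h1
    exact absurd hm.2 (not_le.2 h1)
  classical
  -- By minimality `β_{n-1}, …, β_{n-j}` all exceed the threshold, so the logarithmic clause of
  -- `λ^e` holds at each of these times and the quotients telescope down to `β_{n-1-j} ≤ βbar`.
  obtain ⟨j, hj, hmin⟩ : ∃ j : ℕ, S.be (n - 1 - j) ≤ βbar ∧ ∀ i < j, βbar < S.be (n - 1 - i) :=
    ⟨Nat.find hex, Nat.find_spec hex, fun i hi => not_le.1 (Nat.find_min hex hi)⟩
  refine ⟨j, ?_, ?_⟩
  · have h1 : ∀ i : ℕ, S.be (n - 1) ≤ S.be (n - 1 - i) * Real.exp (L * i) := by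
      intro i
      induction i with
      | zero => simp
      | succ i ih =>
        have h2 := h.be_succ (n - 1 - (i + 1 : ℕ)) (by omega)
        have h3 : n - 1 - ((i + 1 : ℕ) : ℤ) + 1 = n - 1 - i := by push_cast; ring
        rw [h3] at h2
        calc _ ≤ S.be (n - 1 - i) * Real.exp (L * i) := ih
          _ ≤ (Real.exp L * S.be (n - 1 - (i + 1 : ℕ))) * Real.exp (L * i) := by gcongr
          _ = _ := by push_cast; rw [mul_add, Real.exp_add]; ring_nf
    exact (h1 j).trans (by gcongr)
  · have h1 : ∀ i ≤ j, S.be (n - 1) ≤ S.be (n - 1 - i) *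
        Real.exp (-(α * ∑ k ∈ Finset.Ico (n - i) n, S.lamE α βbar k)) := by
      intro i
      induction i with
      | zero => simp
      | succ i ih =>
        intro hi
        have h2 := S.lamE_le_log (α := α) (hmin i (by omega))
        have hp := h.be_pos (n - 1 - i) (by omega)
        have hp' := h.be_pos (n - 1 - i - 1) (by omega)
        have h3 : S.be (n - 1 - i) ≤
            S.be (n - 1 - i - 1) * Real.exp (-(α * S.lamE α βbar (n - 1 - i))) := by
          have h4 : α * S.lamE α βbar (n - 1 - i) ≤
              Real.log (S.be (n - 1 - i - 1) / S.be (n - 1 - i)) := by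
            have := mul_le_mul_of_nonneg_left h2 hα.le
            rwa [← mul_assoc, mul_one_div_cancel hα.ne', one_mul] at this
          rw [Real.le_log_iff_exp_le (by positivity), le_div_iff₀ hp] at h4
          rw [Real.exp_neg, ← div_eq_mul_inv, le_div_iff₀ (Real.exp_pos _), mul_comm]
          exact h4
        have h5 : n - ((i + 1 : ℕ) : ℤ) < n := by omega
        have h6 : n - 1 - ((i + 1 : ℕ) : ℤ) = n - 1 - i - 1 := by push_cast; ring
        have h7 : n - ((i + 1 : ℕ) : ℤ) = n - 1 - i := by push_cast; ring
        have h8 : n - 1 - (i : ℤ) + 1 = n - i := by ring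
        rw [sum_Ico_bot h5, h6, h7, h8, mul_add, neg_add, Real.exp_add, ← mul_assoc]
        exact (ih (by omega)).trans (by gcongr)
    have h2 := h.sum_le_M hα hL hχ (show n - j ≤ n by omega) hn
    rw [Finset.sum_sub_distrib, Finset.sum_const, Int.card_Ico, nsmul_eq_mul] at h2
    have h3 : (n - (n - (j : ℤ))).toNat = j := by omega
    rw [h3] at h2
    have hp := h.be_pos (n - 1 - j) (by omega)
    refine (h1 j le_rfl).trans ?_
    have h4 : -(α * ∑ k ∈ Finset.Ico (n - (j : ℤ)) n, S.lamE α βbar k) ≤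
        α * S.M α βbar χ n - α * χ * j := by nlinarith
    have hβ : 0 ≤ βbar := hp.le.trans hj
    gcongr

theorem be_le_exp_M (h : S.Standing α L) (hα : 0 < α) (hL : 0 < L) (hχ0 : 0 ≤ χ)
    (hβ : 0 < βbar) (hχ : χ < S.chiE α βbar)
    (hinf : {m : ℤ | m ≤ 0 ∧ S.be m ≤ βbar}.Infinite) {n : ℤ} (hn : n ≤ 0) :
    S.be (n - 1) ≤ βbar * Real.exp (α * S.M α βbar χ n) := by
  obtain ⟨j, -, hj⟩ := h.exists_be_le hα hL hχ hinf hn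
  refine hj.trans ?_
  gcongr
  have : 0 ≤ α * χ * j := by positivity
  linarith

/-- `θ_n > sin θ_n ≥ 1 / β_{n-1}`: the angle at time `n` is tied to `β` one step earlier, the index
for which the bound by `M_n` is available. -/
theorem th_ge (h : S.Standing α L) (hα : 0 < α) (hL : 0 < L) (hχ0 : 0 ≤ χ)
    (hβ : 0 < βbar) (hχ : χ < S.chiE α βbar)
    (hinf : {m : ℤ | m ≤ 0 ∧ S.be m ≤ βbar}.Infinite) {n : ℤ} (hn : n ≤ 0) :
    βbar⁻¹ * Real.exp (-(α * S.M α βbar χ n)) ≤ S.th n := by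
  have h1 := h.one_le (n - 1) (by omega)
  rw [sub_add_cancel] at h1
  have h2 := h.be_le_exp_M hα hL hχ0 hβ hχ hinf hn
  have hp := h.be_pos (n - 1) (by omega)
  have h3 := Real.sin_lt (h.th_pos n hn)
  have h4 : 1 ≤ βbar * Real.exp (α * S.M α βbar χ n) * S.th n := by
    have h5 : S.be (n - 1) * Real.sin (S.th n) ≤ S.be (n - 1) * S.th n := by gcongr
    have h6 := h.th_pos n hn
    have h7 : S.be (n - 1) * S.th n ≤ βbar * Real.exp (α * S.M α βbar χ n) * S.th n := by gcongr
    linarith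
  rw [Real.exp_neg, ← mul_inv, inv_le_iff_one_le_mul₀ (by positivity)]
  linarith

/-- The sum over `[m, 0)` is viewed as a function of `m`. The claim bounds its infimum over `m ≤
-N`. That infimum can rise from `N` to `N + 1` only if `-N` is a strict minimiser of its tail; then
`M` vanishes at `-N`, and the rise is at most `L - χ`. -/
theorem exists_sum_le_card (h : S.Standing α L) (hα : 0 < α) (hL : 0 < L)
    (hχ : χ < S.chiE α βbar) (N : ℕ) :
    ∃ m : ℤ, m ≤ -(N : ℤ) ∧ ∑ k ∈ Finset.Ico m 0, (S.lamE α βbar k - χ) ≤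
      (L - χ) * (({n : ℤ | n ≤ 0 ∧ S.M α βbar χ n = 0} ∩ Ioc (-(N : ℤ)) 0).ncard : ℝ) := by
  have hLχ : 0 < L - χ := by linarith [h.chiE_le hα hL (βbar := βbar)]
  induction N with
  | zero => exact ⟨0, by simp, by simp⟩
  | succ N ih =>
    obtain ⟨m, hm, hs⟩ := ih
    have hfin : ∀ N : ℕ, ({n : ℤ | n ≤ 0 ∧ S.M α βbar χ n = 0} ∩ Ioc (-(N : ℤ)) 0).Finite :=
      fun N => (finite_Ioc _ _).inter_of_right _
    have hmono : (({n : ℤ | n ≤ 0 ∧ S.M α βbar χ n = 0} ∩ Ioc (-(N : ℤ)) 0).ncard : ℝ) ≤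
        (({n : ℤ | n ≤ 0 ∧ S.M α βbar χ n = 0} ∩ Ioc (-((N + 1 : ℕ) : ℤ)) 0).ncard : ℝ) := by
      have h1 := ncard_le_ncard (s := {n : ℤ | n ≤ 0 ∧ S.M α βbar χ n = 0} ∩ Ioc (-(N : ℤ)) 0)
        (t := {n : ℤ | n ≤ 0 ∧ S.M α βbar χ n = 0} ∩ Ioc (-((N + 1 : ℕ) : ℤ)) 0)
        (inter_subset_inter_right _ (Ioc_subset_Ioc_left (by push_cast; omega))) (hfin _)
      exact_mod_cast h1
    by_cases hex : ∃ m' : ℤ, m' ≤ -((N + 1 : ℕ) : ℤ) ∧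
        ∑ k ∈ Finset.Ico m' 0, (S.lamE α βbar k - χ) ≤
          ∑ k ∈ Finset.Ico m 0, (S.lamE α βbar k - χ)
    · obtain ⟨m', hm', hs'⟩ := hex
      exact ⟨m', hm', (hs'.trans hs).trans (by gcongr)⟩
    · push Not at hex
      -- Otherwise `m` itself would be an admissible choice for `N + 1`.
      have hmN : m = -(N : ℤ) := by
        by_contra hne
        exact absurd (hex m (by push_cast; omega)) (lt_irrefl _)
      subst hmN
      have hM : S.M α βbar χ (-(N : ℤ)) = 0 := by
        refine le_antisymm (csSup_le ⟨_, _, le_rfl, rfl⟩ ?_) (h.M_nonneg hα hL hχ (by omega))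
        rintro s ⟨m', hm', rfl⟩
        rcases eq_or_lt_of_le hm' with rfl | hlt
        · simp
        · have h1 := hex m' (by push_cast; omega)
          have h2 := sum_Ico_split (a := fun k => S.lamE α βbar k - χ) hm' (by omega)
          have h3 : ∑ k ∈ Finset.Ico m' (-(N : ℤ)), (χ - S.lamE α βbar k) =
              -∑ k ∈ Finset.Ico m' (-(N : ℤ)), (S.lamE α βbar k - χ) := by
            rw [← Finset.sum_neg_distrib]; simp
          rw [h3]
          linarith
      have hset : {n : ℤ | n ≤ 0 ∧ S.M α βbar χ n = 0} ∩ Ioc (-((N + 1 : ℕ) : ℤ)) 0 =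
          insert (-(N : ℤ)) ({n : ℤ | n ≤ 0 ∧ S.M α βbar χ n = 0} ∩ Ioc (-(N : ℤ)) 0) := by
        ext n
        simp only [mem_inter_iff, mem_ofPred_eq, mem_Ioc, mem_insert_iff]
        constructor
        · rintro ⟨⟨h1, h2⟩, h3, -⟩
          by_cases hn : n = -(N : ℤ)
          · exact Or.inl hn
          · exact Or.inr ⟨⟨h1, h2⟩, by push_cast at h3; omega, h1⟩
        · rintro (rfl | ⟨⟨h1, h2⟩, h3, -⟩)
          · exact ⟨⟨by omega, hM⟩, by push_cast; omega, by omega⟩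
          · exact ⟨⟨h1, h2⟩, by push_cast; omega, h1⟩
      refine ⟨-((N + 1 : ℕ) : ℤ), le_rfl, ?_⟩
      rw [hset, ncard_insert_of_notMem (by simp) (hfin N), sum_Ico_bot (by push_cast; omega)]
      have h4 : -((N + 1 : ℕ) : ℤ) + 1 = -(N : ℤ) := by push_cast; ring
      rw [h4]
      have h5 := h.lamE_le βbar (n := -((N + 1 : ℕ) : ℤ)) (by push_cast; omega)
      push_cast at h5 hs ⊢
      linarith

theorem lowerDensity_ge (h : S.Standing α L) (hα : 0 < α) (hL : 0 < L)
    (hχ : χ < S.chiE α βbar) :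
    (S.chiE α βbar - χ) / (L - χ) ≤ lowerDensity {n : ℤ | n ≤ 0 ∧ S.M α βbar χ n = 0} := by
  have hLχ : 0 < L - χ := by linarith [h.chiE_le hα hL (βbar := βbar)]
  refine le_of_forall_lt_imp_le_of_dense fun q hq => ?_
  -- `q'` is taken positive as well as above `q`, so that `-m` may later be replaced by the smaller
  -- number `N`.
  obtain ⟨q', hq', hq'2⟩ := exists_between (max_lt hq (div_pos (sub_pos.2 hχ) hLχ))
  have hq'0 : 0 < q' := (le_max_right _ _).trans_lt hq'
  have hq'1 : q < q' := (le_max_left _ _).trans_lt hq'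
  refine hq'1.le.trans ?_
  rw [lt_div_iff₀ hLχ] at hq'2
  obtain ⟨m₀, hm₀, hsum⟩ := h.exists_forall_sum_ge hα hL hq'2
  refine le_liminf_of_le ?_ ?_
  · refine IsBoundedUnder.isCoboundedUnder_ge ⟨1, eventually_map.2 (Eventually.of_forall
      fun N => ?_)⟩
    rcases Nat.eq_zero_or_pos N with rfl | hN
    · simp
    · rw [div_le_one (by exact_mod_cast hN)]
      have h1 := ncard_le_ncard (s := {n : ℤ | n ≤ 0 ∧ S.M α βbar χ n = 0} ∩ Ioc (-(N : ℤ)) 0)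
        (t := Ioc (-(N : ℤ)) 0) inter_subset_right (finite_Ioc _ _)
      have h2 : (Ioc (-(N : ℤ)) 0).ncard = N := by
        rw [← Finset.coe_Ioc, ncard_coe_finset, Int.card_Ioc]; omega
      rw [h2] at h1
      exact_mod_cast h1
  · filter_upwards [eventually_ge_atTop (-m₀).toNat] with N hN
    obtain ⟨m, hm, hs⟩ := h.exists_sum_le_card hα hL hχ N
    have h1 := hsum m (by omega)
    have hN0 : (0 : ℝ) < N := by
      have : 0 < N := by omega
      exact_mod_cast this
    rw [le_div_iff₀ hN0]
    have h2 : (N : ℝ) ≤ -(m : ℝ) := by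
      have : (N : ℤ) ≤ -m := by omega
      exact_mod_cast this
    have h3 : q' * (L - χ) * N ≤ q' * (L - χ) * (-(m : ℝ)) := by gcongr
    refine le_of_mul_le_mul_left ?_ hLχ
    linarith

end Standing

end MapSeq

/-! ### Angles and coordinates of the splitting -/

/-- Sine control of the components of a sum of two vectors. -/
theorem norm_mul_sin_le_norm_add {E : Type*} [NormedAddCommGroup E] [InnerProductSpace ℝ E]
    {θ : ℝ} (hθ : 0 < θ) {v w : E}
    (hvw : v ≠ 0 → w ≠ 0 → θ ≤ InnerProductGeometry.angle v w)
    (hvw' : v ≠ 0 → w ≠ 0 → θ ≤ InnerProductGeometry.angle v (-w)) :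
    ‖v‖ * Real.sin θ ≤ ‖v + w‖ := by
  by_cases hv : v = 0
  · simp [hv]
  by_cases hw : w = 0
  · simpa [hw] using mul_le_mul_of_nonneg_left (Real.sin_le_one θ) (norm_nonneg v)
  have h1 := hvw hv hw
  have h2 := hvw' hv hw
  rw [InnerProductGeometry.angle_neg_right] at h2
  set φ := InnerProductGeometry.angle v w with hφ
  -- The bounds for `w` and `-w` place `φ` between `θ` and `π - θ`.
  have h3 : Real.sin θ ≤ Real.sin φ := by
    rcases le_total φ (Real.pi / 2) with h | h
    · exact Real.sin_le_sin_of_le_of_le_pi_div_two (by linarith [Real.pi_pos]) h h1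
    · rw [← Real.sin_pi_sub φ]
      exact Real.sin_le_sin_of_le_of_le_pi_div_two (by linarith [Real.pi_pos]) (by linarith) h2
  have h4 : 0 ≤ Real.sin φ := InnerProductGeometry.sin_angle_nonneg v w
  have h5 : ‖v‖ * Real.sin φ ≤ ‖v + w‖ := by
    refine abs_le_of_sq_le_sq' ?_ (norm_nonneg _) |>.2
    have h6 := norm_add_sq_real v w
    rw [← InnerProductGeometry.cos_angle_mul_norm_mul_norm v w, ← hφ] at h6
    have h7 := Real.sin_sq_add_cos_sq φ
    -- `‖v + w‖²` is the sum of the squares of `‖v‖ sin φ` and `‖v‖ cos φ + ‖w‖`.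
    nlinarith [sq_nonneg (‖v‖ * Real.cos φ + ‖w‖)]
  exact (mul_le_mul_of_nonneg_left h3 (norm_nonneg v)).trans h5

namespace MapSeq

variable {d : ℕ}

/-- The sum map `(v, w) ↦ v + w` from `E_n^u × E_n^s` to `V_n`. -/
noncomputable def join (S : MapSeq d) (n : ℤ) : S.Eu n × S.Es n →L[ℝ] Euc d :=
  (S.Eu n).subtypeL.coprod (S.Es n).subtypeL

open Classical in
/-- The coordinates of a vector with respect to the splitting of `V_n`. -/
noncomputable def coord (S : MapSeq d) (n : ℤ) : Euc d →L[ℝ] S.Eu n × S.Es n :=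
  if h : IsCompl (S.Eu n) (S.Es n) then
    LinearMap.toContinuousLinearMap
      (Submodule.prodEquivOfIsCompl _ _ h).symm.toLinearMap
  else 0

/-- The map `f_n` in the coordinates given by the splittings. -/
noncomputable def hat (S : MapSeq d) (n : ℤ) : S.Eu n × S.Es n → S.Eu (n + 1) × S.Es (n + 1) :=
  fun x => S.coord (n + 1) (S.f n (S.join n x))

variable {S : MapSeq d} {α L : ℝ}

theorem join_apply (n : ℤ) (x : S.Eu n × S.Es n) : S.join n x = (x.1 : Euc d) + (x.2 : Euc d) :=
  rfl

theorem norm_join_le (n : ℤ) (x : S.Eu n × S.Es n) : ‖S.join n x‖ ≤ 2 * ‖x‖ := by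
  have h1 : ‖(x.1 : Euc d)‖ ≤ ‖x‖ := norm_fst_le x
  have h2 : ‖(x.2 : Euc d)‖ ≤ ‖x‖ := norm_snd_le x
  rw [join_apply]
  linarith [norm_add_le (x.1 : Euc d) (x.2 : Euc d)]

namespace Standing

theorem coord_join (h : S.Standing α L) {n : ℤ} (hn : n ≤ 0) (x : S.Eu n × S.Es n) :
    S.coord n (S.join n x) = x := by
  rw [coord, dif_pos (h.isCompl n hn)]
  exact (Submodule.prodEquivOfIsCompl _ _ (h.isCompl n hn)).symm_apply_apply x

theorem join_coord (h : S.Standing α L) {n : ℤ} (hn : n ≤ 0) (y : Euc d) :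
    S.join n (S.coord n y) = y := by
  rw [coord, dif_pos (h.isCompl n hn)]
  exact (Submodule.prodEquivOfIsCompl _ _ (h.isCompl n hn)).apply_symm_apply y

/-- No upper bound on `θ_n` is assumed; positivity of the sine comes from `1 ≤ β_{n-1} sin θ_n`. -/
theorem sin_th_pos (h : S.Standing α L) {n : ℤ} (hn : n ≤ 0) : 0 < Real.sin (S.th n) := by
  have h1 := h.one_le (n - 1) (by omega)
  rw [sub_add_cancel] at h1
  have hp := h.be_pos (n - 1) (by omega)
  by_contra hs
  push Not at hs
  nlinarith

theorem norm_mul_sin_le_norm_join (h : S.Standing α L) {n : ℤ} (hn : n ≤ 0)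
    (x : S.Eu n × S.Es n) : ‖x‖ * Real.sin (S.th n) ≤ ‖S.join n x‖ := by
  have key : ∀ v ∈ S.Eu n, ∀ w ∈ S.Es n, v ≠ 0 → w ≠ 0 →
      S.th n ≤ InnerProductGeometry.angle v (-w) := fun v hv w hw hv0 hw0 =>
    h.angle n hn v hv (-w) ((S.Es n).neg_mem hw) hv0 (neg_ne_zero.2 hw0)
  have h1 : ‖(x.1 : Euc d)‖ * Real.sin (S.th n) ≤ ‖(x.1 : Euc d) + x.2‖ :=
    norm_mul_sin_le_norm_add (h.th_pos n hn) (h.angle n hn _ x.1.2 _ x.2.2)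
      (key _ x.1.2 _ x.2.2)
  have h2 : ‖(x.2 : Euc d)‖ * Real.sin (S.th n) ≤ ‖(x.2 : Euc d) + x.1‖ :=
    norm_mul_sin_le_norm_add (h.th_pos n hn)
      (fun a b => by
        rw [InnerProductGeometry.angle_comm]; exact h.angle n hn _ x.1.2 _ x.2.2 b a)
      (fun a b => by
        have := key _ x.1.2 _ x.2.2 b a
        rw [InnerProductGeometry.angle_neg_right] at this ⊢
        rwa [InnerProductGeometry.angle_comm])
  rw [join_apply]
  rw [add_comm (x.2 : Euc d)] at h2
  rw [Prod.norm_def, max_mul_of_nonneg _ _ (h.sin_th_pos hn).le]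
  exact max_le h1 h2

theorem norm_coord_le (h : S.Standing α L) {n : ℤ} (hn : n ≤ 0) (y : Euc d) :
    ‖S.coord n y‖ ≤ (Real.sin (S.th n))⁻¹ * ‖y‖ := by
  have := h.norm_mul_sin_le_norm_join hn (S.coord n y)
  rw [h.join_coord hn] at this
  rwa [inv_mul_eq_div, le_div_iff₀ (h.sin_th_pos hn)]

theorem norm_le_be_mul_norm_join (h : S.Standing α L) {n : ℤ} (hn : n ≤ 0)
    (x : S.Eu n × S.Es n) : ‖x‖ ≤ S.be (n - 1) * ‖S.join n x‖ := by
  have h1 := h.one_le (n - 1) (by omega)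
  rw [sub_add_cancel] at h1
  have h2 := h.norm_mul_sin_le_norm_join hn x
  have hp := h.be_pos (n - 1) (by omega)
  nlinarith [norm_nonneg x]

theorem join_hat (h : S.Standing α L) {n : ℤ} (hn : n < 0) (x : S.Eu n × S.Es n) :
    S.join (n + 1) (S.hat n x) = S.f n (S.join n x) :=
  h.join_coord (by omega) _

theorem join_injective (h : S.Standing α L) {n : ℤ} (hn : n ≤ 0) :
    Function.Injective (S.join n) :=
  Function.LeftInverse.injective (h.coord_join hn)

theorem join_mem_box_iff (h : S.Standing α L) {n : ℤ} (hn : n ≤ 0) {r s : ℝ}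
    {x : S.Eu n × S.Es n} :
    S.join n x ∈ S.box n r s ↔ x ∈ ball (0 : S.Eu n) r ×ˢ ball (0 : S.Es n) s := by
  constructor
  · rintro ⟨v, w, hv, hw, hx⟩
    have : x = (v, w) := h.join_injective hn hx
    subst this
    exact ⟨by simpa using hv, by simpa using hw⟩
  · rintro ⟨h1, h2⟩
    exact ⟨x.1, x.2, by simpa using h1, by simpa using h2, rfl⟩

theorem join_mem_graph_iff (h : S.Standing α L) {n : ℤ} (hn : n ≤ 0) {r : ℝ}
    {ψ : S.Eu n → S.Es n} {x : S.Eu n × S.Es n} :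
    S.join n x ∈ S.graph n r ψ ↔ x.1 ∈ ball (0 : S.Eu n) r ∧ x.2 = ψ x.1 := by
  constructor
  · rintro ⟨v, hv, hx⟩
    have : x = (v, ψ v) := h.join_injective hn hx
    subst this
    exact ⟨by simpa using hv, rfl⟩
  · rintro ⟨h1, h2⟩
    exact ⟨x.1, by simpa using h1, by rw [← h2]; rfl⟩

theorem differentiableAt (h : S.Standing α L) {n : ℤ} (hn : n ≤ 0) {x : Euc d}
    (hx : x ∈ S.Om n) : DifferentiableAt ℝ (S.f n) x :=
  ((h.contDiffOn n hn).differentiableOn one_ne_zero).differentiableAt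
    ((h.isOpen_dom n hn).mem_nhds hx)

theorem hasFDerivAt_hat (h : S.Standing α L) {n : ℤ} (hn : n ≤ 0) {x : S.Eu n × S.Es n}
    (hx : S.join n x ∈ S.Om n) :
    HasFDerivAt (S.hat n)
      ((S.coord (n + 1)).comp ((fderiv ℝ (S.f n) (S.join n x)).comp (S.join n))) x :=
  (S.coord (n + 1)).hasFDerivAt.comp x
    ((h.differentiableAt hn hx).hasFDerivAt.comp x (S.join n).hasFDerivAt)

/-- `join` has norm at most `2` and enters twice, once inside the Hölder power, where `2 ^ α ≤ 2`:
hence the factor `4`. The norm of `coord` at time `n + 1` cancels the sine in the Hölder bound of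
`Df_n`. Strictness of `n < 0` makes that splitting available. -/
theorem exists_splitStep (h : S.Standing α L) (hα : 0 < α) (hα1 : α ≤ 1) {n : ℤ} (hn : n < 0)
    {r γ : ℝ} (hr : 0 < r) (hγ : 0 < γ) (hγ1 : γ ≤ 1) (hbox : S.box n r (γ * r) ⊆ S.Om n)
    (hsmall : 4 * S.be n * r ^ α < Real.exp (S.lu n)) :
    ∃ A B, SplitStep α r γ (Real.exp (S.lu n)) (Real.exp (S.ls n)) (4 * S.be n) (S.hat n) A B := by
  have hn1 : n + 1 ≤ 0 := by omega
  set D := fderiv ℝ (S.f n) 0 with hD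
  have hDu : ∀ v : S.Eu n, D v ∈ S.Eu (n + 1) := fun v => by
    rw [← h.map_Eu n hn.le]; exact Submodule.mem_map_of_mem v.2
  have hDs : ∀ v : S.Es n, D v ∈ S.Es (n + 1) := fun v => by
    rw [← h.map_Es n hn.le]; exact Submodule.mem_map_of_mem v.2
  let A₀ : S.Eu n →ₗ[ℝ] S.Eu (n + 1) :=
    (D.toLinearMap.comp (S.Eu n).subtype).codRestrict (S.Eu (n + 1)) hDu
  let B₀ : S.Es n →ₗ[ℝ] S.Es (n + 1) :=
    (D.toLinearMap.comp (S.Es n).subtype).codRestrict (S.Es (n + 1)) hDs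
  have hA₀ : ∀ v : S.Eu n, ((A₀ v : S.Eu (n + 1)) : Euc d) = D v := fun v => rfl
  have hB₀ : ∀ v : S.Es n, ((B₀ v : S.Es (n + 1)) : Euc d) = D v := fun v => rfl
  have hexp : ∀ v : S.Eu n, Real.exp (S.lu n) * ‖v‖ ≤ ‖A₀ v‖ := fun v =>
    h.expand n hn.le v v.2
  have hbij : Function.Bijective A₀ := by
    constructor
    · rw [injective_iff_map_eq_zero]
      intro v hv
      have h1 := hexp v
      rw [hv, norm_zero] at h1
      have h2 : ‖v‖ ≤ 0 := by
        by_contra hc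
        push Not at hc
        have := mul_pos (Real.exp_pos (S.lu n)) hc
        linarith
      simpa using h2
    · intro w
      have hw : (w : Euc d) ∈ (S.Eu n).map D.toLinearMap := by
        rw [h.map_Eu n hn.le]; exact w.2
      obtain ⟨v, hv, hvw⟩ := hw
      exact ⟨⟨v, hv⟩, Subtype.ext hvw⟩
  let A : S.Eu n ≃L[ℝ] S.Eu (n + 1) := (LinearEquiv.ofBijective A₀ hbij).toContinuousLinearEquiv
  let B : S.Es n →L[ℝ] S.Es (n + 1) := LinearMap.toContinuousLinearMap B₀
  have hmem : ∀ x ∈ ball (0 : S.Eu n) r ×ˢ ball (0 : S.Es n) (γ * r), S.join n x ∈ S.Om n :=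
    fun x hx => hbox ((h.join_mem_box_iff hn.le).2 hx)
  have hbe := h.be_pos n hn.le
  refine ⟨A, B, ⟨hα, hr, hγ, hγ1, by positivity, (Real.exp_pos _).le, hsmall,
    fun x hx => (h.hasFDerivAt_hat hn.le (hmem x hx)).differentiableAt, ?_, ?_, ?_, hexp,
    fun w => h.contract n hn.le w w.2⟩⟩
  · show S.coord (n + 1) (S.f n (S.join n 0)) = 0
    rw [_root_.map_zero, h.map_zero n hn.le, _root_.map_zero]
  · have h0 : S.join n 0 ∈ S.Om n := by
      rw [_root_.map_zero]; exact h.zero_mem n hn.le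
    rw [(h.hasFDerivAt_hat hn.le h0).fderiv]
    refine ContinuousLinearMap.ext fun x => h.join_injective hn1 ?_
    simp only [_root_.map_zero, ContinuousLinearMap.comp_apply]
    rw [h.join_coord hn1, join_apply, join_apply, ← hD, map_add, ← hA₀, ← hB₀]
    rfl
  · intro x hx y hy
    rw [(h.hasFDerivAt_hat hn.le (hmem x hx)).fderiv, (h.hasFDerivAt_hat hn.le (hmem y hy)).fderiv]
    refine ContinuousLinearMap.opNorm_le_bound _ (by positivity) fun p => ?_
    have h1 := h.norm_coord_le hn1
      ((fderiv ℝ (S.f n) (S.join n x) - fderiv ℝ (S.f n) (S.join n y)) (S.join n p))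
    have h2 := (fderiv ℝ (S.f n) (S.join n x) - fderiv ℝ (S.f n) (S.join n y)).le_of_opNorm_le
      (h.holder n hn.le _ (hmem x hx) _ (hmem y hy)) (S.join n p)
    have hs := h.sin_th_pos hn1
    have h3 : ‖S.join n x - S.join n y‖ ^ α ≤ 2 * ‖x - y‖ ^ α := by
      rw [← map_sub]
      calc ‖S.join n (x - y)‖ ^ α ≤ (2 * ‖x - y‖) ^ α := by
            gcongr; exact norm_join_le n _
        _ = 2 ^ α * ‖x - y‖ ^ α := Real.mul_rpow (by norm_num) (norm_nonneg _)
        _ ≤ 2 * ‖x - y‖ ^ α := by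
            gcongr
            calc (2 : ℝ) ^ α ≤ 2 ^ (1 : ℝ) := by gcongr; norm_num
              _ = 2 := Real.rpow_one 2
    have h4 := norm_join_le n p
    calc _ = ‖S.coord (n + 1)
          ((fderiv ℝ (S.f n) (S.join n x) - fderiv ℝ (S.f n) (S.join n y)) (S.join n p))‖ := by
          simp
      _ ≤ _ := h1
      _ ≤ (Real.sin (S.th (n + 1)))⁻¹ * (S.be n * Real.sin (S.th (n + 1)) *
          (2 * ‖x - y‖ ^ α) * (2 * ‖p‖)) := by
          gcongr
          refine h2.trans ?_
          gcongr
      _ = 4 * S.be n * ‖x - y‖ ^ α * ‖p‖ := by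
          field_simp
          ring

end Standing

theorem Admissible.tangentGraph {n : ℤ} {r κ : ℝ} {ψ : S.Eu n → S.Es n}
    (h : S.Admissible α n r κ ψ) : TangentGraph α r κ ψ :=
  ⟨fun _ hv => (h.1.differentiableOn one_ne_zero).differentiableAt (isOpen_ball.mem_nhds hv),
    h.2.1, h.2.2.1, h.2.2.2⟩

theorem _root_.TangentGraph.admissible {n : ℤ} {r κ : ℝ} {ψ : S.Eu n → S.Es n} (hα : 0 < α)
    (h : TangentGraph α r κ ψ) : S.Admissible α n r κ ψ :=
  ⟨h.contDiffOn hα, h.map_zero, h.deriv_zero, h.holder⟩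

end MapSeq

/-! ### Elementary estimates for the constants -/

theorem one_sub_ge_exp {s : ℝ} (hs0 : 0 ≤ s) (hs : s ≤ 1 / 10) : Real.exp (-(2 * s)) ≤ 1 - s := by
  rw [Real.exp_neg, inv_le_comm₀ (Real.exp_pos _) (by linarith)]
  refine le_trans ?_ (Real.add_one_le_exp _)
  rw [inv_le_iff_one_le_mul₀ (by linarith)]
  nlinarith

/-- The estimate of the Hölder constant of the graph transform. -/
theorem transform_const_le {a b c ε γ κ s α : ℝ} (hα : 0 ≤ α) (hα1 : α ≤ 1) (ha : 0 < a)
    (hc : 0 ≤ c) (hb : 0 ≤ b) (hε : 0 ≤ ε) (hκ : 0 ≤ κ) (hγ1 : γ ≤ 1)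
    (hs : 0 ≤ s) (hs1 : s ≤ 1 / 10)
    (hba : b ≤ s * a * κ) (hbc : b ≤ s * c * κ) (hεa : ε ≤ s * a) (hεc : ε ≤ s * c) :
    ((c * κ + b + ε * κ) / (a - ε) + (c * γ + ε) * (b + ε * κ) / (a - ε) ^ 2) *
      ((a - ε)⁻¹) ^ α ≤ Real.exp (10 * s) * (κ * (c / a) * (a⁻¹) ^ α) := by
  have hs' : 0 < 1 - s := by linarith
  have hμ : a * (1 - s) ≤ a - ε := by linarith
  have hμ0 : 0 < a * (1 - s) := by positivity
  have hμ1 : 0 < a - ε := hμ0.trans_le hμ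
  have h1 : (c * κ + b + ε * κ) / (a - ε) ≤ (c * κ * (1 + 2 * s)) / (a * (1 - s)) := by
    have : c * κ + b + ε * κ ≤ c * κ * (1 + 2 * s) := by nlinarith
    gcongr
  have h2 : (c * γ + ε) * (b + ε * κ) / (a - ε) ^ 2 ≤
      (c * (1 + s)) * (2 * s * a * κ) / (a * (1 - s)) ^ 2 := by
    have h3 : c * γ + ε ≤ c * (1 + s) := by nlinarith
    have h4 : b + ε * κ ≤ 2 * s * a * κ := by nlinarith
    gcongr
  have h5 : ((a - ε)⁻¹) ^ α ≤ (a⁻¹) ^ α * (1 - s)⁻¹ := by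
    calc ((a - ε)⁻¹) ^ α ≤ ((a * (1 - s))⁻¹) ^ α := by gcongr
      _ = (a⁻¹) ^ α * ((1 - s)⁻¹) ^ α := by
          rw [mul_inv, Real.mul_rpow (by positivity) (by positivity)]
      _ ≤ (a⁻¹) ^ α * (1 - s)⁻¹ := by
          gcongr
          have h6 : 1 ≤ (1 - s)⁻¹ := (one_le_inv₀ hs').2 (by linarith)
          calc ((1 - s)⁻¹) ^ α ≤ ((1 - s)⁻¹) ^ (1 : ℝ) := Real.rpow_le_rpow_of_exponent_le h6 hα1
            _ = _ := Real.rpow_one _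
  -- The left side collapses to `(1 + 3 * s) / (1 - s) ^ 3`, which is at most `1 + 10 * s` for `s ≤
  -- 1 / 10`.
  have h7 : (1 + 2 * s) / (1 - s) ^ 2 + 2 * s * (1 + s) / (1 - s) ^ 3 ≤ Real.exp (10 * s) := by
    refine le_trans ?_ (Real.add_one_le_exp _)
    have : (1 + 2 * s) / (1 - s) ^ 2 + 2 * s * (1 + s) / (1 - s) ^ 3 =
        (1 + 3 * s) / (1 - s) ^ 3 := by
      field_simp
      ring
    rw [this, div_le_iff₀ (by positivity)]
    have h8 : 1 - 3 * s ≤ (1 - s) ^ 3 := by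
      nlinarith [mul_nonneg (sq_nonneg s) (show 0 ≤ 3 - s by linarith)]
    have h9 : (10 * s + 1) * (1 - 3 * s) ≤ (10 * s + 1) * (1 - s) ^ 3 := by gcongr
    nlinarith
  calc _ ≤ ((c * κ * (1 + 2 * s)) / (a * (1 - s)) +
        (c * (1 + s)) * (2 * s * a * κ) / (a * (1 - s)) ^ 2) * ((a⁻¹) ^ α * (1 - s)⁻¹) := by
        gcongr
    _ = ((1 + 2 * s) / (1 - s) ^ 2 + 2 * s * (1 + s) / (1 - s) ^ 3) *
        (κ * (c / a) * (a⁻¹) ^ α) := by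
        field_simp
    _ ≤ _ := by gcongr

/-! ### Uniform smallness and existence of the graphs -/

namespace MapSeq

variable {d : ℕ}

/-- The hypotheses on the data and on the constants under which invariant graphs are built;
`s` measures the relative size of the nonlinearity. -/
structure GraphSetup (S : MapSeq d) (α L βbar χ rbar γ κbar s : ℝ) : Prop where
  standing : S.Standing α L
  alpha_pos : 0 < α
  alpha_le : α ≤ 1
  L_pos : 0 < L
  beta_pos : 0 < βbar
  chi_pos : 0 < χ
  chi_lt : χ < S.chiE α βbar
  infinite : {m : ℤ | m ≤ 0 ∧ S.be m ≤ βbar}.Infinite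
  gamma_pos : 0 < γ
  rbar_pos : 0 < rbar
  kappa_rbar : κbar * rbar ^ α ≤ γ
  s_pos : 0 < s
  s_le : s ≤ 1 / 10
  s_chi : 30 * s ≤ α * χ
  kappa_ge : 4 * Real.exp (2 * L) * βbar ≤ s * κbar
  gamma_le : 2 * Real.exp (2 * L) * γ ≤ s
  box_subset : ∀ n ≤ 0, S.localBox α βbar χ rbar γ n ⊆ S.Om n

namespace GraphSetup

variable {S : MapSeq d} {α L βbar χ rbar γ κbar s : ℝ}

theorem kappa_pos (h : S.GraphSetup α L βbar χ rbar γ κbar s) : 0 < κbar := by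
  have := h.beta_pos
  have h1 : 0 < s * κbar := lt_of_lt_of_le (by positivity) h.kappa_ge
  exact (mul_pos_iff_of_pos_left h.s_pos).1 h1

theorem two_gamma_le (h : S.GraphSetup α L βbar χ rbar γ κbar s) : 2 * γ ≤ s := by
  have h1 : 1 ≤ Real.exp (2 * L) := Real.one_le_exp (by linarith [h.L_pos])
  have := h.gamma_le
  nlinarith [h.gamma_pos]

theorem gamma_le_one (h : S.GraphSetup α L βbar χ rbar γ κbar s) : γ ≤ 1 := by
  linarith [h.two_gamma_le, h.s_le, h.gamma_pos]

theorem radius_pos (h : S.GraphSetup α L βbar χ rbar γ κbar s) (n : ℤ) :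
    0 < S.radius α βbar χ rbar n := mul_pos h.rbar_pos (Real.exp_pos _)

theorem holderBound_pos (h : S.GraphSetup α L βbar χ rbar γ κbar s) (n : ℤ) :
    0 < S.holderBound α βbar χ κbar n := mul_pos h.kappa_pos (Real.exp_pos _)

theorem radius_rpow (h : S.GraphSetup α L βbar χ rbar γ κbar s) (n : ℤ) :
    S.radius α βbar χ rbar n ^ α = rbar ^ α * Real.exp (-(α * S.M α βbar χ n)) := by
  rw [radius, Real.mul_rpow h.rbar_pos.le (Real.exp_pos _).le, ← Real.exp_mul]
  ring_nf

theorem holderBound_mul_radius (h : S.GraphSetup α L βbar χ rbar γ κbar s) (n : ℤ) :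
    S.holderBound α βbar χ κbar n * S.radius α βbar χ rbar n ^ α ≤ γ := by
  rw [h.radius_rpow, holderBound]
  calc _ = κbar * rbar ^ α * (Real.exp (α * S.M α βbar χ n) *
        Real.exp (-(α * S.M α βbar χ n))) := by ring
    _ ≤ γ := by
        rw [← Real.exp_add, add_neg_cancel, Real.exp_zero, mul_one]
        exact h.kappa_rbar

theorem be_le_prev (h : S.GraphSetup α L βbar χ rbar γ κbar s) {n : ℤ} (hn : n ≤ 0) :
    S.be n ≤ Real.exp L * S.be (n - 1) := by
  have := h.standing.be_succ (n - 1) (by omega)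
  rwa [sub_add_cancel] at this

/-- One factor `e^L` in `kappa_ge` moves from `β_{n-1}` to `β_n`. The other leaves `e^{-L}` on the
right, a lower bound for both rates, so the nonlinearity is small against either. -/
theorem be_le_holderBound (h : S.GraphSetup α L βbar χ rbar γ κbar s) {n : ℤ} (hn : n ≤ 0) :
    4 * S.be n ≤ s * Real.exp (-L) * S.holderBound α βbar χ κbar n := by
  have h1 := h.be_le_prev hn
  have h2 := h.standing.be_le_exp_M h.alpha_pos h.L_pos h.chi_pos.le h.beta_pos h.chi_lt
    h.infinite hn
  have h3 : Real.exp (2 * L) = Real.exp L * Real.exp L := by rw [← Real.exp_add]; ring_nf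
  have h4 := h.kappa_ge
  have h5 := Real.exp_pos L
  rw [holderBound, Real.exp_neg]
  set E := Real.exp (α * S.M α βbar χ n) with hE
  have hE0 : 0 < E := Real.exp_pos _
  calc 4 * S.be n ≤ 4 * (Real.exp L * (βbar * E)) := by
        gcongr
        exact h1.trans (by gcongr)
    _ = (4 * Real.exp (2 * L) * βbar) * (Real.exp L)⁻¹ * E := by
        rw [h3]; field_simp
    _ ≤ (s * κbar) * (Real.exp L)⁻¹ * E := by gcongr
    _ = _ := by ring

theorem exp_neg_L_le_lu (h : S.GraphSetup α L βbar χ rbar γ κbar s) {n : ℤ} (hn : n ≤ 0) :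
    Real.exp (-L) ≤ Real.exp (S.lu n) :=
  Real.exp_le_exp.2 (abs_le.1 (h.standing.abs_lu n hn)).1

theorem exp_neg_L_le_ls (h : S.GraphSetup α L βbar χ rbar γ κbar s) {n : ℤ} (hn : n ≤ 0) :
    Real.exp (-L) ≤ Real.exp (S.ls n) :=
  Real.exp_le_exp.2 (abs_le.1 (h.standing.abs_ls n hn)).1

theorem eps_le (h : S.GraphSetup α L βbar χ rbar γ κbar s) {n : ℤ} (hn : n ≤ 0) :
    4 * S.be n * S.radius α βbar χ rbar n ^ α ≤ s * γ * Real.exp (-L) := by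
  have h1 := h.be_le_holderBound hn
  have h2 := h.holderBound_mul_radius n
  have h3 : 0 ≤ S.radius α βbar χ rbar n ^ α := Real.rpow_nonneg (h.radius_pos n).le _
  have h4 := h.s_pos
  calc _ ≤ s * Real.exp (-L) * S.holderBound α βbar χ κbar n * S.radius α βbar χ rbar n ^ α := by
        gcongr
    _ = s * Real.exp (-L) * (S.holderBound α βbar χ κbar n * S.radius α βbar χ rbar n ^ α) := by
        ring
    _ ≤ s * Real.exp (-L) * γ := by gcongr
    _ = _ := by ring

theorem eps_le_lu (h : S.GraphSetup α L βbar χ rbar γ κbar s) {n : ℤ} (hn : n ≤ 0) :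
    4 * S.be n * S.radius α βbar χ rbar n ^ α ≤ s * Real.exp (S.lu n) := by
  have h1 := h.eps_le hn
  have h2 := h.exp_neg_L_le_lu hn
  have h3 : s * γ * Real.exp (-L) ≤ s * 1 * Real.exp (S.lu n) := by
    have := h.s_pos
    have := h.gamma_le_one
    gcongr
  linarith

theorem eps_le_ls (h : S.GraphSetup α L βbar χ rbar γ κbar s) {n : ℤ} (hn : n ≤ 0) :
    4 * S.be n * S.radius α βbar χ rbar n ^ α ≤ s * γ * Real.exp (S.ls n) := by
  have h1 := h.eps_le hn
  have h2 := h.exp_neg_L_le_ls hn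
  have h3 : s * γ * Real.exp (-L) ≤ s * γ * Real.exp (S.ls n) := by
    have := h.s_pos
    have := h.gamma_pos
    gcongr
  linarith

theorem eps_nonneg (h : S.GraphSetup α L βbar χ rbar γ κbar s) {n : ℤ} (hn : n ≤ 0) :
    0 ≤ 4 * S.be n * S.radius α βbar χ rbar n ^ α := by
  have := h.standing.be_pos n hn
  have := h.radius_pos n
  positivity

theorem mu_ge (h : S.GraphSetup α L βbar χ rbar γ κbar s) {n : ℤ} (hn : n ≤ 0) :
    Real.exp (S.lu n - 2 * s) ≤
      Real.exp (S.lu n) - 4 * S.be n * S.radius α βbar χ rbar n ^ α := by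
  have h1 := h.eps_le_lu hn
  have h2 := one_sub_ge_exp h.s_pos.le h.s_le
  rw [sub_eq_add_neg, Real.exp_add]
  nlinarith [Real.exp_pos (S.lu n)]

theorem exists_splitStep (h : S.GraphSetup α L βbar χ rbar γ κbar s) {n : ℤ} (hn : n < 0) :
    ∃ A B, SplitStep α (S.radius α βbar χ rbar n) γ (Real.exp (S.lu n)) (Real.exp (S.ls n))
      (4 * S.be n) (S.hat n) A B := by
  refine h.standing.exists_splitStep h.alpha_pos h.alpha_le hn (h.radius_pos n) h.gamma_pos
    h.gamma_le_one (h.box_subset n hn.le) ?_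
  linarith [h.mu_ge hn.le, Real.exp_pos (S.lu n - 2 * s)]

/-- The recursion for `M` together with `λ^e ≤ λ^u` shrinks radii relative to the expansion by a
spare factor `e^{-χ}`, and `2 * s ≤ χ` pays for the nonlinearity. -/
theorem radius_succ_le (h : S.GraphSetup α L βbar χ rbar γ κbar s) {n : ℤ} (hn : n < 0) :
    S.radius α βbar χ rbar (n + 1) ≤
      (Real.exp (S.lu n) - 4 * S.be n * S.radius α βbar χ rbar n ^ α) *
        S.radius α βbar χ rbar n := by
  have h1 := h.standing.M_succ h.alpha_pos h.L_pos h.chi_lt hn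
  have h2 := S.lamE_le_lu α βbar n
  have h3 : S.radius α βbar χ rbar (n + 1) ≤
      Real.exp (S.lu n - 2 * s) * S.radius α βbar χ rbar n := by
    rw [radius, radius, mul_left_comm, ← Real.exp_add]
    have h4 : 2 * s ≤ χ := by nlinarith [h.s_chi, h.alpha_le, h.chi_pos, h.s_pos]
    have := h.rbar_pos
    gcongr
    linarith
  refine h3.trans ?_
  have := h.radius_pos n
  gcongr
  exact h.mu_ge hn.le

/-- Here the defect in `λ^e` is used: it compensates `λ^s - λ^u` in the linear transformation of
Hölder constants. The surplus `e^{αχ}` absorbs the distortion `e^{10 s}`. -/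
theorem transform_bound (h : S.GraphSetup α L βbar χ rbar γ κbar s) {n : ℤ} (hn : n < 0) :
    Real.exp (10 * s) * (S.holderBound α βbar χ κbar n *
      (Real.exp (S.ls n) / Real.exp (S.lu n)) * ((Real.exp (S.lu n))⁻¹) ^ α) ≤
      S.holderBound α βbar χ κbar (n + 1) := by
  have h1 := h.standing.M_succ h.alpha_pos h.L_pos h.chi_lt hn
  have h2 := S.alpha_mul_lamE_le h.alpha_pos βbar n
  have h3 : 10 * s ≤ α * χ := by linarith [h.s_chi, h.s_pos]
  rw [holderBound, holderBound, ← Real.exp_sub, ← Real.exp_neg, ← Real.exp_mul]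
  calc _ = κbar * Real.exp (10 * s + α * S.M α βbar χ n + (S.ls n - S.lu n) + -S.lu n * α) := by
        rw [Real.exp_add, Real.exp_add, Real.exp_add]; ring
    _ ≤ _ := by
        have := h.kappa_pos
        gcongr
        nlinarith [mul_le_mul_of_nonneg_left h1 h.alpha_pos.le]

theorem exists_transform (h : S.GraphSetup α L βbar χ rbar γ κbar s) {n : ℤ} (hn : n < 0)
    {ψ : S.Eu n → S.Es n}
    (hψ : TangentGraph α (S.radius α βbar χ rbar n) (S.holderBound α βbar χ κbar n) ψ) :
    ∃ ψ' : S.Eu (n + 1) → S.Es (n + 1), TangentGraph α (S.radius α βbar χ rbar (n + 1))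
        (S.holderBound α βbar χ κbar (n + 1)) ψ' ∧
      ∀ v' ∈ ball (0 : S.Eu (n + 1)) (S.radius α βbar χ rbar (n + 1)),
        ∃ v ∈ ball (0 : S.Eu n) (S.radius α βbar χ rbar n), S.hat n (v, ψ v) = (v', ψ' v') := by
  obtain ⟨A, B, hstep⟩ := h.exists_splitStep hn
  refine hstep.exists_transform (h.holderBound_pos n).le (h.holderBound_mul_radius n) hψ
    (h.radius_pos _) (h.radius_succ_le hn) (le_trans ?_ (h.transform_bound hn))
  have hb := h.be_le_holderBound hn.le
  have hκ := h.holderBound_pos n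
  have hs := h.s_pos
  have h1 : s * Real.exp (-L) * S.holderBound α βbar χ κbar n ≤
      s * Real.exp (S.lu n) * S.holderBound α βbar χ κbar n := by
    have := h.exp_neg_L_le_lu hn.le
    gcongr
  have h2 : s * Real.exp (-L) * S.holderBound α βbar χ κbar n ≤
      s * Real.exp (S.ls n) * S.holderBound α βbar χ κbar n := by
    have := h.exp_neg_L_le_ls hn.le
    gcongr
  have h3 : s * γ * Real.exp (S.ls n) ≤ s * Real.exp (S.ls n) := by
    have := h.gamma_le_one
    have := Real.exp_pos (S.ls n)
    nlinarith [mul_pos hs this]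
  have hbe := h.standing.be_pos n hn.le
  exact transform_const_le h.alpha_pos.le h.alpha_le (Real.exp_pos _) (Real.exp_pos _).le
    (by positivity) (h.eps_nonneg hn.le) hκ.le h.gamma_le_one hs.le h.s_le
    (hb.trans h1) (hb.trans h2) (h.eps_le_lu hn.le) ((h.eps_le_ls hn.le).trans h3)

/-- A family of functions whose graphs are invariant, in coordinates. -/
structure GraphFamily (S : MapSeq d) (α βbar χ rbar κbar : ℝ)
    (ψ : ∀ n : ℤ, S.Eu n → S.Es n) : Prop where
  tangent : ∀ n ≤ 0, TangentGraph α (S.radius α βbar χ rbar n) (S.holderBound α βbar χ κbar n)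
    (ψ n)
  invariant : ∀ n < 0, ∀ v' ∈ ball (0 : S.Eu (n + 1)) (S.radius α βbar χ rbar (n + 1)),
    ∃ v ∈ ball (0 : S.Eu n) (S.radius α βbar χ rbar n),
      S.hat n (v, ψ n v) = (v', ψ (n + 1) v')

theorem exists_graphFamily (h : S.GraphSetup α L βbar χ rbar γ κbar s) :
    ∃ ψ, GraphFamily S α βbar χ rbar κbar ψ := by
  obtain ⟨ψ, h1, h2⟩ := exists_invariant_family (U := fun n => S.Eu n) (W := fun n => S.Es n)
    (α := α) (γ := γ) (r := S.radius α βbar χ rbar) (κ := S.holderBound α βbar χ κbar)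
    (μ := fun n => Real.exp (S.lu n) - 4 * S.be n * S.radius α βbar χ rbar n ^ α)
    (F := S.hat) h.alpha_pos h.gamma_pos h.radius_pos (fun n => (h.holderBound_pos n).le)
    h.holderBound_mul_radius (fun n hn ψ hψ => h.exists_transform hn hψ)
    (fun n hn => (Real.exp_pos _).trans_le (h.mu_ge hn.le)) (fun n hn => h.radius_succ_le hn)
    (fun n hn ψ hψ v hv => by
      obtain ⟨A, B, hstep⟩ := h.exists_splitStep hn
      have hlip := hψ.lipGraph h.alpha_pos (h.holderBound_pos n).le (h.holderBound_mul_radius n)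
      have := hstep.graph_expand hlip hv (mem_ball_self (h.radius_pos n))
      rw [hstep.fst_map_zero hlip.1] at this
      simpa using this)
    (fun n hn x hx => by
      obtain ⟨A, B, hstep⟩ := h.exists_splitStep hn
      exact (hstep.diff x hx).continuousAt)
  exact ⟨ψ, h1, h2⟩

theorem invariantFamily_iff (h : S.GraphSetup α L βbar χ rbar γ κbar s)
    {ψ : ∀ n : ℤ, S.Eu n → S.Es n} :
    S.InvariantFamily α βbar χ rbar κbar ψ ↔ GraphFamily S α βbar χ rbar κbar ψ := by
  constructor
  · rintro ⟨h1, h2⟩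
    refine ⟨fun n hn => (h1 n hn).tangentGraph, fun n hn v' hv' => ?_⟩
    have h3 : S.join (n + 1) (v', ψ (n + 1) v') ∈
        S.graph (n + 1) (S.radius α βbar χ rbar (n + 1)) (ψ (n + 1)) :=
      (h.standing.join_mem_graph_iff (by omega)).2 ⟨hv', rfl⟩
    obtain ⟨y, hy, hy2⟩ := h2 n hn h3
    rw [← h.standing.join_coord hn.le y] at hy hy2
    obtain ⟨h4, h5⟩ := (h.standing.join_mem_graph_iff hn.le).1 hy
    refine ⟨_, h4, h.standing.join_injective (show n + 1 ≤ 0 by omega) ?_⟩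
    rw [h.standing.join_hat hn, ← hy2, ← h5]
  · rintro ⟨h1, h2⟩
    refine ⟨fun n hn => (h1 n hn).admissible h.alpha_pos, fun n hn y hy => ?_⟩
    rw [← h.standing.join_coord (show n + 1 ≤ 0 by omega) y] at hy ⊢
    obtain ⟨h4, h5⟩ := (h.standing.join_mem_graph_iff (by omega)).1 hy
    obtain ⟨v, hv, hv2⟩ := h2 n hn _ h4
    refine ⟨S.join n (v, ψ n v), (h.standing.join_mem_graph_iff hn.le).2 ⟨hv, rfl⟩, ?_⟩
    rw [← h.standing.join_hat hn, hv2, ← h5]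

end GraphSetup

end MapSeq

/-! ### Orbits and expansion along the graphs -/

theorem le_exp_sum_mul {δ g : ℤ → ℝ} {m n : ℤ} (hmn : m ≤ n)
    (h : ∀ k, m ≤ k → k < n → δ (k + 1) ≤ Real.exp (g k) * δ k) :
    δ n ≤ Real.exp (∑ k ∈ Finset.Ico m n, g k) * δ m := by
  induction n, hmn using Int.leInduction with
  | base => simp
  | succ n hmn ih =>
    rw [sum_Ico_top hmn, Real.exp_add, mul_comm (Real.exp _), mul_assoc]
    exact (h n hmn (by omega)).trans (by gcongr; exact ih fun k h1 h2 => h k h1 (by omega))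

theorem exp_sum_mul_le {δ g : ℤ → ℝ} {m n : ℤ} (hmn : m ≤ n)
    (h : ∀ k, m ≤ k → k < n → Real.exp (g k) * δ k ≤ δ (k + 1)) :
    Real.exp (∑ k ∈ Finset.Ico m n, g k) * δ m ≤ δ n := by
  have := le_exp_sum_mul (δ := fun k => -δ k) hmn (fun k h1 h2 => by
    have := h k h1 h2
    show -δ (k + 1) ≤ Real.exp (g k) * -δ k
    linarith)
  simp only [mul_neg] at this
  linarith

namespace MapSeq

variable {d : ℕ} {S : MapSeq d}

theorem F_self (n : ℤ) (x : Euc d) : S.F n n x = x := by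
  simp [F, iter]

theorem F_succ {m n : ℤ} (hmn : m ≤ n) (x : Euc d) : S.F m (n + 1) x = S.f n (S.F m n x) := by
  have h1 : (n + 1 - m).toNat = (n - m).toNat + 1 := by omega
  have h2 : m + ((n - m).toNat : ℤ) = n := by omega
  rw [F, h1]
  show S.f (m + ((n - m).toNat : ℤ)) (S.iter m (n - m).toNat x) = _
  rw [h2, F]

theorem F_one (n : ℤ) (x : Euc d) : S.F n (n + 1) x = S.f n x := by
  rw [F_succ le_rfl, F_self]

theorem F_comp {m k n : ℤ} (hmk : m ≤ k) (hkn : k ≤ n) (x : Euc d) :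
    S.F k n (S.F m k x) = S.F m n x := by
  induction n, hkn using Int.leInduction with
  | base => rw [F_self]
  | succ n hkn ih => rw [F_succ hkn, ih, F_succ (hmk.trans hkn)]

theorem F_mem_of_mem_orbitDomain {D : ℤ → Set (Euc d)} {m n : ℤ} {x : Euc d}
    (hx : x ∈ S.orbitDomain D m n) {k : ℤ} (h1 : m ≤ k) (h2 : k < n) : S.F m k x ∈ D k :=
  connectedComponentIn_subset _ _ hx k h1 h2

theorem Standing.F_injective {α L : ℝ} (h : S.Standing α L) {m n : ℤ} (hmn : m ≤ n) (hn : n ≤ 0)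
    {x y : Euc d} (hx : ∀ k, m ≤ k → k < n → S.F m k x ∈ S.Om k)
    (hy : ∀ k, m ≤ k → k < n → S.F m k y ∈ S.Om k) (hxy : S.F m n x = S.F m n y) : x = y := by
  induction n, hmn using Int.leInduction with
  | base => rwa [F_self, F_self] at hxy
  | succ n hmn ih =>
    rw [F_succ hmn, F_succ hmn] at hxy
    exact ih (by omega) (fun k h1 h2 => hx k h1 (by omega)) (fun k h1 h2 => hy k h1 (by omega))
      (h.injOn n (by omega) (hx n hmn (by omega)) (hy n hmn (by omega)) hxy)

namespace GraphSetup

variable {α L βbar χ rbar γ κbar s : ℝ}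

theorem GraphFamily.lipGraph (h : S.GraphSetup α L βbar χ rbar γ κbar s)
    {ψ : ∀ n : ℤ, S.Eu n → S.Es n} (hψ : GraphFamily S α βbar χ rbar κbar ψ) {n : ℤ}
    (hn : n ≤ 0) : LipGraph (S.radius α βbar χ rbar n) γ (ψ n) :=
  (hψ.tangent n hn).lipGraph h.alpha_pos (h.holderBound_pos n).le (h.holderBound_mul_radius n)

theorem join_mem_localBox_iff (h : S.GraphSetup α L βbar χ rbar γ κbar s) {n : ℤ} (hn : n ≤ 0)
    {x : S.Eu n × S.Es n} : S.join n x ∈ S.localBox α βbar χ rbar γ n ↔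
      x ∈ ball (0 : S.Eu n) (S.radius α βbar χ rbar n) ×ˢ
        ball (0 : S.Es n) (γ * S.radius α βbar χ rbar n) :=
  h.standing.join_mem_box_iff hn

/-- The ratio of the vertical to the horizontal expansion along a graph. -/
theorem slope_le (h : S.GraphSetup α L βbar χ rbar γ κbar s) {n : ℤ} (hn : n ≤ 0) :
    Real.exp (S.ls n) * γ + 4 * S.be n * S.radius α βbar χ rbar n ^ α ≤
      s * (Real.exp (S.lu n) - 4 * S.be n * S.radius α βbar χ rbar n ^ α) := by
  have h1 := h.eps_le_lu hn
  have h2 := h.eps_le_ls hn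
  have hs := h.s_pos
  have hs1 := h.s_le
  have hγ := h.gamma_le
  have h3 : Real.exp (S.ls n) ≤ Real.exp (2 * L) * Real.exp (S.lu n) := by
    rw [← Real.exp_add]
    refine Real.exp_le_exp.2 ?_
    linarith [(abs_le.1 (h.standing.abs_lu n hn)).1, (abs_le.1 (h.standing.abs_ls n hn)).2]
  have h4 := Real.exp_pos (S.lu n)
  have hγ0 := h.gamma_pos
  -- The worst ratio of the rates is `e^{2L}`, which the smallness of `γ` is chosen to beat.
  have h5 : Real.exp (S.ls n) * γ ≤ s / 2 * Real.exp (S.lu n) := by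
    calc Real.exp (S.ls n) * γ ≤ Real.exp (2 * L) * Real.exp (S.lu n) * γ := by gcongr
      _ = (Real.exp (2 * L) * γ) * Real.exp (S.lu n) := by ring
      _ ≤ s / 2 * Real.exp (S.lu n) := by gcongr; linarith
  have h6 : 4 * S.be n * S.radius α βbar χ rbar n ^ α ≤ s * (s / 2 * Real.exp (S.lu n)) := by
    calc _ ≤ s * (Real.exp (S.ls n) * γ) := by linarith
      _ ≤ _ := by gcongr
  have h7 : s * (s / 2 * Real.exp (S.lu n)) ≤ 1 / 10 * (s / 2 * Real.exp (S.lu n)) := by gcongr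
  have h8 : s * (4 * S.be n * S.radius α βbar χ rbar n ^ α) ≤
      1 / 10 * (s * (s / 2 * Real.exp (S.lu n))) := by
    have := h.eps_nonneg hn
    calc _ ≤ s * (s * (s / 2 * Real.exp (S.lu n))) := by gcongr
      _ ≤ _ := by gcongr
  nlinarith [mul_pos hs h4]

variable {ψ φ : ∀ n : ℤ, S.Eu n → S.Es n}

/-- Invariance only says that the next graph is covered. A point whose image lies over the next ball
must land on that graph, because the first coordinate is injective along the old one. -/
theorem graph_forward (h : S.GraphSetup α L βbar χ rbar γ κbar s)
    (hψ : GraphFamily S α βbar χ rbar κbar ψ) {n : ℤ} (hn : n < 0) {v : S.Eu n}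
    (hv : v ∈ ball (0 : S.Eu n) (S.radius α βbar χ rbar n))
    (hv' : (S.hat n (v, ψ n v)).1 ∈
      ball (0 : S.Eu (n + 1)) (S.radius α βbar χ rbar (n + 1))) :
    (S.hat n (v, ψ n v)).2 = ψ (n + 1) (S.hat n (v, ψ n v)).1 := by
  obtain ⟨A, B, hstep⟩ := h.exists_splitStep hn
  obtain ⟨u, hu, hu2⟩ := hψ.invariant n hn _ hv'
  have h1 := hstep.graph_expand (hψ.lipGraph h hn.le) hu hv
  rw [hu2, sub_self, norm_zero] at h1
  have h2 := (Real.exp_pos _).trans_le (h.mu_ge hn.le)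
  have h3 : ‖u - v‖ ≤ 0 := by
    by_contra hc
    push Not at hc
    have := mul_pos h2 hc
    linarith
  have h4 : u = v := by simpa [sub_eq_zero] using h3
  subst h4
  rw [hu2]

/-- The slope of the image graph is at most one, so the horizontal correction in `compare` costs no
more than the nonlinear error itself: hence the factor `2`. The error is measured at `‖x‖`, not at
`r_n`. -/
theorem compare_step (h : S.GraphSetup α L βbar χ rbar γ κbar s)
    (hψ : GraphFamily S α βbar χ rbar κbar ψ) {n : ℤ} (hn : n < 0) {x : S.Eu n × S.Es n}
    (hx : x ∈ ball (0 : S.Eu n) (S.radius α βbar χ rbar n) ×ˢ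
      ball (0 : S.Es n) (γ * S.radius α βbar χ rbar n))
    (hx' : (S.hat n x).1 ∈ ball (0 : S.Eu (n + 1)) (S.radius α βbar χ rbar (n + 1))) :
    ‖(S.hat n x).2 - ψ (n + 1) (S.hat n x).1‖ ≤
      (Real.exp (S.ls n) + 2 * (4 * S.be n * ‖x‖ ^ α)) * ‖x.2 - ψ n x.1‖ := by
  obtain ⟨A, B, hstep⟩ := h.exists_splitStep hn
  obtain ⟨u, hu, hu2⟩ := hψ.invariant n hn _ hx'
  have h1 := hstep.compare (hψ.lipGraph h hn.le) hx le_rfl hu (by rw [hu2])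
  rw [hu2] at h1
  refine h1.trans ?_
  have h2 := (Real.exp_pos _).trans_le (h.mu_ge hn.le)
  have h3 := h.slope_le hn.le
  have h4 : 0 ≤ 4 * S.be n * ‖x‖ ^ α := by
    have := h.standing.be_pos n hn.le
    positivity
  have h5 : (Real.exp (S.ls n) * γ + 4 * S.be n * S.radius α βbar χ rbar n ^ α) *
      (4 * S.be n * ‖x‖ ^ α) / (Real.exp (S.lu n) - 4 * S.be n * S.radius α βbar χ rbar n ^ α) ≤
      4 * S.be n * ‖x‖ ^ α := by
    rw [div_le_iff₀ h2, mul_comm]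
    gcongr
    have := h.s_le
    nlinarith
  exact mul_le_mul_of_nonneg_right (by linarith) (norm_nonneg _)

theorem expansion (h : S.GraphSetup α L βbar χ rbar γ κbar s)
    (hψ : GraphFamily S α βbar χ rbar κbar ψ) {χ' : ℝ} (hχ' : 6 * s ≤ χ - χ') {m n : ℤ}
    (hmn : m < n) (hn : n ≤ 0) {x y : Euc d}
    (hx : x ∈ S.graph m (S.radius α βbar χ rbar m) (ψ m) ∩
      S.orbitDomain (S.localBox α βbar χ rbar γ) m n)
    (hy : y ∈ S.graph m (S.radius α βbar χ rbar m) (ψ m) ∩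
      S.orbitDomain (S.localBox α βbar χ rbar γ) m n) :
    Real.exp (-S.M α βbar χ n) * Real.exp (((n : ℝ) - (m : ℝ)) * χ') * ‖x - y‖ ≤
      ‖S.F m n x - S.F m n y‖ := by
  obtain ⟨n, rfl⟩ : ∃ n', n = n' + 1 := ⟨n - 1, by ring⟩
  have hmn' : m ≤ n := by omega
  have hn0 : n < 0 := by omega
  let X : ∀ z : Euc d, ∀ k : ℤ, S.Eu k × S.Es k := fun z k => S.coord k (S.F m k z)
  have hXstep : ∀ z k, m ≤ k → k ≤ n → S.hat k (X z k) = X z (k + 1) := fun z k h1 h2 => by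
    show S.coord (k + 1) (S.f k (S.join k (S.coord k _))) = S.coord (k + 1) _
    rw [h.standing.join_coord (by omega), F_succ h1]
  have hXjoin : ∀ z k, k ≤ 0 → S.join k (X z k) = S.F m k z := fun z k hk =>
    h.standing.join_coord hk _
  have hgraph : ∀ z, z ∈ S.graph m (S.radius α βbar χ rbar m) (ψ m) ∩
      S.orbitDomain (S.localBox α βbar χ rbar γ) m (n + 1) → ∀ k, m ≤ k → k ≤ n →
      (X z k).1 ∈ ball (0 : S.Eu k) (S.radius α βbar χ rbar k) ∧
        X z k = ((X z k).1, ψ k (X z k).1) := by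
    intro z hz k hmk
    have hbox : ∀ k, m ≤ k → k ≤ n →
        (X z k).1 ∈ ball (0 : S.Eu k) (S.radius α βbar χ rbar k) := fun k h1 h2 => by
      have := F_mem_of_mem_orbitDomain hz.2 h1 (by omega)
      rw [← hXjoin z k (by omega), h.join_mem_localBox_iff (by omega)] at this
      exact this.1
    induction k, hmk using Int.leInduction with
    | base =>
      intro _
      refine ⟨hbox m le_rfl hmn', Prod.ext rfl ?_⟩
      have := hz.1
      rw [← F_self (S := S) m z, ← hXjoin z m (by omega), h.standing.join_mem_graph_iff (by omega)]
        at this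
      exact this.2
    | succ k hmk ih =>
      intro hk
      obtain ⟨h1, h2⟩ := ih (by omega)
      have h3 := hbox (k + 1) (by omega) hk
      refine ⟨h3, Prod.ext rfl ?_⟩
      have h4 := hXstep z k hmk (by omega)
      rw [h2] at h4
      rw [← h4] at h3 ⊢
      exact h.graph_forward hψ (by omega) h1 h3
  have hp : ∀ k, m ≤ k → k < n + 1 → Real.exp (S.lu k - 2 * s) * ‖(X x k).1 - (X y k).1‖ ≤
      ‖(X x (k + 1)).1 - (X y (k + 1)).1‖ := fun k h1 h2 => by
    obtain ⟨A, B, hstep⟩ := h.exists_splitStep (show k < 0 by omega)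
    obtain ⟨hx1, hx2⟩ := hgraph x hx k h1 (by omega)
    obtain ⟨hy1, hy2⟩ := hgraph y hy k h1 (by omega)
    have h3 := hstep.graph_expand (hψ.lipGraph h (by omega)) hx1 hy1
    rw [← hx2, ← hy2, hXstep x k h1 (by omega), hXstep y k h1 (by omega)] at h3
    refine le_trans ?_ h3
    gcongr
    exact h.mu_ge (by omega)
  have hprod := exp_sum_mul_le (δ := fun k => ‖(X x k).1 - (X y k).1‖)
    (g := fun k => S.lu k - 2 * s) (show m ≤ n + 1 by omega) hp
  have hs := h.s_pos
  have hs1 := h.s_le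
  have hγ := h.two_gamma_le
  set P := ‖(X x m).1 - (X y m).1‖ with hP
  set Q := ‖(X x (n + 1)).1 - (X y (n + 1)).1‖ with hQ
  have hP0 : 0 ≤ P := norm_nonneg _
  have hQ0 : 0 ≤ Q := norm_nonneg _
  have hstart : ‖x - y‖ ≤ (1 + s) * P := by
    obtain ⟨hx1, hx2⟩ := hgraph x hx m le_rfl hmn'
    obtain ⟨hy1, hy2⟩ := hgraph y hy m le_rfl hmn'
    have h1 := (hψ.lipGraph h (show m ≤ 0 by omega)).2 _ hx1 _ hy1
    have h2 : x - y = S.join m (X x m - X y m) := by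
      rw [map_sub, hXjoin x m (by omega), hXjoin y m (by omega), F_self, F_self]
    rw [h2, join_apply]
    refine (norm_add_le _ _).trans ?_
    have h3 : ‖(X x m - X y m).2‖ ≤ s * P := by
      have : (X x m - X y m).2 = ψ m (X x m).1 - ψ m (X y m).1 := by
        rw [Prod.snd_sub]; rw [hx2, hy2]
      rw [this]
      refine h1.trans ?_
      have := h.gamma_pos
      gcongr
      linarith
    have h4 : ‖(X x m - X y m).1‖ = P := rfl
    simp only [Submodule.coe_norm] at h3 h4 ⊢
    linarith
  -- The orbit domain does not restrict the point at the final time, so its image need not lie over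
  -- the ball of the last graph. The slope is instead controlled by one application of the map,
  -- through `slope_le`.
  have hend : (1 - s) * Q ≤ ‖S.F m (n + 1) x - S.F m (n + 1) y‖ := by
    obtain ⟨A, B, hstep⟩ := h.exists_splitStep hn0
    obtain ⟨hx1, hx2⟩ := hgraph x hx n hmn' le_rfl
    obtain ⟨hy1, hy2⟩ := hgraph y hy n hmn' le_rfl
    have h1 := hstep.graph_expand (hψ.lipGraph h hn0.le) hx1 hy1
    have h2 := hstep.graph_snd (hψ.lipGraph h hn0.le) hx1 hy1
    rw [← hx2, ← hy2, hXstep x n hmn' le_rfl, hXstep y n hmn' le_rfl] at h1 h2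
    have h3 : ‖(X x (n + 1)).2 - (X y (n + 1)).2‖ ≤ s * Q := by
      refine h2.trans ?_
      calc _ ≤ s * (Real.exp (S.lu n) - 4 * S.be n * S.radius α βbar χ rbar n ^ α) *
            ‖(X x n).1 - (X y n).1‖ := by
            gcongr; exact h.slope_le hn0.le
        _ = s * ((Real.exp (S.lu n) - 4 * S.be n * S.radius α βbar χ rbar n ^ α) *
            ‖(X x n).1 - (X y n).1‖) := by ring
        _ ≤ s * Q := by gcongr
    have h4 : S.F m (n + 1) x - S.F m (n + 1) y = S.join (n + 1) (X x (n + 1) - X y (n + 1)) := by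
      rw [map_sub, hXjoin x _ hn, hXjoin y _ hn]
    rw [h4, join_apply]
    have h5 := norm_sub_le_norm_add ((X x (n + 1) - X y (n + 1)).1 : Euc d)
      ((X x (n + 1) - X y (n + 1)).2 : Euc d)
    have h6 : ‖((X x (n + 1) - X y (n + 1)).1 : Euc d)‖ = Q := rfl
    have h7 : ‖((X x (n + 1) - X y (n + 1)).2 : Euc d)‖ ≤ s * Q := h3
    linarith
  refine le_trans ?_ hend
  have hM := h.standing.sum_le_M h.alpha_pos h.L_pos h.chi_lt (show m ≤ n + 1 by omega) hn
  have hlam : ∑ k ∈ Finset.Ico m (n + 1), (χ - S.lu k) ≤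
      ∑ k ∈ Finset.Ico m (n + 1), (χ - S.lamE α βbar k) :=
    Finset.sum_le_sum fun k _ => by linarith [S.lamE_le_lu α βbar k]
  have hcard : (((n + 1 - m).toNat : ℕ) : ℝ) = (((n + 1 : ℤ) : ℝ) - (m : ℝ)) := by
    have : (((n + 1 - m).toNat : ℕ) : ℤ) = (n + 1) - m := by omega
    exact_mod_cast this
  rw [Finset.sum_sub_distrib, Finset.sum_const, Int.card_Ico, nsmul_eq_mul, hcard] at hlam
  simp only [Finset.sum_sub_distrib, Finset.sum_const, Int.card_Ico, nsmul_eq_mul, hcard] at hprod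
  set N : ℝ := ((n + 1 : ℤ) : ℝ) - (m : ℝ) with hN
  have hN1 : 1 ≤ N := by
    have : (1 : ℤ) ≤ (n + 1) - m := by omega
    rw [hN]
    exact_mod_cast this
  set Λ := ∑ k ∈ Finset.Ico m (n + 1), S.lu k with hΛ
  have he1 := one_sub_ge_exp hs.le hs1
  -- The margin `χ - χ' ≥ 6 * s` pays `2 * s` at every step for the nonlinearity and, as `N ≥ 1`, a
  -- further `4 * s` once for passing between full and horizontal norms at the two ends.
  have hexp : Real.exp (-S.M α βbar χ (n + 1)) * Real.exp (N * χ') ≤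
      Real.exp (Λ - N * (2 * s)) * Real.exp (-(4 * s)) := by
    rw [← Real.exp_add, ← Real.exp_add]
    refine Real.exp_le_exp.2 ?_
    nlinarith [mul_le_mul_of_nonneg_left hχ' (show 0 ≤ N by linarith)]
  have he4 : Real.exp (-(4 * s)) * (1 + s) ≤ 1 - s := by
    have h1 : Real.exp (-(4 * s)) = Real.exp (-(2 * s)) * Real.exp (-(2 * s)) := by
      rw [← Real.exp_add]; ring_nf
    have h2 : Real.exp (-(2 * s)) * (1 + s) ≤ 1 := by
      calc _ ≤ (1 - s) * (1 + s) := by gcongr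
        _ ≤ 1 := by nlinarith
    rw [h1, mul_assoc]
    calc _ ≤ Real.exp (-(2 * s)) * 1 := by gcongr
      _ ≤ 1 - s := by linarith
  calc _ ≤ Real.exp (Λ - N * (2 * s)) * Real.exp (-(4 * s)) * ((1 + s) * P) := by gcongr
    _ = (Real.exp (-(4 * s)) * (1 + s)) * (Real.exp (Λ - N * (2 * s)) * P) := by ring
    _ ≤ (1 - s) * Q := by
        have : 0 ≤ 1 - s := by linarith
        gcongr

end GraphSetup

end MapSeq

/-! ### Uniqueness and backward characterisation -/

namespace MapSeq

variable {d : ℕ} {S : MapSeq d}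

namespace GraphSetup

variable {α L βbar χ rbar γ κbar s : ℝ} {ψ φ : ∀ n : ℤ, S.Eu n → S.Es n}

/-- A point of one invariant graph is pulled back along it, and `compare_step` for the other graph
bounds the change of the gap. Measuring the gap against `‖v‖` turns the rate `e^{λ^s}` into `e^{λ^s
- λ^u}`. The initial gap is `2 * γ * ‖v‖` by the Lipschitz bounds. -/
theorem norm_sub_graph_le (h : S.GraphSetup α L βbar χ rbar γ κbar s)
    (hψ : GraphFamily S α βbar χ rbar κbar ψ) (hφ : GraphFamily S α βbar χ rbar κbar φ) (j : ℕ) :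
    ∀ n ≤ 0, ∀ v ∈ ball (0 : S.Eu n) (S.radius α βbar χ rbar n), ‖ψ n v - φ n v‖ ≤
      2 * γ * Real.exp (∑ k ∈ Finset.Ico (n - j) n, (S.ls k - S.lu k + 4 * s)) * ‖v‖ := by
  induction j with
  | zero =>
    intro n hn v hv
    have h1 := (hψ.lipGraph h hn).norm_le hv
    have h2 := (hφ.lipGraph h hn).norm_le hv
    have h3 := norm_sub_le (ψ n v) (φ n v)
    simp only [Nat.cast_zero, sub_zero, Finset.Ico_self, Finset.sum_empty, Real.exp_zero, mul_one]
    linarith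
  | succ j ih =>
    intro n hn v' hv'
    obtain ⟨n, rfl⟩ : ∃ n', n = n' + 1 := ⟨n - 1, by ring⟩
    have hn0 : n < 0 := by omega
    obtain ⟨A, B, hstep⟩ := h.exists_splitStep hn0
    obtain ⟨v, hv, hv2⟩ := hψ.invariant n hn0 v' hv'
    have hmem := (hψ.lipGraph h hn0.le).mem h.gamma_pos hv
    have h1 := h.compare_step hφ hn0 hmem (by rw [hv2]; exact hv')
    rw [hv2] at h1
    have h2 := hstep.graph_expand (hψ.lipGraph h hn0.le) hv (mem_ball_self (h.radius_pos n))
    rw [hv2, hstep.fst_map_zero (hψ.lipGraph h hn0.le).1] at h2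
    simp only [Prod.fst_zero, sub_zero] at h2
    have h3 : Real.exp (S.lu n - 2 * s) * ‖v‖ ≤ ‖v'‖ :=
      (mul_le_mul_of_nonneg_right (h.mu_ge hn0.le) (norm_nonneg v)).trans h2
    have h4 : Real.exp (S.ls n) + 2 * (4 * S.be n * ‖((v, ψ n v) : S.Eu n × S.Es n)‖ ^ α) ≤
        Real.exp (S.ls n + 2 * s) := by
      have h5 : 4 * S.be n * ‖((v, ψ n v) : S.Eu n × S.Es n)‖ ^ α ≤ s * Real.exp (S.ls n) := by
        have h6 := h.standing.be_pos n hn0.le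
        have h7 := (hstep.norm_lt_of_mem hmem).le
        have h8 := h.alpha_pos
        have h9 := h.s_pos
        calc _ ≤ 4 * S.be n * S.radius α βbar χ rbar n ^ α := by gcongr
          _ ≤ s * γ * Real.exp (S.ls n) := h.eps_le_ls hn0.le
          _ ≤ s * 1 * Real.exp (S.ls n) := by gcongr; exact h.gamma_le_one
          _ = _ := by ring
      rw [Real.exp_add]
      nlinarith [Real.exp_pos (S.ls n), Real.add_one_le_exp (2 * s)]
    have h5 := ih n hn0.le v hv
    have h6 : n + 1 - ((j + 1 : ℕ) : ℤ) = n - j := by push_cast; ring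
    rw [h6, sum_Ico_top (by omega)]
    set T := ∑ k ∈ Finset.Ico (n - (j : ℤ)) n, (S.ls k - S.lu k + 4 * s)
    have hγ := h.gamma_pos
    calc ‖ψ (n + 1) v' - φ (n + 1) v'‖ ≤ _ := h1
      _ ≤ Real.exp (S.ls n + 2 * s) * (2 * γ * Real.exp T * ‖v‖) := by gcongr
      _ = 2 * γ * (Real.exp (S.ls n + 2 * s) * Real.exp T * Real.exp (-(S.lu n - 2 * s))) *
          (Real.exp (S.lu n - 2 * s) * ‖v‖) := by
          rw [Real.exp_neg]
          field_simp
      _ ≤ 2 * γ * (Real.exp (S.ls n + 2 * s) * Real.exp T * Real.exp (-(S.lu n - 2 * s))) *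
          ‖v'‖ := by gcongr
      _ = _ := by
          rw [← Real.exp_add, ← Real.exp_add]
          ring_nf

theorem eqOn_of_dominated (h : S.GraphSetup α L βbar χ rbar γ κbar s) {χg : ℝ} (hχg0 : 0 < χg)
    (hχg : 8 * s ≤ χg) (hdom : χg < S.chiG)
    (hψ : GraphFamily S α βbar χ rbar κbar ψ) (hφ : GraphFamily S α βbar χ rbar κbar φ) {n : ℤ}
    (hn : n ≤ 0) : EqOn (φ n) (ψ n) (ball (0 : S.Eu n) (S.radius α βbar χ rbar n)) := by
  obtain ⟨m₀, hm₀, hsum⟩ := eventually_sum_ge (a := fun k => S.lu k - S.ls k) (C := -(2 * L))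
    (fun k hk => by
      have h1 := (abs_le.1 (h.standing.abs_lu k hk.le)).1
      have h2 := (abs_le.1 (h.standing.abs_ls k hk.le)).2
      linarith) hdom
  intro v hv
  set K := ∑ k ∈ Finset.Ico n 0, (S.lu k - S.ls k) with hK
  have hbound : ∀ᶠ j : ℕ in atTop, ‖ψ n v - φ n v‖ ≤
      2 * γ * Real.exp (K + -(χg / 2) * j) * ‖v‖ := by
    filter_upwards [eventually_ge_atTop (n - m₀).toNat] with j hj
    refine (h.norm_sub_graph_le hψ hφ j n hn v hv).trans ?_
    have hγ := h.gamma_pos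
    gcongr
    have h1 := hsum (n - j) (by omega)
    have h2 := sum_Ico_split (a := fun k => S.lu k - S.ls k) (show n - (j : ℤ) ≤ n by omega) hn
    have h3 : ∑ k ∈ Finset.Ico (n - (j : ℤ)) n, (S.ls k - S.lu k + 4 * s) =
        -∑ k ∈ Finset.Ico (n - (j : ℤ)) n, (S.lu k - S.ls k) + 4 * s * j := by
      rw [Finset.sum_add_distrib, Finset.sum_const, Int.card_Ico, ← Finset.sum_neg_distrib,
        nsmul_eq_mul, show (n - (n - (j : ℤ))).toNat = j by omega]
      congr 1
      · exact Finset.sum_congr rfl fun k _ => by ring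
      · ring
    rw [h3, h2]
    push_cast at h1
    have h4 : (n : ℝ) ≤ 0 := by exact_mod_cast hn
    have h5 : χg * j ≤ χg * (-((n : ℝ) - j)) := by
      gcongr
      linarith
    -- Half of the domination gap absorbs the nonlinear error; the other half gives the decay.
    have h6 : 4 * s * j ≤ χg / 2 * j := by
      gcongr
      linarith
    linarith
  have hlim : Tendsto (fun j : ℕ => 2 * γ * Real.exp (K + -(χg / 2) * j) * ‖v‖) atTop (𝓝 0) := by
    have h1 : Tendsto (fun j : ℕ => K + -(χg / 2) * (j : ℝ)) atTop atBot :=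
      tendsto_atBot_add_const_left _ _
        (tendsto_natCast_atTop_atTop.const_mul_atTop_of_neg (by linarith))
    have := ((Real.tendsto_exp_atBot.comp h1).const_mul (2 * γ)).mul_const ‖v‖
    simpa using this
  have h0 : ‖ψ n v - φ n v‖ ≤ 0 := ge_of_tendsto hlim hbound
  exact (sub_eq_zero.1 (norm_le_zero_iff.1 h0)).symm

/-- The preimages are given separately for each `m`. Injectivity of the compositions links them into
one orbit, since `f_m (y m)` and `y (m + 1)` both reach `x` at time `n`. -/
theorem exists_backward_orbit (h : S.GraphSetup α L βbar χ rbar γ κbar s) {χ' C : ℝ} {n : ℤ}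
    (hn : n ≤ 0) {x : Euc d} (hx : x ∈ S.localBox α βbar χ rbar γ n)
    (hC : ∀ m ≤ n, ∃ y ∈ S.orbitDomain (S.localBox α βbar χ rbar γ) m n,
      S.F m n y = x ∧ ‖y‖ ≤ C * Real.exp (-(((n : ℝ) - (m : ℝ)) * χ'))) :
    ∃ Y : ∀ k : ℤ, S.Eu k × S.Es k, S.join n (Y n) = x ∧
      (∀ m ≤ n, Y m ∈ ball (0 : S.Eu m) (S.radius α βbar χ rbar m) ×ˢ
        ball (0 : S.Es m) (γ * S.radius α βbar χ rbar m)) ∧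
      (∀ m < n, S.hat m (Y m) = Y (m + 1)) ∧
      ∀ m ≤ n, ‖Y m‖ ≤ S.be (m - 1) * (C * Real.exp (-(((n : ℝ) - (m : ℝ)) * χ'))) := by
  have hC' : ∀ m, ∃ y, m ≤ n → y ∈ S.orbitDomain (S.localBox α βbar χ rbar γ) m n ∧
      S.F m n y = x ∧ ‖y‖ ≤ C * Real.exp (-(((n : ℝ) - (m : ℝ)) * χ')) := fun m => by
    by_cases hm : m ≤ n
    · obtain ⟨y, h1, h2⟩ := hC m hm
      exact ⟨y, fun _ => ⟨h1, h2⟩⟩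
    · exact ⟨0, fun hh => absurd hh hm⟩
  choose y hy using hC'
  have hyn : y n = x := by
    have := (hy n le_rfl).2.1
    rwa [F_self] at this
  have hbox : ∀ m ≤ n, y m ∈ S.localBox α βbar χ rbar γ m := fun m hm => by
    -- At `m = n` the orbit domain imposes no box condition, so the hypothesis on `x` supplies it.
    rcases eq_or_lt_of_le hm with rfl | hlt
    · rwa [hyn]
    · have := F_mem_of_mem_orbitDomain (hy m hm).1 le_rfl hlt
      rwa [F_self] at this
  have hstep : ∀ m < n, S.f m (y m) = y (m + 1) := fun m hm => by
    have hcomp : ∀ k, m + 1 ≤ k → S.F (m + 1) k (S.f m (y m)) = S.F m k (y m) := fun k hk => by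
      rw [← F_one, F_comp (by omega) hk]
    refine h.standing.F_injective (show m + 1 ≤ n by omega) hn (fun k h1 h2 => ?_)
      (fun k h1 h2 => ?_) ?_
    · rw [hcomp k h1]
      exact h.box_subset k (by omega)
        (F_mem_of_mem_orbitDomain (hy m hm.le).1 (by omega) h2)
    · exact h.box_subset k (by omega)
        (F_mem_of_mem_orbitDomain (hy (m + 1) (by omega)).1 h1 h2)
    · rw [hcomp n (by omega), (hy m hm.le).2.1, (hy (m + 1) (by omega)).2.1]
  have hjoin : ∀ m ≤ n, S.join m (S.coord m (y m)) = y m := fun m hm =>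
    h.standing.join_coord (by omega) _
  refine ⟨fun k => S.coord k (y k), by rw [hjoin n le_rfl, hyn], fun m hm => ?_, fun m hm => ?_,
    fun m hm => ?_⟩
  · rw [← h.join_mem_localBox_iff (by omega), hjoin m hm]
    exact hbox m hm
  · show S.coord (m + 1) (S.f m (S.join m (S.coord m (y m)))) = _
    rw [hjoin m hm.le, hstep m hm]
  · refine (h.standing.norm_le_be_mul_norm_join (by omega) _).trans ?_
    rw [hjoin m hm]
    have := h.standing.be_pos (m - 1) (by omega)
    gcongr
    exact (hy m hm).2.2

/-- Along a sequence of points of the local boxes which decays exponentially backward in time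
after multiplication by the angle, the nonlinearity becomes negligible. -/
theorem exists_forall_nonlinearity_le (h : S.GraphSetup α L βbar χ rbar γ κbar s) {χ' C : ℝ}
    (hχ' : 0 < χ') {n : ℤ} (hn : n ≤ 0) {ρ : ℤ → ℝ} (hρ0 : ∀ m ≤ n, 0 ≤ ρ m)
    (hρ : ∀ m ≤ n, ρ m ≤ S.radius α βbar χ rbar m)
    (hρ' : ∀ m ≤ n, ρ m ≤ S.be (m - 1) * (C * Real.exp (-(((n : ℝ) - (m : ℝ)) * χ'))))
    {τ : ℝ} (hτ : 0 < τ) : ∃ m₁ ≤ n, ∀ m ≤ m₁, 4 * S.be m * ρ m ^ α ≤ τ := by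
  have hα := h.alpha_pos
  have hβ := h.beta_pos
  have hr := h.rbar_pos
  have hχ := h.chi_pos
  have hL := h.L_pos
  have hlim1 : Tendsto (fun j : ℕ => 4 * (Real.exp L * βbar) * rbar ^ α *
      Real.exp (-(α * χ) * j)) atTop (𝓝 0) := by
    have h1 : Tendsto (fun j : ℕ => -(α * χ) * (j : ℝ)) atTop atBot :=
      tendsto_natCast_atTop_atTop.const_mul_atTop_of_neg (neg_lt_zero.2 (mul_pos hα hχ))
    have := (Real.tendsto_exp_atBot.comp h1).const_mul (4 * (Real.exp L * βbar) * rbar ^ α)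
    simpa using this
  obtain ⟨K, hK⟩ := (hlim1.eventually (gt_mem_nhds hτ)).exists
  set Q := βbar * Real.exp (L * K) with hQ
  have hQ0 : 0 < Q := by positivity
  have hlim2 : Tendsto (fun m : ℤ => 4 * (Real.exp L * Q) *
      (Q * (|C| * Real.exp (-(((n : ℝ) - (m : ℝ)) * χ')))) ^ α) atBot (𝓝 0) := by
    have h1 : Tendsto (fun m : ℤ => -(((n : ℝ) - (m : ℝ)) * χ')) atBot atBot := by
      have h2 : Tendsto (fun m : ℤ => χ' * (m : ℝ)) atBot atBot :=
        (tendsto_intCast_atBot_iff.2 tendsto_id).const_mul_atBot hχ'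
      refine (tendsto_atBot_add_const_left _ (-(n : ℝ) * χ') h2).congr fun m => ?_
      ring
    have h2 : Tendsto (fun m : ℤ => Q * (|C| * Real.exp (-(((n : ℝ) - (m : ℝ)) * χ')))) atBot
        (𝓝 0) := by
      have := ((Real.tendsto_exp_atBot.comp h1).const_mul |C|).const_mul Q
      simpa using this
    have h3 := (h2.rpow_const (Or.inr hα.le)).const_mul (4 * (Real.exp L * Q))
    rwa [Real.zero_rpow hα.ne', mul_zero] at h3
  obtain ⟨m₁, hm₁⟩ := eventually_atBot.1 (hlim2.eventually (gt_mem_nhds hτ))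
  refine ⟨min m₁ n, min_le_right _ _, fun m hm => ?_⟩
  have hmn : m ≤ n := hm.trans (min_le_right _ _)
  have hbe := h.be_le_prev (show m ≤ 0 by omega)
  have hbe0 := h.standing.be_pos m (by omega)
  have hbe1 := h.standing.be_pos (m - 1) (by omega)
  have hr0 := hρ0 m hmn
  obtain ⟨j, hj1, hj2⟩ := h.standing.exists_be_le hα hL h.chi_lt h.infinite (show m ≤ 0 by omega)
  -- If `β` was below the threshold at most `K` steps ago, it is bounded by `Q` and the backward
  -- decay makes the product small. If longer ago, the surplus `e^{-αχj}` does so, since `M` cancels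
  -- between `β` and the radius.
  rcases le_total j K with hjK | hjK
  · have h1 : S.be (m - 1) ≤ Q := hj1.trans (by rw [hQ]; gcongr)
    have h2 : ρ m ≤ Q * (|C| * Real.exp (-(((n : ℝ) - (m : ℝ)) * χ'))) := by
      refine (hρ' m hmn).trans ?_
      calc _ ≤ S.be (m - 1) * (|C| * Real.exp (-(((n : ℝ) - (m : ℝ)) * χ'))) := by
            gcongr; exact le_abs_self C
        _ ≤ _ := by gcongr
    calc 4 * S.be m * ρ m ^ α ≤ 4 * (Real.exp L * Q) *
          (Q * (|C| * Real.exp (-(((n : ℝ) - (m : ℝ)) * χ')))) ^ α := by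
          gcongr
          exact hbe.trans (by gcongr)
      _ ≤ τ := (hm₁ m (hm.trans (min_le_left _ _))).le
  · have h1 : ρ m ^ α ≤ rbar ^ α * Real.exp (-(α * S.M α βbar χ m)) := by
      rw [← h.radius_rpow]
      exact Real.rpow_le_rpow hr0 (hρ m hmn) hα.le
    calc 4 * S.be m * ρ m ^ α ≤ 4 * (Real.exp L * (βbar *
          Real.exp (α * S.M α βbar χ m - α * χ * j))) *
          (rbar ^ α * Real.exp (-(α * S.M α βbar χ m))) := by
          gcongr
          exact hbe.trans (by gcongr)
      _ = 4 * (Real.exp L * βbar) * rbar ^ α * Real.exp (-(α * χ) * j) := by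
          have : -(α * χ) * j = (α * S.M α βbar χ m - α * χ * j) + -(α * S.M α βbar χ m) := by
            ring
          rw [this, Real.exp_add]
          ring
      _ ≤ 4 * (Real.exp L * βbar) * rbar ^ α * Real.exp (-(α * χ) * K) := by
          have : (K : ℝ) ≤ j := by exact_mod_cast hjK
          gcongr ?_ * Real.exp ?_
          nlinarith [mul_pos hα hχ]
      _ ≤ τ := hK.le

/-- The vertical distance `δ` grows from `m` to `l` at a rate below `χ'`, while at times with
`β_{m-1} ≤ βbar` it starts no larger than a constant times `e^{-(n-m)χ'}`. Infinitely many such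
times force `δ l = 0`, and a zero distance stays zero. -/
theorem mem_graph_of_backward_decay (h : S.GraphSetup α L βbar χ rbar γ κbar s)
    (hψ : GraphFamily S α βbar χ rbar κbar ψ) {χ' C : ℝ} (hχ' : 0 < χ') (hχs : S.chiS < χ') {n : ℤ}
    (hn : n ≤ 0) {x : Euc d} (hx : x ∈ S.localBox α βbar χ rbar γ n)
    (hC : ∀ m ≤ n, ∃ y ∈ S.orbitDomain (S.localBox α βbar χ rbar γ) m n,
      S.F m n y = x ∧ ‖y‖ ≤ C * Real.exp (-(((n : ℝ) - (m : ℝ)) * χ'))) :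
    x ∈ S.graph n (S.radius α βbar χ rbar n) (ψ n) := by
  obtain ⟨Y, rfl, hYbox, hYstep, hYnorm⟩ := h.exists_backward_orbit hn hx hC
  set δ : ℤ → ℝ := fun m => ‖(Y m).2 - ψ m (Y m).1‖ with hδ
  have hstep : ∀ m < n, δ (m + 1) ≤ (Real.exp (S.ls m) + 2 * (4 * S.be m * ‖Y m‖ ^ α)) * δ m :=
    fun m hm => by
      have h1 := hYstep m hm
      have h2 := h.compare_step hψ (by omega) (hYbox m hm.le)
        (by rw [h1]; exact (hYbox (m + 1) (by omega)).1)
      rwa [h1] at h2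
  obtain ⟨q, hq1, hq2⟩ := exists_between hχs
  obtain ⟨m₀, hm₀, hsum⟩ := eventually_sum_le (a := S.ls) (C := L)
    (fun k hk => (abs_le.1 (h.standing.abs_ls k hk.le)).2) hq1
  have hL0 := Real.exp_pos L
  -- Chosen so that the error `2 * τ` is at most `e^{λ^s} (χ' - q) / 2`, raising the growth rate
  -- only to the midpoint of `q` and `χ'`.
  set τ := (χ' - q) / (4 * Real.exp L) with hτ
  have hτ0 : 0 < τ := div_pos (by linarith) (by positivity)
  obtain ⟨m₁, hm₁, hsmall⟩ := h.exists_forall_nonlinearity_le hχ' hn (ρ := fun m => ‖Y m‖)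
    (fun m _ => norm_nonneg _) (fun m hm => by
      have h1 : ‖(Y m).1‖ < S.radius α βbar χ rbar m := by simpa using (hYbox m hm).1
      have h2 : ‖(Y m).2‖ < γ * S.radius α βbar χ rbar m := by simpa using (hYbox m hm).2
      refine max_le h1.le (h2.le.trans ?_)
      have := h.radius_pos m
      have := h.gamma_le_one
      nlinarith) hYnorm hτ0
  set l := min m₁ m₀ with hl
  have hln : l ≤ n := (min_le_left _ _).trans hm₁
  have hdecay : ∀ m ≤ l, δ l ≤ Real.exp (∑ k ∈ Finset.Ico m l, (S.ls k + (χ' - q) / 2)) * δ m :=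
    fun m hm => le_exp_sum_mul hm fun k h1 h2 => by
      refine (hstep k (by omega)).trans (mul_le_mul_of_nonneg_right ?_ (norm_nonneg _))
      have h3 : 4 * S.be k * ‖Y k‖ ^ α ≤ τ := hsmall k (by omega)
      have h4 := h.exp_neg_L_le_ls (show k ≤ 0 by omega)
      have h5 : 2 * τ ≤ Real.exp (S.ls k) * ((χ' - q) / 2) := by
        have h6 : 2 * τ = Real.exp (-L) * ((χ' - q) / 2) := by
          rw [hτ, Real.exp_neg]; field_simp; ring
        rw [h6]
        have : 0 < (χ' - q) / 2 := by linarith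
        gcongr
      rw [Real.exp_add]
      nlinarith [Real.exp_pos (S.ls k), Real.add_one_le_exp ((χ' - q) / 2)]
  have hδle : ∀ m ≤ n, S.be (m - 1) ≤ βbar →
      δ m ≤ 2 * (βbar * (|C| * Real.exp (-(((n : ℝ) - (m : ℝ)) * χ')))) := fun m hm hb => by
    have h1 := (hψ.lipGraph h (show m ≤ 0 by omega)).norm_le (hYbox m hm).1
    have h2 := hYnorm m hm
    have h3 := norm_sub_le (Y m).2 (ψ m (Y m).1)
    have h4 := norm_fst_le (Y m)
    have h5 := norm_snd_le (Y m)
    have h6 : ‖Y m‖ ≤ βbar * (|C| * Real.exp (-(((n : ℝ) - (m : ℝ)) * χ'))) := by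
      refine h2.trans ?_
      have := h.standing.be_pos (m - 1) (by omega)
      have := h.beta_pos
      calc _ ≤ S.be (m - 1) * (|C| * Real.exp (-(((n : ℝ) - (m : ℝ)) * χ'))) := by
            gcongr; exact le_abs_self C
        _ ≤ _ := by gcongr
    have h7 : γ * ‖(Y m).1‖ ≤ ‖(Y m).1‖ :=
      mul_le_of_le_one_left (norm_nonneg _) h.gamma_le_one
    show ‖(Y m).2 - ψ m (Y m).1‖ ≤ _
    linarith
  -- `K` collects all terms of the exponent independent of `m`; what is left is `(χ' - q) / 2 * m`,
  -- tending to `-∞` with `m`.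
  set K : ℝ := -∑ k ∈ Finset.Ico l 0, S.ls k + (χ' - q) / 2 * l - n * χ' with hK
  have hbound : ∀ m ≤ l, S.be (m - 1) ≤ βbar →
      δ l ≤ 2 * (βbar * |C|) * Real.exp (K + (χ' - q) / 2 * m) := fun m hm hb => by
    have h1 := (hdecay m hm).trans (mul_le_mul_of_nonneg_left (hδle m (hm.trans hln) hb)
      (Real.exp_pos _).le)
    have h2 : ∑ k ∈ Finset.Ico m l, (S.ls k + (χ' - q) / 2) ≤
        q * (-(m : ℝ)) - ∑ k ∈ Finset.Ico l 0, S.ls k + (χ' - q) / 2 * (l - m) := by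
      rw [Finset.sum_add_distrib, Finset.sum_const, Int.card_Ico, nsmul_eq_mul,
        sum_Ico_split hm (by omega)]
      have h3 : (((l - m).toNat : ℕ) : ℝ) = (l : ℝ) - m := by
        have : (((l - m).toNat : ℕ) : ℤ) = l - m := by omega
        exact_mod_cast this
      rw [h3]
      have := hsum m (by omega)
      linarith
    have hβ := h.beta_pos
    calc δ l ≤ _ := h1
      _ = 2 * (βbar * |C|) * Real.exp (∑ k ∈ Finset.Ico m l, (S.ls k + (χ' - q) / 2) +
          -(((n : ℝ) - (m : ℝ)) * χ')) := by rw [Real.exp_add]; ring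
      _ ≤ _ := by
          refine mul_le_mul_of_nonneg_left (Real.exp_le_exp.2 ?_) (by positivity)
          rw [hK]
          linarith
  have hlim : Tendsto (fun m : ℤ => 2 * (βbar * |C|) * Real.exp (K + (χ' - q) / 2 * m)) atBot
      (𝓝 0) := by
    have h1 : Tendsto (fun m : ℤ => K + (χ' - q) / 2 * (m : ℝ)) atBot atBot :=
      tendsto_atBot_add_const_left _ _
        ((tendsto_intCast_atBot_iff.2 tendsto_id).const_mul_atBot (by linarith))
    have := (Real.tendsto_exp_atBot.comp h1).const_mul (2 * (βbar * |C|))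
    simpa using this
  have hδl : δ l ≤ 0 := by
    refine le_of_forall_pos_le_add fun ε hε => ?_
    obtain ⟨m₂, hm₂⟩ := eventually_atBot.1 (hlim.eventually (gt_mem_nhds hε))
    obtain ⟨m, hm, hb⟩ : ∃ m ≤ min l m₂, S.be (m - 1) ≤ βbar := by
      by_contra hcon
      push Not at hcon
      refine h.infinite ((finite_Icc (min l m₂) 0).subset fun m hm => ⟨?_, hm.1⟩)
      by_contra hlt
      have := hcon (m + 1) (by omega)
      rw [add_sub_cancel_right] at this
      exact absurd hm.2 (not_le.2 this)
    have h1 := hbound m (by omega) hb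
    have h2 := hm₂ m (by omega)
    linarith
  have hδn : ∀ k, l ≤ k → k ≤ n → δ k = 0 := by
    intro k hk
    induction k, hk using Int.leInduction with
    | base => exact fun _ => le_antisymm hδl (norm_nonneg _)
    | succ k hk ih =>
      intro hkn
      have h1 := hstep k (by omega)
      rw [ih (by omega), mul_zero] at h1
      exact le_antisymm h1 (norm_nonneg _)
  rw [h.standing.join_mem_graph_iff hn]
  exact ⟨(hYbox n le_rfl).1, sub_eq_zero.1 (norm_eq_zero.1 (hδn n hln le_rfl))⟩

end GraphSetup

end MapSeq

end LocalUnstableGraphs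

/-! ### Choice of thresholds and assembly -/

theorem theoremB (βbar L α χu χu' χg : ℝ) (hβ : 0 < βbar) (hL : 0 < L)
    (hα : 0 < α) (hα1 : α ≤ 1) (hχu' : 0 < χu') (hχu : χu' < χu) (hχg : 0 < χg) :
    ∃ γ₀ > 0, ∃ r₀ > 0, ∃ θ₀ > 0, ∃ κ₀ > 0,
      ∀ γbar rbar θbar κbar : ℝ,
        0 < γbar → γbar ≤ γ₀ → 0 < rbar → rbar ≤ r₀ → 0 < θbar → θbar ≤ θ₀ →
        κ₀ ≤ κbar → κbar * rbar ^ α ≤ γbar →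
      ∀ (d : ℕ) (S : MapSeq d),
        S.Standing α L →
        (∀ n ≤ 0, S.localBox α βbar χu rbar γbar n ⊆ S.Om n) →
        χu < S.chiE α βbar →
        {m : ℤ | m ≤ 0 ∧ S.be m ≤ βbar}.Infinite →
        -- density of the good times
        (((S.chiE α βbar - χu) / (L - χu)) ^ 2 ≤
            lowerDensity {n : ℤ | n ≤ 0 ∧ S.M α βbar χu n = 0} ∧
          0 < ((S.chiE α βbar - χu) / (L - χu)) ^ 2) ∧
        -- angles
        (∀ n ≤ 0, θbar * Real.exp (-(α * S.M α βbar χu n)) ≤ S.th n) ∧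
        ∃ ψ : ∀ n : ℤ, S.Eu n → S.Es n,
          -- invariant local unstable graphs
          S.InvariantFamily α βbar χu rbar κbar ψ ∧
          (∀ n ≤ 0, ∀ v ∈ Metric.ball (0 : S.Eu n) (S.radius α βbar χu rbar n),
            ‖fderiv ℝ (ψ n) v‖ ≤ γbar) ∧
          -- expansion along the graphs
          (∀ m n : ℤ, m < n → n ≤ 0 →
            ∀ x ∈ S.graph m (S.radius α βbar χu rbar m) (ψ m) ∩
                S.orbitDomain (S.localBox α βbar χu rbar γbar) m n,
            ∀ y ∈ S.graph m (S.radius α βbar χu rbar m) (ψ m) ∩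
                S.orbitDomain (S.localBox α βbar χu rbar γbar) m n,
              Real.exp (-S.M α βbar χu n) * Real.exp (((n : ℝ) - (m : ℝ)) * χu') * ‖x - y‖ ≤
                ‖S.F m n x - S.F m n y‖) ∧
          -- uniqueness under asymptotic domination
          (χg < S.chiG →
            ∀ φ : ∀ n : ℤ, S.Eu n → S.Es n, S.InvariantFamily α βbar χu rbar κbar φ →
              ∀ n ≤ 0, Set.EqOn (φ n) (ψ n)
                (Metric.ball (0 : S.Eu n) (S.radius α βbar χu rbar n))) ∧
          -- characterisation by backward exponential contraction
          (0 < S.chiG → S.chiS < χu' →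
            ∀ n ≤ 0, ∀ x ∈ S.localBox α βbar χu rbar γbar n, ∀ C : ℝ,
              (∀ m ≤ n, ∃ y ∈ S.orbitDomain (S.localBox α βbar χu rbar γbar) m n,
                S.F m n y = x ∧ ‖y‖ ≤ C * Real.exp (-(((n : ℝ) - (m : ℝ)) * χu'))) →
              x ∈ S.graph n (S.radius α βbar χu rbar n) (ψ n)) := by
  have hs0 : ∃ s : ℝ, 0 < s ∧ s ≤ 1 / 10 ∧ 30 * s ≤ α * χu ∧ 6 * s ≤ χu - χu' ∧ 8 * s ≤ χg := by
    have h1 : 0 < α * χu / 30 := by have := hχu'.trans hχu; positivity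
    -- The four entries serve, in order, the elementary estimates, the graph transform, expansion
    -- and uniqueness.
    refine ⟨min (min (1 / 10) (α * χu / 30)) (min ((χu - χu') / 6) (χg / 8)), ?_, ?_, ?_, ?_, ?_⟩
    · refine lt_min (lt_min (by norm_num) h1) (lt_min (by linarith) (by linarith))
    · exact (min_le_left _ _).trans (min_le_left _ _)
    · linarith [(min_le_left (min (1 / 10) (α * χu / 30))
        (min ((χu - χu') / 6) (χg / 8))).trans (min_le_right _ _)]
    · linarith [(min_le_right (min (1 / 10) (α * χu / 30))
        (min ((χu - χu') / 6) (χg / 8))).trans (min_le_left _ _)]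
    · linarith [(min_le_right (min (1 / 10) (α * χu / 30))
        (min ((χu - χu') / 6) (χg / 8))).trans (min_le_right _ _)]
  obtain ⟨s, hs, hs1, hs2, hs3, hs4⟩ := hs0
  -- The slope and Hölder thresholds are what `gamma_le` and `kappa_ge` require, and `βbar⁻¹` comes
  -- from `th_ge`. The radius threshold `1` is arbitrary: smallness of the radius comes from `κbar *
  -- rbar ^ α ≤ γbar`.
  refine ⟨s / (2 * Real.exp (2 * L)), by positivity, 1, one_pos, βbar⁻¹, by positivity,
    4 * Real.exp (2 * L) * βbar / s, by positivity, ?_⟩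
  intro γbar rbar θbar κbar hγ hγ1 hr _ _ hθ1 hκ hκr d S hS hbox hχe hinf
  have hχu0 : 0 < χu := hχu'.trans hχu
  have h : S.GraphSetup α L βbar χu rbar γbar κbar s :=
    { standing := hS
      alpha_pos := hα
      alpha_le := hα1
      L_pos := hL
      beta_pos := hβ
      chi_pos := hχu0
      chi_lt := hχe
      infinite := hinf
      gamma_pos := hγ
      rbar_pos := hr
      kappa_rbar := hκr
      s_pos := hs
      s_le := hs1
      s_chi := hs2
      kappa_ge := by
        rw [div_le_iff₀ hs] at hκ
        linarith
      gamma_le := by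
        rw [le_div_iff₀ (by positivity)] at hγ1
        linarith
      box_subset := hbox }
  have hLχ : 0 < L - χu := by linarith [hS.chiE_le hα hL (βbar := βbar)]
  have hq0 : 0 < (S.chiE α βbar - χu) / (L - χu) := div_pos (sub_pos.2 hχe) hLχ
  have hq1 : (S.chiE α βbar - χu) / (L - χu) ≤ 1 := by
    rw [div_le_one hLχ]
    linarith [hS.chiE_le hα hL (βbar := βbar)]
  refine ⟨⟨le_trans ?_ (hS.lowerDensity_ge hα hL hχe), by positivity⟩, fun n hn => ?_, ?_⟩
  · rw [sq]
    exact mul_le_of_le_one_left hq0.le hq1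
  · refine le_trans ?_ (hS.th_ge hα hL hχu0.le hβ hχe hinf hn)
    gcongr
  obtain ⟨ψ, hψ⟩ := h.exists_graphFamily
  refine ⟨ψ, h.invariantFamily_iff.2 hψ, fun n hn v hv => ?_, fun m n hmn hn x hx y hy => ?_,
    fun hdom φ hφ n hn => ?_, fun _ hχs n hn x hx C hC => ?_⟩
  · exact (hψ.tangent n hn).norm_fderiv_le hα (h.holderBound_pos n).le
      (h.holderBound_mul_radius n) hv
  · exact h.expansion hψ hs3 hmn hn hx hy
  · exact h.eqOn_of_dominated hχg hs4 hdom hψ (h.invariantFamily_iff.1 hφ) hn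
  · exact h.mem_graph_of_backward_decay hψ hχu' hχs hn hx hC
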